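/- Let $B_0>0$, let $g:\mathbb R_+\to\mathbb R_+$ and $\omega:\mathbb R\to\mathbb R_+$ be measurable functions, and put $$f(x_1,x_2)=-\int_{x_1}^{\infty} g\Big(\sqrt{t^2+x_2^2}\Big)\,\mathrm dt,$$ where the integral is assumed to converge absolutely for all $(x_1,x_2)\in\mathbb R^2$. Assume that (i) $g\in L^\infty(\mathbb R_+)$, $g\ge 0$ a.e., both $f$ and its weak derivative $\partial_{x_2}f$ belong to $L^\infty(\mathbb R^2)$, and for every $c\in\mathbb R$ $$|\partial_{x_2}f(x_1,x_2)|+|f(x_1,x_2)|\to 0\quad\text{as } x_1^2+x_2^2\to\infty \text{ with } x_1\ge -c$$ (in the essential, i.e. almost-everywhere, sense; in particular this holds if the limit is zero without the restriction $x_1\ge -c$); (ii) $\omega\ge 0$ a.e., $\omega\in L^2(\mathbb R)\cap L^\infty(\mathbb R)$, $\|\omega\|_\infty\|g\|_\infty\le B_0$, and $\omega(x_3)\to0$ (essentially) as $|x_3|\to\infty$. Let $\mathcal H(B)$ be the self-adjoint operator $$\mathcal H(B)=-\partial_{x_1}^2+\big(i\partial_{x_2}+B_0x_1-\omega(x_3)f(x_1,x_2)\big)^2-\partial_{x_3}^2$$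 in $L^2(\mathbb R^3)$, i.e. the operator associated with the closure of the quadratic form $$\varphi\mapsto\|\partial_{x_1}\varphi\|^2+\|(i\partial_{x_2}+B_0x_1-\omega f)\varphi\|^2+\|\partial_{x_3}\varphi\|^2,\qquad \varphi\in C_c^\infty(\mathbb R^3).$$ Then the essential spectrum of $\mathcal H(B)$, that is, the set of $z\in\mathbb C$ for which $\mathcal H(B)-z$ is not a Fredholm operator, is $$\sigma_{\mathrm{ess}}(\mathcal H(B))=[B_0,\infty).$$ -/

import Mathlib

open MeasureTheory Set Filter Topology
open scoped ContDiff ENNReal ComplexConjugate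

namespace MagneticHole

noncomputable section

/-- Configuration space `ℝ³` with coordinates `x = (x.1, x.2.1, x.2.2)`; its `volume` is the
three-dimensional Lebesgue measure. -/
abbrev Space : Type := ℝ × ℝ × ℝ

/-- The coordinate directions of `ℝ³`. -/
def dir : Fin 3 → Space := ![(1, 0, 0), (0, 1, 0), (0, 0, 1)]

/-- The Hilbert space `L²(ℝ³)` of complex-valued functions. -/
abbrev L2 : Type := Lp ℂ 2 (volume : Measure Space)

/-- Test functions: the elements of `C_c^∞(E)`. -/
def IsTest {E F : Type*} [NormedAddCommGroup E] [NormedSpace ℝ E] [NormedAddCommGroup F]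
    [NormedSpace ℝ F] (φ : E → F) : Prop :=
  ContDiff ℝ ∞ φ ∧ HasCompactSupport φ

/-- The `j`-th component `(i ∂ⱼ + Aⱼ) φ` of the magnetic gradient of a smooth function `φ`. -/
def magD (A : Space → Fin 3 → ℝ) (φ : Space → ℂ) (j : Fin 3) (x : Space) : ℂ :=
  Complex.I * fderiv ℝ φ x (dir j) + (A x j : ℂ) * φ x

/-- The graph of the magnetic gradient `φ ↦ ((i ∂ⱼ + Aⱼ) φ)ⱼ` on test functions, regarded as an
operator from `L²(ℝ³)` to `L²(ℝ³)³`. -/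
def gradGraph (A : Space → Fin 3 → ℝ) : Submodule ℂ (L2 × (Fin 3 → L2)) where
  carrier := {p | ∃ φ : Space → ℂ, IsTest φ ∧ p.1 =ᵐ[volume] φ ∧
    ∀ j, p.2 j =ᵐ[volume] magD A φ j}
  add_mem' := by
    rintro ⟨u, d⟩ ⟨u', d'⟩ ⟨φ, hφ, hu, hd⟩ ⟨ψ, hψ, hu', hd'⟩
    refine ⟨φ + ψ, ⟨hφ.1.add hψ.1, hφ.2.add hψ.2⟩, ?_, fun j => ?_⟩
    · exact (Lp.coeFn_add u u').trans (hu.add hu')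
    · refine (Lp.coeFn_add (d j) (d' j)).trans (((hd j).add (hd' j)).trans ?_)
      refine Eventually.of_forall fun x => ?_
      have h1 : DifferentiableAt ℝ φ x := (hφ.1.differentiable (by simp)) x
      have h2 : DifferentiableAt ℝ ψ x := (hψ.1.differentiable (by simp)) x
      simp only [magD, Pi.add_apply, fderiv_add h1 h2, _root_.add_apply]
      ring
  zero_mem' := by
    refine ⟨0, ⟨contDiff_const, HasCompactSupport.zero⟩, Lp.coeFn_zero _ _ _, fun j => ?_⟩
    refine (Lp.coeFn_zero ℂ 2 _).trans (Eventually.of_forall fun x => ?_)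
    simp [magD]
  smul_mem' := by
    rintro c ⟨u, d⟩ ⟨φ, hφ, hu, hd⟩
    refine ⟨c • φ, ⟨hφ.1.const_smul c, hφ.2.smul_left⟩, ?_, fun j => ?_⟩
    · exact (Lp.coeFn_smul c u).trans (hu.const_smul c)
    · refine (Lp.coeFn_smul c (d j)).trans (((hd j).const_smul c).trans ?_)
      refine Eventually.of_forall fun x => ?_
      have h1 : DifferentiableAt ℝ φ x := (hφ.1.differentiable (by simp)) x
      simp only [magD, Pi.smul_apply, fderiv_const_smul h1, _root_.smul_apply,
        smul_eq_mul]
      ring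

/-- The graph of the self-adjoint operator associated with the closure of the quadratic form
`q[φ] = ∑ⱼ ‖(i ∂ⱼ + Aⱼ) φ‖²` on `C_c^∞(ℝ³)`. A pair `(u, w)` lies in it iff `u` is in the domain
of the closed form, with magnetic gradient `v` (that is, `(u, v)` is a limit of pairs
`(φ, ((i ∂ⱼ + Aⱼ) φ)ⱼ)` with `φ` a test function), and `q(ψ, u) = ⟪ψ, w⟫` for all test
functions `ψ`. -/
def operatorGraph (A : Space → Fin 3 → ℝ) : Submodule ℂ (L2 × L2) where
  carrier := {p | ∃ v : Fin 3 → L2, (p.1, v) ∈ (gradGraph A).topologicalClosure ∧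
    ∀ q ∈ gradGraph A, ∑ j, inner ℂ (q.2 j) (v j) = inner ℂ q.1 p.2}
  add_mem' := by
    rintro ⟨u, w⟩ ⟨u', w'⟩ ⟨v, hv, h⟩ ⟨v', hv', h'⟩
    refine ⟨v + v', by simpa using add_mem hv hv', fun q hq => ?_⟩
    simp [inner_add_right, Finset.sum_add_distrib, ← h q hq, ← h' q hq]
  zero_mem' := ⟨0, zero_mem _, by simp⟩
  smul_mem' := by
    rintro c ⟨u, w⟩ ⟨v, hv, h⟩
    refine ⟨c • v, by simpa using Submodule.smul_mem _ c hv, fun q hq => ?_⟩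
    simp [inner_smul_right, ← Finset.mul_sum, ← h q hq]

/-- The magnetic Schrödinger operator `(i ∇ + A)²` in `L²(ℝ³)`: the operator associated with the
closure of the form `∑ⱼ ‖(i ∂ⱼ + Aⱼ) φ‖²` on `C_c^∞(ℝ³)`. (That `operatorGraph A` is
single-valued for locally square integrable `A` is `operatorGraph_single_valued` below.) -/
def magneticOperator (A : Space → Fin 3 → ℝ) : L2 →ₗ.[ℂ] L2 :=
  (operatorGraph A).toLinearPMap

/-- The operator `T - z` is Fredholm: finite-dimensional kernel, closed range, and range of
finite codimension. -/
def IsFredholmAt {H : Type*} [NormedAddCommGroup H] [NormedSpace ℂ H] (T : H →ₗ.[ℂ] H)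
    (z : ℂ) : Prop :=
  FiniteDimensional ℂ (LinearMap.ker (T.toFun - z • T.domain.subtype)) ∧
  IsClosed (LinearMap.range (T.toFun - z • T.domain.subtype) : Set H) ∧
  FiniteDimensional ℂ (H ⧸ LinearMap.range (T.toFun - z • T.domain.subtype))

/-- The essential spectrum: all `z ∈ ℂ` for which `T - z` is not Fredholm. For a self-adjoint
operator this is the spectrum without the isolated eigenvalues of finite multiplicity. -/
def essSpectrum {H : Type*} [NormedAddCommGroup H] [NormedSpace ℂ H] (T : H →ₗ.[ℂ] H) : Set ℂ :=
  {z | ¬ IsFredholmAt T z}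

/-- `f(x₁, x₂) = -∫_{x₁}^∞ g(√(t² + x₂²)) dt`. -/
def fluxPot (g : ℝ → ℝ) (x₁ x₂ : ℝ) : ℝ :=
  -∫ t in Ioi x₁, g (√(t ^ 2 + x₂ ^ 2))

/-- The vector potential `A = (0, B₀ x₁ - η(x₃) f(x₁, x₂), 0)`. -/
def vectorPotential (B₀ : ℝ) (g η : ℝ → ℝ) (x : Space) : Fin 3 → ℝ :=
  ![0, B₀ * x.1 - η x.2.2 * fluxPot g x.1 x.2.1, 0]

/-- The operator `𝓗(B) = -∂₁² + (i ∂₂ + B₀ x₁ - η(x₃) f(x₁, x₂))² - ∂₃²` in `L²(ℝ³)`. -/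
def magneticHamiltonian (B₀ : ℝ) (g η : ℝ → ℝ) : L2 →ₗ.[ℂ] L2 :=
  magneticOperator (vectorPotential B₀ g η)

/-- `h` is the weak partial derivative `∂₂ f` on `ℝ²`. -/
def IsWeakDerivSnd (f h : ℝ × ℝ → ℝ) : Prop :=
  ∀ φ : ℝ × ℝ → ℝ, IsTest φ → ∫ p, f p * fderiv ℝ φ p (0, 1) = -∫ p, h p * φ p

/-- Assumption on `g`: it is a non-negative element of `L^∞(ℝ₊)`, the integral defining
`f = fluxPot g` converges, `f` and `∂₂ f` belong to `L^∞(ℝ²)`, and `|∂₂ f| + |f|` tends to zero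
(essentially) as `x₁² + x₂² → ∞` in every half-plane `{x₁ ≥ -c}`. -/
def AssumptionI (g : ℝ → ℝ) : Prop :=
  MemLp g ∞ (volume.restrict (Ioi 0)) ∧
  (∀ᵐ r ∂(volume.restrict (Ioi (0 : ℝ))), 0 ≤ g r) ∧
  (∀ x₁ x₂ : ℝ, IntegrableOn (fun t => g (√(t ^ 2 + x₂ ^ 2))) (Ioi x₁)) ∧
  MemLp (fun p : ℝ × ℝ => fluxPot g p.1 p.2) ∞ volume ∧
  ∃ h : ℝ × ℝ → ℝ, MemLp h ∞ volume ∧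
    IsWeakDerivSnd (fun p => fluxPot g p.1 p.2) h ∧
    ∀ c ε : ℝ, 0 < ε → ∃ R : ℝ, ∀ᵐ p : ℝ × ℝ, -c ≤ p.1 → R ≤ p.1 ^ 2 + p.2 ^ 2 →
      |h p| + |fluxPot g p.1 p.2| ≤ ε

/-- Assumption on `η`: it is a non-negative element of `L²(ℝ) ∩ L^∞(ℝ)`,
`‖η‖_∞ ‖g‖_∞ ≤ B₀`, and `η(x₃) → 0` (essentially) as `|x₃| → ∞`. -/
def AssumptionII (B₀ : ℝ) (g η : ℝ → ℝ) : Prop :=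
  (∀ᵐ s : ℝ, 0 ≤ η s) ∧ MemLp η 2 volume ∧ MemLp η ∞ volume ∧
  eLpNorm η ∞ volume * eLpNorm g ∞ (volume.restrict (Ioi 0)) ≤ ENNReal.ofReal B₀ ∧
  ∀ ε : ℝ, 0 < ε → ∃ R : ℝ, ∀ᵐ s : ℝ, R ≤ |s| → η s ≤ ε

/-! ### The operator is well defined -/

theorem isAddHaarMeasure_volume : (volume : Measure Space).IsAddHaarMeasure :=
  have : (volume : Measure (ℝ × ℝ)).IsAddHaarMeasure :=
    Measure.prod.instIsAddHaarMeasure volume volume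
  Measure.prod.instIsAddHaarMeasure volume volume

theorem integral_parts {φ ψ : Space → ℂ} (hφ : IsTest φ) (hψ : IsTest ψ) (v : Space) :
    ∫ x, (fderiv ℝ φ x v) * ψ x = -∫ x, φ x * fderiv ℝ ψ x v := by
  have d1 := hφ.1.differentiable (by simp)
  have d2 := hψ.1.differentiable (by simp)
  have c1 : Continuous fun x => fderiv ℝ φ x v :=
    (hφ.1.continuous_fderiv (by simp)).clm_apply continuous_const
  have c2 : Continuous fun x => fderiv ℝ ψ x v :=
    (hψ.1.continuous_fderiv (by simp)).clm_apply continuous_const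
  have := isAddHaarMeasure_volume
  have := integral_mul_fderiv_eq_neg_fderiv_mul_of_integrable (𝕜 := ℂ) (μ := (volume : Measure Space))
    (f := φ) (g := ψ) (v := v)
    ((c1.mul hψ.1.continuous).integrable_of_hasCompactSupport hψ.2.mul_left)
    ((hφ.1.continuous.mul c2).integrable_of_hasCompactSupport hφ.2.mul_right)
    ((hφ.1.continuous.mul hψ.1.continuous).integrable_of_hasCompactSupport hψ.2.mul_left)
    (fun x _ => d1 x) (fun x _ => d2 x)
  rw [this, neg_neg]

theorem magD_symm {A : Space → Fin 3 → ℝ} {φ ψ : Space → ℂ} (hφ : IsTest φ) (hψ : IsTest ψ)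
    (j : Fin 3) (hA : MemLp (fun x => (A x j : ℂ) * φ x) 2 volume) :
    ∫ x, conj (magD A φ j x) * ψ x = ∫ x, conj (φ x) * magD A ψ j x := by
  have hc : IsTest fun x => conj (φ x) :=
    ⟨Complex.conjCLE.contDiff.comp hφ.1, hφ.2.comp_left (g := conj) (map_zero _)⟩
  have hψ2 : MemLp ψ 2 volume := hψ.1.continuous.memLp_of_hasCompactSupport hψ.2
  have c1 : Continuous fun x => fderiv ℝ (fun x => conj (φ x)) x (dir j) :=
    (hc.1.continuous_fderiv (by simp)).clm_apply continuous_const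
  have c2 : Continuous fun x => fderiv ℝ ψ x (dir j) :=
    (hψ.1.continuous_fderiv (by simp)).clm_apply continuous_const
  have hd : ∀ x, conj (fderiv ℝ φ x (dir j)) = fderiv ℝ (fun x => conj (φ x)) x (dir j) := by
    intro x
    have := Complex.conjCLE.toContinuousLinearMap.hasFDerivAt.comp x
      ((hφ.1.differentiable (by simp)) x).hasFDerivAt
    have h2 : fderiv ℝ (fun x => conj (φ x)) x = _ := this.fderiv
    rw [h2]; simp
  have i0 : Integrable (fun x => conj (φ x) * ((A x j : ℂ) * ψ x)) volume := by
    have h1 : MemLp (fun x => conj ((A x j : ℂ) * φ x)) 2 volume := by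
      refine hA.of_le (Complex.continuous_conj.comp_aestronglyMeasurable hA.1) ?_
      exact Eventually.of_forall fun x => by simp
    have := h1.integrable_mul hψ2
    refine this.congr (Eventually.of_forall fun x => ?_)
    simp; ring
  have i1 : Integrable (fun x => fderiv ℝ (fun x => conj (φ x)) x (dir j) * ψ x) volume :=
    (c1.mul hψ.1.continuous).integrable_of_hasCompactSupport hψ.2.mul_left
  have i2 : Integrable (fun x => conj (φ x) * fderiv ℝ ψ x (dir j)) volume :=
    (hc.1.continuous.mul c2).integrable_of_hasCompactSupport hc.2.mul_right
  have e1 : ∀ x, conj (magD A φ j x) * ψ x =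
      (-Complex.I) * (fderiv ℝ (fun x => conj (φ x)) x (dir j) * ψ x) +
        conj (φ x) * ((A x j : ℂ) * ψ x) := by
    intro x
    simp only [magD, map_add, map_mul, Complex.conj_I, Complex.conj_ofReal, hd]
    ring
  have e2 : ∀ x, conj (φ x) * magD A ψ j x =
      Complex.I * (conj (φ x) * fderiv ℝ ψ x (dir j)) + conj (φ x) * ((A x j : ℂ) * ψ x) := by
    intro x
    simp only [magD]
    ring
  simp_rw [e1, e2]
  rw [integral_add (i1.const_mul _) i0, integral_add (i2.const_mul _) i0, integral_const_mul,
    integral_const_mul, integral_parts hc hψ]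
  ring

theorem eq_zero_of_orthogonal_test (v : L2)
    (h : ∀ φ : Space → ℂ, IsTest φ → ∫ x, conj (φ x) * v x = 0) : v = 0 := by
  rw [Lp.eq_zero_iff_ae_eq_zero]
  have hl : LocallyIntegrable (fun x => v x) (volume : Measure Space) :=
    (Lp.memLp v).locallyIntegrable (by norm_num)
  refine ae_eq_zero_of_integral_contDiff_smul_eq_zero hl fun g hg hs => ?_
  have := h (fun x => (g x : ℂ)) ⟨Complex.ofRealCLM.contDiff.comp hg,
    hs.comp_left (g := fun r : ℝ => (r : ℂ)) Complex.ofReal_zero⟩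
  simpa using this

/-- For `A` locally square integrable, the relation defining `magneticOperator A` is the graph of
an operator. -/
theorem operatorGraph_single_valued {A : Space → Fin 3 → ℝ}
    (hA : ∀ φ : Space → ℂ, IsTest φ → ∀ j, MemLp (fun x => (A x j : ℂ) * φ x) 2 volume) :
    ∀ p ∈ operatorGraph A, p.1 = 0 → p.2 = 0 := by
  have key : ∀ φ : Space → ℂ, IsTest φ → ∃ q ∈ gradGraph A, q.1 =ᵐ[volume] φ := by
    intro φ hφ
    have m0 : MemLp φ 2 volume := hφ.1.continuous.memLp_of_hasCompactSupport hφ.2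
    have m1 : ∀ j, MemLp (magD A φ j) 2 volume := by
      intro j
      have c1 : Continuous fun x => fderiv ℝ φ x (dir j) :=
        (hφ.1.continuous_fderiv (by simp)).clm_apply continuous_const
      have : MemLp (fun x => fderiv ℝ φ x (dir j)) 2 volume :=
        c1.memLp_of_hasCompactSupport (hφ.2.fderiv_apply ℝ (dir j))
      exact (this.const_mul Complex.I).add (hA φ hφ j)
    exact ⟨(m0.toLp φ, fun j => (m1 j).toLp _), ⟨φ, hφ, m0.coeFn_toLp, fun j => (m1 j).coeFn_toLp⟩,
      m0.coeFn_toLp⟩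
  have hin : ∀ (φ : Space → ℂ) (u v : L2), u =ᵐ[volume] φ →
      inner ℂ u v = ∫ x, conj (φ x) * v x := by
    intro φ u v hu
    rw [L2.inner_def]
    refine integral_congr_ae ?_
    filter_upwards [hu] with x hx
    simp [hx, mul_comm]
  have sym : ∀ q ∈ gradGraph A, ∀ p ∈ gradGraph A, ∀ j,
      inner ℂ (q.2 j) p.1 = inner ℂ q.1 (p.2 j) := by
    rintro q ⟨φ, hφ, hu, hd⟩ p ⟨ψ, hψ, hu', hd'⟩ j
    rw [hin _ _ _ (hd j), hin _ _ _ hu]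
    have a1 : ∫ x, conj (magD A φ j x) * p.1 x = ∫ x, conj (magD A φ j x) * ψ x :=
      integral_congr_ae (by filter_upwards [hu'] with x hx; rw [hx])
    have a2 : ∫ x, conj (φ x) * p.2 j x = ∫ x, conj (φ x) * magD A ψ j x :=
      integral_congr_ae (by filter_upwards [hd' j] with x hx; rw [hx])
    rw [a1, a2, magD_symm hφ hψ j (hA φ hφ j)]
  have symc : ∀ q ∈ gradGraph A, ∀ p ∈ (gradGraph A).topologicalClosure, ∀ j,
      inner ℂ (q.2 j) p.1 = inner ℂ q.1 (p.2 j) := by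
    intro q hq p hp j
    have hcl : IsClosed {p : L2 × (Fin 3 → L2) | inner ℂ (q.2 j) p.1 = inner ℂ q.1 (p.2 j)} :=
      isClosed_eq (by fun_prop) (by fun_prop)
    exact hcl.closure_subset_iff.2 (fun p hp => sym q hq p hp j) hp
  rintro ⟨u, w⟩ ⟨v, hv, h⟩ (rfl : u = 0)
  have hv0 : ∀ j, v j = 0 := by
    intro j
    refine eq_zero_of_orthogonal_test _ fun φ hφ => ?_
    obtain ⟨q, hq, hqφ⟩ := key φ hφ
    have := symc q hq _ hv j
    rw [← hin φ q.1 _ hqφ, ← this]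
    simp
  refine eq_zero_of_orthogonal_test _ fun φ hφ => ?_
  obtain ⟨q, hq, hqφ⟩ := key φ hφ
  rw [← hin φ q.1 _ hqφ, ← h q hq]
  simp [hv0]

end

end MagneticHole

/-! Everything is read off a bounded operator. Let `J` embed the form domain, with norm `(‖u‖² +
q(u))^{1/2}`, into `L²`. Then `J J†` is the inverse of `T + 1`, so `T - z` is Fredholm exactly when
`1 - (1 + z) J J†` is (`isFredholmAt_iff`, `mem_operatorGraph_iff`). Off the real axis this operator
and its adjoint are bounded below. On the real axis two criteria stated on test functions suffice: a
form bound modulo finitely many functionals gives Fredholmness (`isFredholmAt_of_form_bound`), and a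
Weyl sequence with small residual in the dual form norm excludes it
(`not_isFredholmAt_of_form_weyl`).

Below `B₀`: integrating `|D₁φ + i D₂φ|² ≥ 0` gives formally `‖D₁φ‖² + ‖D₂φ‖² ≥ ∫ ∂₁A₂ |φ|²`. Here
`∂₁A₂` involves `g`, which need not decay pointwise, so only a regular part of `A₂` is
differentiated. Because the integrand of `f` is even in `t`, `f(x₁, x₂) + f(-x₁, x₂)` is the line
flux `2 f(0, x₂)`; decay of `f` on half-planes bounded to the left therefore gives `f - lineFlux →
0` on the other side. With a smooth step `θ` in `x₁`, both `W = η (f - θ · lineFlux)` and `V = η θ'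
· lineFlux` are bounded and vanish at infinity (`boundedDecaying_fluxPot_sub`). The term in `W`
stays undifferentiated and is absorbed by Cauchy–Schwarz (`form_lower_bound`). Multiplication by
such functions is form-small modulo finitely many functionals, by the Poincaré inequality on a fine
grid of cubes (`exists_potential_bound`). Hence `q ≥ B₀ - o(1)` modulo finitely many functionals
(`isFredholmAt_of_lt`).

At `t = B₀ + k²`: take the lowest Landau Gaussian in `x₁`, a cutoff of width `ℓ` in `x₂`, and
`e^{ikx₃}` times a cutoff supported in `ℓ ≤ x₃ ≤ 5ℓ`. The constant-field residual is `O(1/ℓ)`, the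
perturbation `η f` is small there because `η` is, and the supports escape, so the sequence is weakly
null (`norm_residual_weyl_le`, `norm_form_sub_le`, `tendsto_inner_of_escaping`). -/

namespace MagneticHole

/-! ### Fredholm criteria for operators given by a form embedding -/

section Abstract

variable {H V : Type*} [NormedAddCommGroup H] [InnerProductSpace ℂ H] [CompleteSpace H]
  [NormedAddCommGroup V] [InnerProductSpace ℂ V] [CompleteSpace V]

/-- An operator that is bounded below up to finitely many functionals has finite-dimensional
kernel and closed range. -/
theorem finiteDimensional_ker_and_isClosed_range {ι : Type*} [Fintype ι] (L : H →L[ℂ] H)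
    (κ : H →L[ℂ] (ι → ℂ)) (C : ℝ) (h : ∀ x, ‖x‖ ≤ C * (‖L x‖ + ‖κ x‖)) :
    FiniteDimensional ℂ (LinearMap.ker (L : H →ₗ[ℂ] H)) ∧
      IsClosed (LinearMap.range (L : H →ₗ[ℂ] H) : Set H) := by
  constructor
  · refine FiniteDimensional.of_injective
      ((κ : H →ₗ[ℂ] (ι → ℂ)).comp (LinearMap.ker (L : H →ₗ[ℂ] H)).subtype) ?_
    rw [← LinearMap.ker_eq_bot, LinearMap.ker_eq_bot']
    rintro ⟨x, hx⟩ hκ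
    have h1 : L x = 0 := hx
    have h2 : κ x = 0 := hκ
    have := h x
    rw [h1, h2] at this
    ext
    simpa using this
  -- On `ker κ` the operator is bounded below, so the image of `ker κ` is closed. A complement of
  -- `ker κ` is finite-dimensional, and a closed subspace plus a finite-dimensional one is closed.
  · set M : Submodule ℂ H := (κ : H →ₗ[ℂ] (ι → ℂ)).ker with hM
    obtain ⟨N, hN2⟩ := M.exists_isCompl
    have hMc : IsClosed (M : Set H) := κ.isClosed_ker
    have hNf : FiniteDimensional ℂ N := by
      refine FiniteDimensional.of_injective ((κ : H →ₗ[ℂ] (ι → ℂ)).comp N.subtype) ?_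
      rw [← LinearMap.ker_eq_bot, LinearMap.ker_eq_bot']
      rintro ⟨x, hx⟩ hκ
      have : x ∈ M ⊓ N := ⟨hκ, hx⟩
      rw [hN2.inf_eq_bot] at this
      ext
      simpa using this
    have hcl : IsClosed (M.map (L : H →ₗ[ℂ] H) : Set H) := by
      have ha : AntilipschitzWith (Real.toNNReal C) (fun x : M => L x) := by
        refine AddMonoidHomClass.antilipschitz_of_bound
          ((L : H →ₗ[ℂ] H).comp M.subtype) fun x => ?_
        have h1 : κ x = 0 := x.2
        have h2 := h x
        rw [h1, norm_zero, add_zero] at h2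
        refine h2.trans ?_
        exact mul_le_mul_of_nonneg_right (Real.le_coe_toNNReal C) (norm_nonneg _)
      have : CompleteSpace M := hMc.completeSpace_coe
      have hu : UniformContinuous (fun x : M => L x) :=
        (L.comp M.subtypeL).uniformContinuous
      have := ha.isClosed_range hu
      convert this using 1
      ext y
      simp
    have : LinearMap.range (L : H →ₗ[ℂ] H) = M.map (L : H →ₗ[ℂ] H) ⊔ N.map (L : H →ₗ[ℂ] H) := by
      rw [← Submodule.map_sup, hN2.sup_eq_top, Submodule.map_top]
    rw [this]
    exact Submodule.isClosed_sup_finiteDimensional _ _ hcl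

/-- A closed range is of finite codimension if the kernel of the adjoint is finite-dimensional. -/
theorem finiteDimensional_quotient_range (L : H →L[ℂ] H)
    (hc : IsClosed (LinearMap.range (L : H →ₗ[ℂ] H) : Set H))
    (hk : FiniteDimensional ℂ (LinearMap.ker (L.adjoint : H →ₗ[ℂ] H))) :
    FiniteDimensional ℂ (H ⧸ LinearMap.range (L : H →ₗ[ℂ] H)) := by
  set K := LinearMap.range (L : H →ₗ[ℂ] H) with hK
  have : CompleteSpace K := hc.completeSpace_coe
  have h1 : Kᗮ = LinearMap.ker (L.adjoint : H →ₗ[ℂ] H) := L.orthogonal_range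
  rw [← h1] at hk
  exact LinearEquiv.finiteDimensional
    (Submodule.quotientEquivOfIsCompl K Kᗮ (Submodule.isCompl_orthogonal K)).symm

/-- A Weyl sequence obstructs the Fredholm property. -/
theorem not_fredholm_of_weyl (L : H →L[ℂ] H) (x : ℕ → H) (c : ℝ) (hc : 0 < c)
    (hx : ∀ n, c ≤ ‖x n‖) (hw : ∀ y, Tendsto (fun n => inner ℂ y (x n)) atTop (𝓝 0))
    (hL : Tendsto (fun n => L (x n)) atTop (𝓝 0))
    (hk : FiniteDimensional ℂ (LinearMap.ker (L : H →ₗ[ℂ] H)))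
    (hr : IsClosed (LinearMap.range (L : H →ₗ[ℂ] H) : Set H)) : False := by
  set N := LinearMap.ker (L : H →ₗ[ℂ] H) with hN
  -- On the finite-dimensional kernel weak convergence is norm convergence, so the kernel components
  -- of the sequence disappear.
  have hP : Tendsto (fun n => N.starProjection (x n)) atTop (𝓝 0) := by
    have : ∀ n, N.starProjection (x n) =
        ∑ i, inner ℂ ((stdOrthonormalBasis ℂ N i : N) : H) (x n) •
          ((stdOrthonormalBasis ℂ N i : N) : H) := by
      intro n
      rw [Submodule.starProjection_apply,
        ← (stdOrthonormalBasis ℂ N).sum_repr' (N.orthogonalProjectionOnto (x n))]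
      simp
    simp_rw [this]
    rw [← Finset.sum_const_zero (s := (Finset.univ : Finset (Fin (Module.finrank ℂ N))))]
    refine tendsto_finsetSum _ fun i _ => ?_
    simpa using (hw ((stdOrthonormalBasis ℂ N i : N) : H)).smul_const
      ((stdOrthonormalBasis ℂ N i : N) : H)
  have hinj : Function.Injective (L.comp Nᗮ.subtypeL) := by
    refine (injective_iff_map_eq_zero _).2 ?_
    rintro ⟨y, hy⟩ h0
    have h1 : y ∈ N := h0
    have : y ∈ N ⊓ Nᗮ := ⟨h1, hy⟩
    rw [Submodule.inf_orthogonal_eq_bot] at this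
    ext
    simpa using this
  have hdec : ∀ y : H, L (y - N.starProjection y) = L y := by
    intro y
    have : L (N.starProjection y) = 0 := (N.starProjection_apply_mem y : _ ∈ N)
    rw [map_sub, this, sub_zero]
  have hrange : IsClosed (Set.range (L.comp Nᗮ.subtypeL)) := by
    convert hr using 1
    ext y
    constructor
    · rintro ⟨z, rfl⟩
      exact ⟨z, rfl⟩
    · rintro ⟨z, rfl⟩
      exact ⟨⟨z - N.starProjection z, N.sub_starProjection_mem_orthogonal z⟩, hdec z⟩
  -- Off the kernel, injectivity and closed range force a lower bound, so `L xₙ → 0` drives the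
  -- remaining components to zero as well.
  obtain ⟨K, hK⟩ := (L.comp Nᗮ.subtypeL).antilipschitz_of_injective_of_isClosed_range hinj hrange
  have h1 : ∀ n, ‖x n - N.starProjection (x n)‖ ≤ K * ‖L (x n)‖ := by
    intro n
    have := hK.le_mul_dist ⟨x n - N.starProjection (x n), N.sub_starProjection_mem_orthogonal _⟩ 0
    simpa [dist_eq_norm, hdec] using this
  have h2 : Tendsto (fun n => x n - N.starProjection (x n)) atTop (𝓝 0) := by
    refine squeeze_zero_norm h1 ?_
    simpa using hL.norm.const_mul (K : ℝ)
  have h3 : Tendsto x atTop (𝓝 0) := by simpa using h2.add hP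
  have := ge_of_tendsto' h3.norm hx
  simp at this
  linarith

/-- The bounded operator `1 - (1 + z) J J†`. -/
noncomputable def resolventPencil (J : V →L[ℂ] H) (z : ℂ) : H →L[ℂ] H :=
  ContinuousLinearMap.id ℂ H - (1 + z) • (J.comp J.adjoint)

theorem resolventPencil_apply (J : V →L[ℂ] H) (z : ℂ) (y : H) :
    resolventPencil J z y = y - (1 + z) • J (J.adjoint y) := rfl

theorem resolventPencil_adjoint (J : V →L[ℂ] H) (z : ℂ) :
    (resolventPencil J z).adjoint = resolventPencil J (conj z) := by
  refine (ContinuousLinearMap.eq_adjoint_iff _ _).2 (fun x y => ?_) |>.symm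
  have h : inner ℂ (J (J.adjoint x)) y = inner ℂ x (J (J.adjoint y)) := by
    rw [← ContinuousLinearMap.adjoint_inner_right, ContinuousLinearMap.adjoint_inner_left]
  rw [resolventPencil_apply, resolventPencil_apply, inner_sub_left, inner_sub_right,
    inner_smul_left, inner_smul_right, h]
  simp

/-- An operator whose graph is `{(u, w) | u = J J† (u + w)}` is Fredholm at `z` iff
`1 - (1 + z) J J†` is Fredholm. -/
theorem isFredholmAt_iff {T : H →ₗ.[ℂ] H} (J : V →L[ℂ] H)
    (hT : ∀ u w : H, (u, w) ∈ T.graph ↔ u = J (J.adjoint (u + w))) (z : ℂ) :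
    IsFredholmAt T z ↔
      FiniteDimensional ℂ (LinearMap.ker (resolventPencil J z : H →ₗ[ℂ] H)) ∧
      IsClosed (LinearMap.range (resolventPencil J z : H →ₗ[ℂ] H) : Set H) ∧
      FiniteDimensional ℂ (H ⧸ LinearMap.range (resolventPencil J z : H →ₗ[ℂ] H)) := by
  have hd : ∀ u : T.domain, (u : H) = J (J.adjoint (u + T u)) := fun u =>
    (hT _ _).1 (T.mem_graph u)
  have hex : ∀ y : H, ∃ u : T.domain, (u : H) = J (J.adjoint y) ∧ T u = y - u := by
    intro y
    have : (J (J.adjoint y), y - J (J.adjoint y)) ∈ T.graph := (hT _ _).2 (by simp)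
    obtain ⟨u, hu1, hu2⟩ := (LinearPMap.mem_graph_iff T).1 this
    exact ⟨u, hu1, by rw [hu1]; exact hu2⟩
  -- The substitution `y = (T + 1) u`, `u = J J† y`, turns `(T - z) u` into `(1 - (1 + z) J J†) y`.
  -- Ranges therefore coincide, and `T + 1` maps one kernel isomorphically onto the other.
  have hrange : LinearMap.range (T.toFun - z • T.domain.subtype) =
      LinearMap.range (resolventPencil J z : H →ₗ[ℂ] H) := by
    ext w
    constructor
    · rintro ⟨u, rfl⟩
      refine ⟨u + T u, ?_⟩
      change resolventPencil J z (u + T u) = T u - z • (u : H)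
      rw [resolventPencil_apply, ← hd u]
      module
    · rintro ⟨y, rfl⟩
      obtain ⟨u, hu1, hu2⟩ := hex y
      refine ⟨u, ?_⟩
      change T u - z • (u : H) = resolventPencil J z y
      rw [resolventPencil_apply, hu2, ← hu1]
      module
  have hker : FiniteDimensional ℂ (LinearMap.ker (T.toFun - z • T.domain.subtype)) ↔
      FiniteDimensional ℂ (LinearMap.ker (resolventPencil J z : H →ₗ[ℂ] H)) := by
    let Φ : T.domain →ₗ[ℂ] H := T.toFun + T.domain.subtype
    have hΦ : ∀ u, Φ u = T u + u := fun u => rfl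
    have hinj : Function.Injective Φ := by
      refine (injective_iff_map_eq_zero _).2 fun u hu => ?_
      have := hd u
      rw [add_comm, ← hΦ, hu] at this
      ext
      simpa using this
    have hmap : (LinearMap.ker (T.toFun - z • T.domain.subtype)).map Φ =
        LinearMap.ker (resolventPencil J z : H →ₗ[ℂ] H) := by
      ext y
      constructor
      · rintro ⟨u, hu, rfl⟩
        have hu' : T u - z • (u : H) = 0 := hu
        change resolventPencil J z (Φ u) = 0
        rw [resolventPencil_apply, hΦ, add_comm, ← hd u, ← hu']
        module
      · intro hy
        have hy' : resolventPencil J z y = 0 := hy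
        obtain ⟨u, hu1, hu2⟩ := hex y
        rw [resolventPencil_apply, ← hu1] at hy'
        refine ⟨u, ?_, ?_⟩
        · change T u - z • (u : H) = 0
          rw [hu2, ← hy']
          module
        · rw [hΦ, hu2]
          simp
    rw [← hmap]
    let e := Submodule.equivMapOfInjective Φ hinj (LinearMap.ker (T.toFun - z • T.domain.subtype))
    exact ⟨fun _ => e.finiteDimensional, fun _ => e.symm.finiteDimensional⟩
  unfold IsFredholmAt
  rw [hker, hrange]

/-- Since `y` is the pencil at `y` plus `(1 + z) J J† y`, it is enough to control `J J† y`. -/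
theorem norm_le_of_norm_pencil_le {ι : Type*} [Fintype ι] (J : V →L[ℂ] H) (z : ℂ)
    (κ : H →L[ℂ] (ι → ℂ)) (C : ℝ)
    (h : ∀ y, ‖J (J.adjoint y)‖ ≤ C * (‖resolventPencil J z y‖ + ‖κ y‖)) (y : H) :
    ‖y‖ ≤ (1 + ‖1 + z‖ * C) * (‖resolventPencil J z y‖ + ‖κ y‖) := by
  have h1 : y = resolventPencil J z y + (1 + z) • J (J.adjoint y) := by
    rw [resolventPencil_apply]; simp
  have h2 : ‖y‖ ≤ ‖resolventPencil J z y‖ + ‖1 + z‖ * ‖J (J.adjoint y)‖ := by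
    conv_lhs => rw [h1]
    refine (norm_add_le _ _).trans ?_
    rw [norm_smul]
  have h3 := mul_le_mul_of_nonneg_left (h y) (norm_nonneg (1 + z))
  have := norm_nonneg (κ y)
  nlinarith

/-- With `p = J† y` and `u = J p`, the right side is `‖p‖² - (1 + z) ‖u‖²`, which is `q(u) - z ‖u‖²`
for the form norm. Its imaginary part handles nonreal `z`, its real part turns form bounds into
bounds on the pencil. -/
theorem inner_pencil (J : V →L[ℂ] H) (z : ℂ) (y : H) :
    inner ℂ (J (J.adjoint y)) (resolventPencil J z y) =
      (‖J.adjoint y‖ ^ 2 : ℝ) - (1 + z) * (‖J (J.adjoint y)‖ ^ 2 : ℝ) := by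
  rw [resolventPencil_apply, inner_sub_right, inner_smul_right,
    ← ContinuousLinearMap.adjoint_inner_right, inner_self_eq_norm_sq_to_K,
    inner_self_eq_norm_sq_to_K]
  push_cast
  rfl

/-- Away from the real axis `J J†` is controlled by the pencil. -/
theorem norm_le_pencil_of_im_ne_zero (J : V →L[ℂ] H) (z : ℂ) (hz : z.im ≠ 0) (y : H) :
    ‖J (J.adjoint y)‖ ≤ |z.im|⁻¹ * ‖resolventPencil J z y‖ := by
  have h1 := congrArg Complex.im (inner_pencil J z y)
  rw [Complex.sub_im, Complex.mul_im] at h1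
  simp only [Complex.ofReal_im, Complex.ofReal_re, Complex.add_im, Complex.one_im] at h1
  have h2 := (Complex.abs_im_le_norm _).trans
    (norm_inner_le_norm (𝕜 := ℂ) (J (J.adjoint y)) (resolventPencil J z y))
  rw [h1] at h2
  have h3 : |0 - ((1 + z).re * 0 + (0 + z.im) * ‖J (J.adjoint y)‖ ^ 2)| =
      |z.im| * ‖J (J.adjoint y)‖ ^ 2 := by
    rw [show 0 - ((1 + z).re * 0 + (0 + z.im) * ‖J (J.adjoint y)‖ ^ 2) =
      -(z.im * ‖J (J.adjoint y)‖ ^ 2) by ring, abs_neg, abs_mul, abs_of_nonneg (sq_nonneg ‖_‖)]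
  rw [h3] at h2
  have hp : 0 < |z.im| := abs_pos.2 hz
  rw [inv_mul_eq_div, le_div_iff₀ hp]
  rcases eq_or_lt_of_le (norm_nonneg (J (J.adjoint y))) with h0 | h0
  · rw [← h0]; simp
  · nlinarith

/-- Below the essential infimum of the form, `J J†` is controlled by the pencil up to finitely
many functionals. -/
theorem norm_le_pencil_of_form_bound {ι : Type*} [Fintype ι] (J : V →L[ℂ] H) (t : ℝ)
    (κ : V →L[ℂ] (ι → ℂ)) (m C : ℝ) (hm : 0 < m) (hC : 0 ≤ C)
    (h : ∀ p, m * ‖J p‖ ^ 2 ≤ ‖p‖ ^ 2 - (1 + t) * ‖J p‖ ^ 2 + C * ‖κ p‖ ^ 2) (y : H) :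
    ‖J (J.adjoint y)‖ ≤ (1 / m + √(2 * C / m)) *
      (‖resolventPencil J t y‖ + ‖κ.comp J.adjoint y‖) := by
  have h1 := congrArg Complex.re (inner_pencil J t y)
  rw [show ((‖J.adjoint y‖ ^ 2 : ℝ) : ℂ) - (1 + t) * (‖J (J.adjoint y)‖ ^ 2 : ℝ) =
    ((‖J.adjoint y‖ ^ 2 - (1 + t) * ‖J (J.adjoint y)‖ ^ 2 : ℝ) : ℂ) by push_cast; ring,
    Complex.ofReal_re] at h1
  have h2 := (Complex.re_le_norm _).trans
    (norm_inner_le_norm (𝕜 := ℂ) (J (J.adjoint y)) (resolventPencil J t y))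
  rw [h1] at h2
  have h3 := h (J.adjoint y)
  rw [ContinuousLinearMap.comp_apply]
  set u := ‖J (J.adjoint y)‖
  set a := ‖resolventPencil J t y‖
  set k := ‖κ (J.adjoint y)‖
  have ha : 0 ≤ a := norm_nonneg _
  have hk : 0 ≤ k := norm_nonneg _
  have hs := Real.sq_sqrt (show 0 ≤ 2 * C / m by positivity)
  set s := √(2 * C / m)
  have hs0 : 0 ≤ s := Real.sqrt_nonneg _
  have hmu : m * u ^ 2 ≤ u * a + C * k ^ 2 := by linarith
  -- Young's inequality `2 u (a/m) ≤ u² + (a/m)²` absorbs the linear term of `m u² ≤ u a + C k²`.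
  have h5 : u ^ 2 ≤ (a / m) ^ 2 + (2 * C / m) * k ^ 2 := by
    have h6 : u ^ 2 ≤ u * (a / m) + (2 * C / m) * k ^ 2 / 2 := by
      rw [← mul_le_mul_iff_right₀ hm]
      refine hmu.trans (le_of_eq ?_)
      field_simp
    nlinarith [sq_nonneg (u - a / m)]
  have h7 : u ≤ a / m + s * k := by
    refine le_of_sq_le_sq ?_ (by positivity)
    rw [← hs] at h5
    have : 0 ≤ a / m * (s * k) := by positivity
    nlinarith
  refine h7.trans ?_
  have : 0 ≤ 1 / m * k := by positivity
  have : 0 ≤ s * a := by positivity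
  rw [div_eq_mul_one_div]
  nlinarith

end Abstract

/-! ### The form domain as a Hilbert space and the resulting criteria -/

/-- `L²(ℝ³) ⊕ L²(ℝ³)³` as a Hilbert space. -/
def PairSpace : Type := WithLp 2 (L2 × PiLp 2 (fun _ : Fin 3 => L2))

noncomputable instance : NormedAddCommGroup PairSpace :=
  inferInstanceAs (NormedAddCommGroup (WithLp 2 (L2 × PiLp 2 (fun _ : Fin 3 => L2))))

noncomputable instance : InnerProductSpace ℂ PairSpace :=
  inferInstanceAs (InnerProductSpace ℂ (WithLp 2 (L2 × PiLp 2 (fun _ : Fin 3 => L2))))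

instance : CompleteSpace PairSpace :=
  inferInstanceAs (CompleteSpace (WithLp 2 (L2 × PiLp 2 (fun _ : Fin 3 => L2))))

/-- The identification of `PairSpace` with the plain product. -/
noncomputable def pairEquiv : PairSpace ≃L[ℂ] (L2 × (Fin 3 → L2)) :=
  (WithLp.prodContinuousLinearEquiv 2 ℂ L2 (PiLp 2 (fun _ : Fin 3 => L2))).trans
    ((ContinuousLinearEquiv.refl ℂ L2).prodCongr (PiLp.continuousLinearEquiv 2 ℂ (fun _ : Fin 3 => L2)))

theorem inner_pair (p q : PairSpace) : inner ℂ p q =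
    inner ℂ (pairEquiv p).1 (pairEquiv q).1 +
      ∑ j, inner ℂ ((pairEquiv p).2 j) ((pairEquiv q).2 j) := rfl

theorem norm_pair_sq (p : PairSpace) :
    ‖p‖ ^ 2 = ‖(pairEquiv p).1‖ ^ 2 + ∑ j, ‖(pairEquiv p).2 j‖ ^ 2 := by
  refine (WithLp.prod_norm_sq_eq_of_L2 (α := L2) (β := PiLp 2 (fun _ : Fin 3 => L2)) p).trans ?_
  rw [PiLp.norm_sq_eq_of_L2]
  rfl

/-- The form domain with the form norm. -/
noncomputable def formDomain (A : Space → Fin 3 → ℝ) : Submodule ℂ PairSpace :=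
  (gradGraph A).topologicalClosure.comap (pairEquiv : PairSpace →ₗ[ℂ] L2 × (Fin 3 → L2))

theorem isClosed_formDomain (A : Space → Fin 3 → ℝ) : IsClosed (formDomain A : Set PairSpace) :=
  (gradGraph A).isClosed_topologicalClosure.preimage pairEquiv.continuous

instance (A : Space → Fin 3 → ℝ) : CompleteSpace (formDomain A) :=
  (isClosed_formDomain A).completeSpace_coe

theorem symm_mem_formDomain {A : Space → Fin 3 → ℝ} {q : L2 × (Fin 3 → L2)}
    (hq : q ∈ (gradGraph A).topologicalClosure) : pairEquiv.symm q ∈ formDomain A := by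
  change pairEquiv (pairEquiv.symm q) ∈ (gradGraph A).topologicalClosure
  simpa using hq

/-- A closed condition that holds on test functions holds on the form domain. -/
theorem formDomain_induction {A : Space → Fin 3 → ℝ} {P : PairSpace → Prop}
    (hP : IsClosed {p | P p}) (h : ∀ p, pairEquiv p ∈ gradGraph A → P p) :
    ∀ p ∈ formDomain A, P p := by
  intro p hp
  have h1 : pairEquiv p ∈ closure (gradGraph A : Set (L2 × (Fin 3 → L2))) := hp
  have h2 : IsClosed {q : L2 × (Fin 3 → L2) | P (pairEquiv.symm q)} :=
    hP.preimage pairEquiv.symm.continuous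
  have h3 := h2.closure_subset_iff.2 (fun q hq => h _ (by simpa using hq)) h1
  simpa using h3

/-- The embedding of the form domain into `L²`. -/
noncomputable def formEmbedding (A : Space → Fin 3 → ℝ) : formDomain A →L[ℂ] L2 :=
  ((ContinuousLinearMap.fst ℂ L2 (Fin 3 → L2)).comp
    (pairEquiv : PairSpace →L[ℂ] L2 × (Fin 3 → L2))).comp (formDomain A).subtypeL

theorem formEmbedding_apply (A : Space → Fin 3 → ℝ) (p : formDomain A) :
    formEmbedding A p = (pairEquiv (p : PairSpace)).1 := rfl

/-- By Riesz, `J† (u + w)` is the vector `p` of the form domain with `⟪q, p⟫ = ⟪J q, u + w⟫` for all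
`q`. Removing `⟪J q, u⟫` from both sides leaves the weak equation defining the operator. Test
functions suffice for `q`, being dense in the form domain. -/
theorem mem_operatorGraph_iff (A : Space → Fin 3 → ℝ) (u w : L2) :
    (u, w) ∈ operatorGraph A ↔
      u = formEmbedding A ((formEmbedding A).adjoint (u + w)) := by
  constructor
  · rintro ⟨v, hv, h⟩
    let p : formDomain A := ⟨pairEquiv.symm (u, v), symm_mem_formDomain hv⟩
    have hpe : pairEquiv (p : PairSpace) = (u, v) := by simp [p]
    suffices hp : (formEmbedding A).adjoint (u + w) = p by
      rw [hp, formEmbedding_apply, hpe]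
    have key : ∀ q ∈ formDomain A, inner ℂ q (p : PairSpace) =
        inner ℂ (pairEquiv q).1 (u + w) := by
      refine formDomain_induction (isClosed_eq (by fun_prop) (by fun_prop)) fun q hq => ?_
      rw [inner_pair, hpe, inner_add_right, ← h _ hq]
    refine ext_inner_left ℂ fun q => ?_
    rw [ContinuousLinearMap.adjoint_inner_right, formEmbedding_apply, ← key q q.2]
    rfl
  · intro hu
    set p := (formEmbedding A).adjoint (u + w) with hp
    refine ⟨(pairEquiv (p : PairSpace)).2, ?_, fun q hq => ?_⟩
    · change (u, _) ∈ _
      rw [hu]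
      exact p.2
    · let q' : formDomain A := ⟨pairEquiv.symm q,
        symm_mem_formDomain ((gradGraph A).le_topologicalClosure hq)⟩
      have hqe : pairEquiv (q' : PairSpace) = q := by simp [q']
      have h1 : inner ℂ q' p = inner ℂ (formEmbedding A q') (u + w) :=
        ContinuousLinearMap.adjoint_inner_right _ _ _
      have h2 : inner ℂ q' p = inner ℂ q.1 u +
          ∑ j, inner ℂ (q.2 j) ((pairEquiv (p : PairSpace)).2 j) := by
        change inner ℂ (q' : PairSpace) (p : PairSpace) = _
        rw [inner_pair, hqe, hu]
        rfl
      rw [h2, formEmbedding_apply, hqe, inner_add_right] at h1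
      exact add_left_cancel h1

/-- Local square integrability of a vector potential. -/
def LocallySqIntegrable (A : Space → Fin 3 → ℝ) : Prop :=
  ∀ φ : Space → ℂ, IsTest φ → ∀ j, MemLp (fun x => (A x j : ℂ) * φ x) 2 volume

theorem mem_graph_magneticOperator {A : Space → Fin 3 → ℝ} (hA : LocallySqIntegrable A)
    (u w : L2) : (u, w) ∈ (magneticOperator A).graph ↔
      u = formEmbedding A ((formEmbedding A).adjoint (u + w)) := by
  rw [← mem_operatorGraph_iff, magneticOperator,
    Submodule.toLinearPMap_graph_eq _ (operatorGraph_single_valued hA)]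

theorem isFredholmAt_magneticOperator_iff {A : Space → Fin 3 → ℝ} (hA : LocallySqIntegrable A)
    (z : ℂ) : IsFredholmAt (magneticOperator A) z ↔
      FiniteDimensional ℂ (LinearMap.ker (resolventPencil (formEmbedding A) z : L2 →ₗ[ℂ] L2)) ∧
      IsClosed (LinearMap.range (resolventPencil (formEmbedding A) z : L2 →ₗ[ℂ] L2) : Set L2) ∧
      FiniteDimensional ℂ
        (L2 ⧸ LinearMap.range (resolventPencil (formEmbedding A) z : L2 →ₗ[ℂ] L2)) :=
  isFredholmAt_iff (formEmbedding A) (mem_graph_magneticOperator hA) z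

/-- The pencil is bounded below without any auxiliary functional, whence the zero map as `κ`. Its
adjoint is the pencil at `conj z`, to which the same bound applies. -/
theorem isFredholmAt_of_im_ne_zero {A : Space → Fin 3 → ℝ} (hA : LocallySqIntegrable A)
    (z : ℂ) (hz : z.im ≠ 0) : IsFredholmAt (magneticOperator A) z := by
  rw [isFredholmAt_magneticOperator_iff hA]
  have key : ∀ z : ℂ, z.im ≠ 0 → _ := fun z hz =>
    finiteDimensional_ker_and_isClosed_range (resolventPencil (formEmbedding A) z)
      (0 : L2 →L[ℂ] (Fin 1 → ℂ)) _ (norm_le_of_norm_pencil_le (formEmbedding A) z 0 |z.im|⁻¹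
        fun y => by simpa using norm_le_pencil_of_im_ne_zero (formEmbedding A) z hz y)
  refine ⟨(key z hz).1, (key z hz).2, finiteDimensional_quotient_range _ (key z hz).2 ?_⟩
  rw [resolventPencil_adjoint]
  exact (key _ (by simpa using hz)).1

/-- If the form is bounded below by `t + m`, `m > 0`, up to finitely many functionals, then the
operator is Fredholm at `t`. -/
theorem isFredholmAt_of_form_bound {A : Space → Fin 3 → ℝ} (hA : LocallySqIntegrable A)
    {ι : Type*} [Fintype ι] (t m C : ℝ) (e : ι → L2) (hm : 0 < m) (hC : 0 ≤ C)
    (h : ∀ q ∈ gradGraph A, m * ‖q.1‖ ^ 2 ≤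
      ∑ j, ‖q.2 j‖ ^ 2 - t * ‖q.1‖ ^ 2 + C * ∑ i, ‖inner ℂ (e i) q.1‖ ^ 2) :
    IsFredholmAt (magneticOperator A) t := by
  rw [isFredholmAt_magneticOperator_iff hA]
  let κ : formDomain A →L[ℂ] (ι → ℂ) :=
    ContinuousLinearMap.pi fun i => (innerSL ℂ (e i)).comp (formEmbedding A)
  have hb : ∀ p : formDomain A, m * ‖formEmbedding A p‖ ^ 2 ≤
      ‖p‖ ^ 2 - (1 + t) * ‖formEmbedding A p‖ ^ 2 +
        (C * Fintype.card ι) * ‖κ p‖ ^ 2 := by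
    intro p
    have h1 : ∀ q ∈ formDomain A, m * ‖(pairEquiv q).1‖ ^ 2 ≤
        ∑ j, ‖(pairEquiv q).2 j‖ ^ 2 - t * ‖(pairEquiv q).1‖ ^ 2 +
          C * ∑ i, ‖inner ℂ (e i) (pairEquiv q).1‖ ^ 2 :=
      formDomain_induction (isClosed_le (by fun_prop) (by fun_prop)) fun q hq => h _ hq
    have h2 := h1 p p.2
    have h3 : ‖p‖ ^ 2 = ‖(pairEquiv (p : PairSpace)).1‖ ^ 2 +
      ∑ j, ‖(pairEquiv (p : PairSpace)).2 j‖ ^ 2 := norm_pair_sq (p : PairSpace)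
    -- The target `ι → ℂ` carries the sup norm, so the sum of squares costs a factor `card ι`.
    have h4 : ∑ i, ‖inner ℂ (e i) (pairEquiv (p : PairSpace)).1‖ ^ 2 ≤
        Fintype.card ι * ‖κ p‖ ^ 2 := by
      rw [← nsmul_eq_mul, ← Finset.card_univ]
      refine Finset.sum_le_card_nsmul _ _ _ fun i _ => ?_
      have : ‖κ p i‖ ≤ ‖κ p‖ := norm_le_pi_norm _ i
      exact pow_le_pow_left₀ (norm_nonneg _) this 2
    have h5 := mul_le_mul_of_nonneg_left h4 hC
    rw [h3, formEmbedding_apply]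
    linarith
  have key := finiteDimensional_ker_and_isClosed_range (resolventPencil (formEmbedding A) t) _ _
    (norm_le_of_norm_pencil_le (formEmbedding A) t _ _
      (norm_le_pencil_of_form_bound (formEmbedding A) t κ m _ hm (by positivity) hb))
  refine ⟨key.1, key.2, finiteDimensional_quotient_range _ key.2 ?_⟩
  rw [resolventPencil_adjoint, Complex.conj_ofReal]
  exact key.1

/-- A Weyl sequence in the sense of forms obstructs the Fredholm property. -/
theorem not_isFredholmAt_of_form_weyl {A : Space → Fin 3 → ℝ} (hA : LocallySqIntegrable A)
    (t : ℝ) (p : ℕ → L2 × (Fin 3 → L2)) (hp : ∀ n, p n ∈ gradGraph A) (c : ℝ) (hc : 0 < c)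
    (hcp : ∀ n, c ≤ ‖(p n).1‖) (hw : ∀ y, Tendsto (fun n => inner ℂ y (p n).1) atTop (𝓝 0))
    (ε : ℕ → ℝ) (hε : Tendsto ε atTop (𝓝 0))
    (h : ∀ n, ∀ q ∈ gradGraph A, ‖∑ j, inner ℂ (q.2 j) ((p n).2 j) - t * inner ℂ q.1 (p n).1‖ ≤
      ε n * √(‖q.1‖ ^ 2 + ∑ j, ‖q.2 j‖ ^ 2)) :
    ¬ IsFredholmAt (magneticOperator A) t := by
  rw [isFredholmAt_magneticOperator_iff hA]
  rintro ⟨h1, h2, -⟩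
  set J := formEmbedding A with hJ
  let P : ℕ → formDomain A := fun n => ⟨pairEquiv.symm (p n),
    symm_mem_formDomain ((gradGraph A).le_topologicalClosure (hp n))⟩
  have hPe : ∀ n, pairEquiv (P n : PairSpace) = p n := fun n => by simp [P]
  have hPJ : ∀ n, J (P n) = (p n).1 := fun n => by rw [hJ, formEmbedding_apply, hPe]
  -- `r n` represents, in the form inner product, the residual functional that is small by
  -- hypothesis; testing against `r n` itself bounds its norm by `ε n`. Moreover `J (r n)` is the
  -- pencil applied to `J (P n)`.
  let r : ℕ → formDomain A := fun n => P n - (1 + (t : ℂ)) • J.adjoint (J (P n))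
  have hr : ∀ n, ∀ q ∈ formDomain A, ‖inner ℂ q (P n : PairSpace) -
      (1 + (t : ℂ)) * inner ℂ (pairEquiv q).1 (p n).1‖ ≤ ε n * ‖q‖ := by
    intro n
    refine formDomain_induction (isClosed_le (by fun_prop) (by fun_prop)) fun q hq => ?_
    have h3 := h n _ hq
    rw [← norm_pair_sq, Real.sqrt_sq (norm_nonneg _)] at h3
    rw [inner_pair, hPe]
    convert h3 using 2
    ring
  have hrn : ∀ n, ‖r n‖ ≤ ε n := by
    intro n
    have h3 := hr n (r n) (r n).2
    have h4 : inner ℂ (r n : PairSpace) (P n : PairSpace) -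
        (1 + (t : ℂ)) * inner ℂ (pairEquiv (r n : PairSpace)).1 (p n).1 = inner ℂ (r n) (r n) := by
      conv_rhs => rhs; simp only [r]
      rw [inner_sub_right, inner_smul_right, ContinuousLinearMap.adjoint_inner_right, hPJ]
      rfl
    rw [h4, inner_self_eq_norm_sq_to_K] at h3
    rcases eq_or_lt_of_le (norm_nonneg (r n)) with h0 | h0
    -- If `r n = 0`, what remains is `0 ≤ ε n`, seen by testing with the nonzero vector `P n`.
    · rw [← h0]
      have h5 := (norm_nonneg _).trans (hr n (P n) (P n).2)
      have h6 : 0 < ‖(P n : PairSpace)‖ := by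
        rw [norm_pos_iff]
        intro h7
        have := hcp n
        rw [← hPe, h7, map_zero] at this
        simp at this
        linarith
      exact nonneg_of_mul_nonneg_left h5 h6
    · have h5 : ‖r n‖ ^ 2 ≤ ε n * ‖r n‖ := by simpa using h3
      nlinarith
  refine not_fredholm_of_weyl _ (fun n => J (P n)) c hc (fun n => by rw [hPJ]; exact hcp n)
    (fun y => by simpa only [hPJ] using hw y) ?_ h1 h2
  have h3 : ∀ n, resolventPencil J t (J (P n)) = J (r n) := by
    intro n
    simp only [r, resolventPencil_apply, map_sub, map_smul]
  simp_rw [h3]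
  have h4 : Tendsto r atTop (𝓝 0) := squeeze_zero_norm hrn hε
  simpa [Function.comp_def] using (J.continuous.tendsto 0).comp h4

/-! ### The Poincaré inequality on cubes through oscillation integrals -/

theorem sq_lintegral_le {X : Type*} [MeasurableSpace X] (μ : Measure X) {f : X → ℝ≥0∞}
    (hf : AEMeasurable f μ) : (∫⁻ x, f x ∂μ) ^ 2 ≤ μ univ * ∫⁻ x, f x ^ 2 ∂μ := by
  have h := ENNReal.lintegral_mul_le_Lp_mul_Lq μ (p := 2) (q := 2)
    ⟨by norm_num, by norm_num, by norm_num⟩ (aemeasurable_const (b := (1 : ℝ≥0∞))) hf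
  simp only [Pi.mul_apply, one_mul, ENNReal.one_rpow, lintegral_const] at h
  have h2 := pow_le_pow_left₀ (zero_le) h 2
  refine h2.trans (le_of_eq ?_)
  rw [mul_pow, ← ENNReal.rpow_natCast, ← ENNReal.rpow_natCast, ← ENNReal.rpow_mul,
    ← ENNReal.rpow_mul]
  simp

theorem enorm_add_sq_le (a b : ℂ) :
    ‖a + b‖ₑ ^ 2 ≤ 2 * (‖a‖ₑ ^ 2 + ‖b‖ₑ ^ 2) := by
  refine (pow_le_pow_left₀ zero_le (enorm_add_le a b) 2).trans ?_
  have := ENNReal.rpow_add_le_mul_rpow_add_rpow ‖a‖ₑ ‖b‖ₑ (p := 2) (by norm_num)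
  norm_num at this
  exact this

/-- The oscillation integral `∬ |f(x) - f(y)|²`. -/
noncomputable def oscillation {X : Type*} [MeasurableSpace X] (μ : Measure X) (f : X → ℂ) : ℝ≥0∞ :=
  ∫⁻ x, ∫⁻ y, ‖f x - f y‖ₑ ^ 2 ∂μ ∂μ

/-- Write `μ(X) f(x) = ∫ (f(x) - f(y)) dy + ∫ f`, square, apply Cauchy–Schwarz to the first integral
and integrate in `x`. -/
theorem lintegral_sq_le_oscillation {X : Type*} [MeasurableSpace X] (μ : Measure X)
    [IsFiniteMeasure μ] {f : X → ℂ} (hf : Integrable f μ) :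
    μ univ * ∫⁻ x, ‖f x‖ₑ ^ 2 ∂μ ≤ 2 * oscillation μ f + 2 * ‖∫ x, f x ∂μ‖ₑ ^ 2 := by
  rcases eq_or_ne (μ univ) 0 with h0 | h0
  · simp [h0]
  have hfin : μ univ ≠ ⊤ := measure_ne_top _ _
  have key : ∀ x, μ univ ^ 2 * ‖f x‖ₑ ^ 2 ≤
      2 * (μ univ * ∫⁻ y, ‖f x - f y‖ₑ ^ 2 ∂μ) + 2 * ‖∫ x, f x ∂μ‖ₑ ^ 2 := by
    intro x
    have e1 : (μ.real univ : ℂ) * f x = (∫ y, (f x - f y) ∂μ) + ∫ y, f y ∂μ := by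
      rw [integral_sub (integrable_const _) hf, integral_const]
      simp
    have e2 : μ univ ^ 2 * ‖f x‖ₑ ^ 2 = ‖(μ.real univ : ℂ) * f x‖ₑ ^ 2 := by
      rw [enorm_mul, mul_pow]
      congr 2
      rw [← ofReal_norm, Complex.norm_real, Real.norm_of_nonneg measureReal_nonneg,
        ofReal_measureReal hfin]
    rw [e2, e1]
    refine (enorm_add_sq_le _ _).trans ?_
    rw [mul_add]
    gcongr
    refine (pow_le_pow_left₀ zero_le (enorm_integral_le_lintegral_enorm _) 2).trans ?_
    exact sq_lintegral_le μ (by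
      have := hf.aestronglyMeasurable
      exact (aestronglyMeasurable_const.sub this).enorm)
  have h1 := lintegral_mono (μ := μ) key
  rw [lintegral_const_mul' _ _ (by finiteness), lintegral_add_right _ measurable_const,
    lintegral_const_mul' _ _ (by finiteness), lintegral_const_mul' _ _ hfin, lintegral_const] at h1
  have h2 : μ univ * (μ univ * ∫⁻ x, ‖f x‖ₑ ^ 2 ∂μ) ≤
      μ univ * (2 * oscillation μ f + 2 * ‖∫ x, f x ∂μ‖ₑ ^ 2) := by
    refine le_trans (le_of_eq (by ring)) (h1.trans (le_of_eq ?_))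
    rw [oscillation]
    ring
  exact (ENNReal.mul_le_mul_iff_right h0 hfin).1 h2

/-- Go from `(x, y)` to `(x', y')` through `(x', y)`, changing one coordinate at a time. Oscillation
thus tensorises, and the Poincaré inequality on a cube reduces to intervals. -/
theorem oscillation_prod_le {X Y : Type*} [MeasurableSpace X] [MeasurableSpace Y]
    (μ : Measure X) (ν : Measure Y) [IsFiniteMeasure μ] [IsFiniteMeasure ν] {f : X × Y → ℂ}
    (hf : Measurable f) :
    oscillation (μ.prod ν) f ≤ 2 * (ν univ * ∫⁻ y, oscillation μ (fun x => f (x, y)) ∂ν) +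
      2 * (μ univ * ∫⁻ x, oscillation ν (fun y => f (x, y)) ∂μ) := by
  have m1 : Measurable fun p : (X × Y) × X => ‖f p.1 - f (p.2, p.1.2)‖ₑ ^ 2 := by fun_prop
  have m2 : Measurable fun p : (X × Y) × Y => ‖f p.1 - f (p.1.1, p.2)‖ₑ ^ 2 := by fun_prop
  have e1 : ∀ p : X × Y, ∫⁻ q, ‖f p - f q‖ₑ ^ 2 ∂μ.prod ν ≤
      2 * (ν univ * ∫⁻ x', ‖f p - f (x', p.2)‖ₑ ^ 2 ∂μ) +
        2 * ∫⁻ x', ∫⁻ y', ‖f (x', p.2) - f (x', y')‖ₑ ^ 2 ∂ν ∂μ := by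
    intro p
    rw [lintegral_prod _ (by fun_prop)]
    have : ∀ x' y', ‖f p - f (x', y')‖ₑ ^ 2 ≤
        2 * ‖f p - f (x', p.2)‖ₑ ^ 2 + 2 * ‖f (x', p.2) - f (x', y')‖ₑ ^ 2 := by
      intro x' y'
      rw [← mul_add]
      convert enorm_add_sq_le (f p - f (x', p.2)) (f (x', p.2) - f (x', y')) using 3
      ring
    refine (lintegral_mono fun x' => lintegral_mono fun y' => this x' y').trans (le_of_eq ?_)
    have e2 : ∀ x', ∫⁻ y', 2 * ‖f p - f (x', p.2)‖ₑ ^ 2 +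
        2 * ‖f (x', p.2) - f (x', y')‖ₑ ^ 2 ∂ν = 2 * ν univ * ‖f p - f (x', p.2)‖ₑ ^ 2 +
        2 * ∫⁻ y', ‖f (x', p.2) - f (x', y')‖ₑ ^ 2 ∂ν := by
      intro x'
      rw [lintegral_add_left measurable_const, lintegral_const,
        lintegral_const_mul' _ _ (by finiteness)]
      ring
    simp_rw [e2]
    rw [lintegral_add_left (by fun_prop), lintegral_const_mul' _ _ (by finiteness),
      lintegral_const_mul' _ _ (by finiteness), mul_assoc]
  refine (lintegral_mono e1).trans ?_
  have m3 : Measurable fun p : X × Y => ∫⁻ x', ‖f p - f (x', p.2)‖ₑ ^ 2 ∂μ :=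
    Measurable.lintegral_prod_right' m1
  rw [lintegral_add_left ((m3.const_mul _).const_mul _),
    lintegral_const_mul' _ _ (by finiteness), lintegral_const_mul' _ _ (by finiteness),
    lintegral_const_mul' _ _ (by finiteness)]
  gcongr 2 * (_ * ?_) + 2 * ?_
  · rw [lintegral_prod_symm _ m3.aemeasurable]
    rfl
  · have m4 : Measurable fun p : X × Y =>
        ∫⁻ x', ∫⁻ y', ‖f (x', p.2) - f (x', y')‖ₑ ^ 2 ∂ν ∂μ := by
      have : Measurable fun p : ((X × Y) × X) × Y =>
        ‖f (p.1.2, p.1.1.2) - f (p.1.2, p.2)‖ₑ ^ 2 := by fun_prop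
      exact Measurable.lintegral_prod_right' (Measurable.lintegral_prod_right' this)
    rw [lintegral_prod _ m4.aemeasurable]
    dsimp only
    rw [lintegral_const, mul_comm]
    gcongr _ * ?_
    have m5 : Measurable fun p : Y × X => ∫⁻ y', ‖f (p.2, p.1) - f (p.2, y')‖ₑ ^ 2 ∂ν := by
      have : Measurable fun p : (Y × X) × Y => ‖f (p.1.2, p.1.1) - f (p.1.2, p.2)‖ₑ ^ 2 := by
        fun_prop
      exact Measurable.lintegral_prod_right' this
    rw [lintegral_lintegral_swap m5.aemeasurable]
    rfl

/-- Poincaré inequality on an interval, in terms of the oscillation. -/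
theorem oscillation_Ico_le {w w' : ℝ → ℂ} (hw : ∀ x, HasDerivAt w (w' x) x)
    (hc : Continuous w') (a δ : ℝ) :
    oscillation (volume.restrict (Ico a (a + δ))) w ≤
      ENNReal.ofReal δ ^ 3 * ∫⁻ x in Ico a (a + δ), ‖w' x‖ₑ ^ 2 := by
  -- The fundamental theorem of calculus and Cauchy–Schwarz give one factor `δ`; integrating over
  -- `x` and `y` supplies the other two.
  have key : ∀ x ∈ Ico a (a + δ), ∀ y ∈ Ico a (a + δ), ‖w x - w y‖ₑ ^ 2 ≤
      ENNReal.ofReal δ * ∫⁻ x in Ico a (a + δ), ‖w' x‖ₑ ^ 2 := by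
    intro x hx y hy
    have h1 : w x - w y = ∫ t in y..x, w' t :=
      (intervalIntegral.integral_eq_sub_of_hasDerivAt (fun t _ => hw t)
        (hc.intervalIntegrable _ _)).symm
    have h2 : ‖w x - w y‖ₑ ≤ ∫⁻ t in Ico a (a + δ), ‖w' t‖ₑ := by
      rw [h1, ← enorm_norm, intervalIntegral.norm_intervalIntegral_eq, enorm_norm]
      refine (enorm_integral_le_lintegral_enorm _).trans ?_
      refine lintegral_mono_set fun t ht => ?_
      rw [mem_uIoc] at ht
      rcases ht with ht | ht
      · exact ⟨hy.1.trans ht.1.le, ht.2.trans_lt hx.2⟩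
      · exact ⟨hx.1.trans ht.1.le, ht.2.trans_lt hy.2⟩
    refine (pow_le_pow_left₀ zero_le h2 2).trans ?_
    refine (sq_lintegral_le _ (by fun_prop)).trans (le_of_eq ?_)
    simp
  calc oscillation (volume.restrict (Ico a (a + δ))) w
      ≤ ∫⁻ x in Ico a (a + δ), ∫⁻ y in Ico a (a + δ),
          ENNReal.ofReal δ * ∫⁻ x in Ico a (a + δ), ‖w' x‖ₑ ^ 2 :=
        setLIntegral_mono' measurableSet_Ico fun x hx =>
          setLIntegral_mono' measurableSet_Ico fun y hy => key x hx y hy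
    _ = _ := by
        simp
        ring

/-- The half-open cube with lower corner `a` and side `δ`. -/
def cell (a : Space) (δ : ℝ) : Set Space :=
  Ico a.1 (a.1 + δ) ×ˢ Ico a.2.1 (a.2.1 + δ) ×ˢ Ico a.2.2 (a.2.2 + δ)

theorem measurableSet_cell (a : Space) (δ : ℝ) : MeasurableSet (cell a δ) :=
  measurableSet_Ico.prod (measurableSet_Ico.prod measurableSet_Ico)

theorem volume_restrict_cell (a : Space) (δ : ℝ) : volume.restrict (cell a δ) =
    (volume.restrict (Ico a.1 (a.1 + δ))).prod ((volume.restrict (Ico a.2.1 (a.2.1 + δ))).prod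
      (volume.restrict (Ico a.2.2 (a.2.2 + δ)))) := by
  rw [Measure.prod_restrict, Measure.prod_restrict]
  rfl

theorem volume_cell (a : Space) (δ : ℝ) : volume (cell a δ) = ENNReal.ofReal δ ^ 3 := by
  rw [← Measure.restrict_apply_univ, volume_restrict_cell]
  simp only [← univ_prod_univ, Measure.prod_prod]
  simp
  ring

theorem hasDerivAt_slice {φ : Space → ℂ} (hφ : Differentiable ℝ φ) {c : ℝ → Space} {v : Space}
    (hc : ∀ t, HasDerivAt c v t) (t : ℝ) :
    HasDerivAt (fun t => φ (c t)) (fderiv ℝ φ (c t) v) t :=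
  (hφ (c t)).hasFDerivAt.comp_hasDerivAt t (hc t)

theorem hasDerivAt_line_zero (y z t : ℝ) :
    HasDerivAt (fun t : ℝ => ((t, y, z) : Space)) (dir 0) t :=
  (hasDerivAt_id t).prodMk (hasDerivAt_const t (y, z))

theorem hasDerivAt_line_one (x z t : ℝ) :
    HasDerivAt (fun t : ℝ => ((x, t, z) : Space)) (dir 1) t :=
  (hasDerivAt_const t x).prodMk ((hasDerivAt_id t).prodMk (hasDerivAt_const t z))

theorem hasDerivAt_line_two (x y t : ℝ) :
    HasDerivAt (fun t : ℝ => ((x, y, t) : Space)) (dir 2) t :=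
  (hasDerivAt_const t x).prodMk ((hasDerivAt_const t y).prodMk (hasDerivAt_id t))

/-- Each direction contributes `δ³` from its interval and `δ²` from the frozen variables. The
constant is 4 because the second and third directions pass through the product estimate twice. -/
theorem oscillation_cell_le {φ : Space → ℂ} (hφ : ContDiff ℝ 1 φ) (a : Space) (δ : ℝ) :
    oscillation (volume.restrict (cell a δ)) φ ≤ 4 * ENNReal.ofReal δ ^ 5 *
      ∑ j, ∫⁻ x in cell a δ, ‖fderiv ℝ φ x (dir j)‖ₑ ^ 2 := by
  have hd := hφ.differentiable one_ne_zero
  have hc : ∀ j, Continuous fun x => fderiv ℝ φ x (dir j) := fun j =>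
    (hφ.continuous_fderiv one_ne_zero).clm_apply continuous_const
  have hm : ∀ j, Measurable fun x => ‖fderiv ℝ φ x (dir j)‖ₑ ^ 2 := fun j => by
    have := hc j
    fun_prop
  rw [volume_restrict_cell]
  set μ := volume.restrict (Ico a.1 (a.1 + δ))
  set ν := volume.restrict (Ico a.2.1 (a.2.1 + δ))
  set τ := volume.restrict (Ico a.2.2 (a.2.2 + δ))
  set d := ENNReal.ofReal δ with hd'
  have hμ : μ univ = d := by simp [μ, hd']
  have hν : ν univ = d := by simp [ν, hd']
  have hτ : τ univ = d := by simp [τ, hd']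
  have hντ : (ν.prod τ) univ = d ^ 2 := by
    rw [← univ_prod_univ, Measure.prod_prod, hν, hτ, sq]
  have h0 : ∫⁻ y, oscillation μ (fun x => φ (x, y)) ∂ν.prod τ ≤
      d ^ 3 * ∫⁻ p, ‖fderiv ℝ φ p (dir 0)‖ₑ ^ 2 ∂μ.prod (ν.prod τ) := by
    rw [lintegral_prod_symm _ (hm 0).aemeasurable, ← lintegral_const_mul' _ _ (by finiteness)]
    refine lintegral_mono fun y => ?_
    exact oscillation_Ico_le (fun t => hasDerivAt_slice hd (hasDerivAt_line_zero y.1 y.2) t)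
      ((hc 0).comp (by fun_prop)) _ _
  have h1 : ∀ x, oscillation (ν.prod τ) (fun y => φ (x, y)) ≤
      2 * d ^ 4 * ∫⁻ y, ‖fderiv ℝ φ (x, y) (dir 1)‖ₑ ^ 2 ∂ν.prod τ +
      2 * d ^ 4 * ∫⁻ y, ‖fderiv ℝ φ (x, y) (dir 2)‖ₑ ^ 2 ∂ν.prod τ := by
    intro x
    have hcx : Measurable fun y : ℝ × ℝ => φ (x, y) :=
      (hφ.continuous.comp (by fun_prop)).measurable
    refine (oscillation_prod_le ν τ hcx).trans ?_
    rw [hν, hτ]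
    have hmx : ∀ j, Measurable fun y : ℝ × ℝ => ‖fderiv ℝ φ (x, y) (dir j)‖ₑ ^ 2 :=
      fun j => (hm j).comp measurable_prodMk_left
    have e1 : ∫⁻ z, oscillation ν (fun y => φ (x, y, z)) ∂τ ≤
        d ^ 3 * ∫⁻ y, ‖fderiv ℝ φ (x, y) (dir 1)‖ₑ ^ 2 ∂ν.prod τ := by
      rw [lintegral_prod_symm _ (hmx 1).aemeasurable,
        ← lintegral_const_mul' _ _ (by finiteness)]
      refine lintegral_mono fun z => ?_
      exact oscillation_Ico_le (fun t => hasDerivAt_slice hd (hasDerivAt_line_one x z) t)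
        ((hc 1).comp (by fun_prop)) _ _
    have e2 : ∫⁻ y, oscillation τ (fun z => φ (x, y, z)) ∂ν ≤
        d ^ 3 * ∫⁻ y, ‖fderiv ℝ φ (x, y) (dir 2)‖ₑ ^ 2 ∂ν.prod τ := by
      rw [lintegral_prod _ (hmx 2).aemeasurable,
        ← lintegral_const_mul' _ _ (by finiteness)]
      refine lintegral_mono fun y => ?_
      exact oscillation_Ico_le (fun t => hasDerivAt_slice hd (hasDerivAt_line_two x y) t)
        ((hc 2).comp (by fun_prop)) _ _
    calc _ ≤ 2 * (d * (d ^ 3 * ∫⁻ y, ‖fderiv ℝ φ (x, y) (dir 1)‖ₑ ^ 2 ∂ν.prod τ)) +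
          2 * (d * (d ^ 3 * ∫⁻ y, ‖fderiv ℝ φ (x, y) (dir 2)‖ₑ ^ 2 ∂ν.prod τ)) := by gcongr
      _ = _ := by ring
  have h2 : ∫⁻ x, oscillation (ν.prod τ) (fun y => φ (x, y)) ∂μ ≤
      2 * d ^ 4 * ∫⁻ p, ‖fderiv ℝ φ p (dir 1)‖ₑ ^ 2 ∂μ.prod (ν.prod τ) +
      2 * d ^ 4 * ∫⁻ p, ‖fderiv ℝ φ p (dir 2)‖ₑ ^ 2 ∂μ.prod (ν.prod τ) := by
    refine (lintegral_mono h1).trans (le_of_eq ?_)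
    rw [lintegral_prod _ (hm 1).aemeasurable, lintegral_prod _ (hm 2).aemeasurable,
      lintegral_add_left ((Measurable.lintegral_prod_right' (hm 1)).const_mul _),
      lintegral_const_mul' _ _ (by finiteness), lintegral_const_mul' _ _ (by finiteness)]
  refine (oscillation_prod_le μ (ν.prod τ) hφ.continuous.measurable).trans ?_
  rw [hμ, hντ, Fin.sum_univ_three]
  calc _ ≤ 2 * (d ^ 2 * (d ^ 3 * ∫⁻ p, ‖fderiv ℝ φ p (dir 0)‖ₑ ^ 2 ∂μ.prod (ν.prod τ))) +
        2 * (d * (2 * d ^ 4 * ∫⁻ p, ‖fderiv ℝ φ p (dir 1)‖ₑ ^ 2 ∂μ.prod (ν.prod τ) +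
      2 * d ^ 4 * ∫⁻ p, ‖fderiv ℝ φ p (dir 2)‖ₑ ^ 2 ∂μ.prod (ν.prod τ))) := by gcongr
    _ = 2 * (d ^ 5 * ∫⁻ p, ‖fderiv ℝ φ p (dir 0)‖ₑ ^ 2 ∂μ.prod (ν.prod τ)) +
        4 * d ^ 5 * (∫⁻ p, ‖fderiv ℝ φ p (dir 1)‖ₑ ^ 2 ∂μ.prod (ν.prod τ) +
      ∫⁻ p, ‖fderiv ℝ φ p (dir 2)‖ₑ ^ 2 ∂μ.prod (ν.prod τ)) := by ring
    _ ≤ 4 * (d ^ 5 * ∫⁻ p, ‖fderiv ℝ φ p (dir 0)‖ₑ ^ 2 ∂μ.prod (ν.prod τ)) +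
        4 * d ^ 5 * (∫⁻ p, ‖fderiv ℝ φ p (dir 1)‖ₑ ^ 2 ∂μ.prod (ν.prod τ) +
      ∫⁻ p, ‖fderiv ℝ φ p (dir 2)‖ₑ ^ 2 ∂μ.prod (ν.prod τ)) := by gcongr; norm_num
    _ = _ := by ring

/-- Poincaré inequality on a cube. -/
theorem poincare_cell {φ : Space → ℂ} (hφ : IsTest φ) (a : Space) {δ : ℝ} (hδ : 0 < δ) :
    ∫⁻ x in cell a δ, ‖φ x‖ₑ ^ 2 ≤
      8 * ENNReal.ofReal δ ^ 2 * (∑ j, ∫⁻ x in cell a δ, ‖fderiv ℝ φ x (dir j)‖ₑ ^ 2) +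
        2 * (ENNReal.ofReal δ ^ 3)⁻¹ * ‖∫ x in cell a δ, φ x‖ₑ ^ 2 := by
  have := isAddHaarMeasure_volume
  have hfin : IsFiniteMeasure (volume.restrict (cell a δ)) := ⟨by
    rw [Measure.restrict_apply_univ, volume_cell]; finiteness⟩
  have h1 := lintegral_sq_le_oscillation (volume.restrict (cell a δ))
    (hφ.1.continuous.integrable_of_hasCompactSupport hφ.2).restrict
  rw [Measure.restrict_apply_univ, volume_cell] at h1
  have h2 := oscillation_cell_le (hφ.1.of_le (by simp)) a δ
  have hd : ENNReal.ofReal δ ≠ 0 := by simpa using hδ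
  set d := ENNReal.ofReal δ with hd'
  have h3 : d ^ 3 ≠ 0 := pow_ne_zero _ hd
  have h4 : d ^ 3 ≠ ⊤ := by finiteness
  rw [← ENNReal.mul_le_mul_iff_right h3 h4]
  refine h1.trans ?_
  calc _ ≤ 2 * (4 * d ^ 5 * ∑ j, ∫⁻ x in cell a δ, ‖fderiv ℝ φ x (dir j)‖ₑ ^ 2) +
        2 * ‖∫ x in cell a δ, φ x‖ₑ ^ 2 := by gcongr
    _ = d ^ 3 * (8 * d ^ 2 * (∑ j, ∫⁻ x in cell a δ, ‖fderiv ℝ φ x (dir j)‖ₑ ^ 2)) +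
        2 * (d ^ 3 * (d ^ 3)⁻¹) * ‖∫ x in cell a δ, φ x‖ₑ ^ 2 := by
        rw [ENNReal.mul_inv_cancel h3 h4]; ring
    _ = _ := by ring

/-- The half-open cube `[-R, R)³`. -/
def box (R : ℝ) : Set Space := cell (-R, -R, -R) (2 * R)

theorem measurableSet_box (R : ℝ) : MeasurableSet (box R) := measurableSet_cell _ _

theorem mem_Ico_div_iff {m : ℝ} (hm : 0 < m) (k : ℤ) (x : ℝ) :
    x ∈ Ico (k / m : ℝ) (k / m + 1 / m) ↔ ⌊m * x⌋ = k := by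
  rw [Int.floor_eq_iff, mem_Ico, ← add_div, div_le_iff₀ hm, lt_div_iff₀ hm, mul_comm]

/-- The cube of side `1 / m` at the lattice point `k / m`. -/
def latticeCell (m : ℝ) (k : ℤ × ℤ × ℤ) : Set Space :=
  cell (k.1 / m, k.2.1 / m, k.2.2 / m) (1 / m)

theorem measurableSet_latticeCell (m : ℝ) (k : ℤ × ℤ × ℤ) : MeasurableSet (latticeCell m k) :=
  measurableSet_cell _ _

theorem volume_latticeCell_ne_top (m : ℝ) (k : ℤ × ℤ × ℤ) : volume (latticeCell m k) ≠ ⊤ := by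
  rw [latticeCell, volume_cell]
  finiteness

theorem mem_latticeCell_iff {m : ℝ} (hm : 0 < m) (k : ℤ × ℤ × ℤ) (x : Space) :
    x ∈ latticeCell m k ↔ (⌊m * x.1⌋, ⌊m * x.2.1⌋, ⌊m * x.2.2⌋) = k := by
  rw [latticeCell, cell, mem_prod, mem_prod, mem_Ico_div_iff hm, mem_Ico_div_iff hm,
    mem_Ico_div_iff hm]
  simp [Prod.ext_iff]

/-- The lattice points whose cells fill the box. -/
noncomputable def latticeBox (m R : ℕ) : Finset (ℤ × ℤ × ℤ) :=
  Finset.Ico (-(m * R : ℤ)) (m * R) ×ˢ Finset.Ico (-(m * R : ℤ)) (m * R) ×ˢ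
    Finset.Ico (-(m * R : ℤ)) (m * R)

/-- With `R` and `m` natural numbers, `±R` are multiples of `1 / m`, so the half-open grid cells
tile the box exactly; rounding down identifies the cell of each point. -/
theorem lintegral_box {m : ℕ} (hm : 0 < m) (R : ℕ) (f : Space → ℝ≥0∞) :
    ∫⁻ x in box R, f x = ∑ k ∈ latticeBox m R, ∫⁻ x in latticeCell m k, f x := by
  have hm' : (0 : ℝ) < m := by exact_mod_cast hm
  rw [← lintegral_biUnion_finset]
  · congr 2
    ext x
    have h1 : ∀ t : ℝ, t ∈ Ico (-R : ℝ) (-R + 2 * R) ↔ -(m * R : ℤ) ≤ ⌊m * t⌋ ∧ ⌊m * t⌋ < m * R := by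
      intro t
      rw [Int.le_floor, Int.floor_lt, mem_Ico]
      push_cast
      rw [show -((m : ℝ) * R) = m * (-R) by ring, mul_le_mul_iff_right₀ hm',
        mul_lt_mul_iff_right₀ hm', show -(R : ℝ) + 2 * R = R by ring]
    simp only [mem_iUnion, exists_prop, mem_latticeCell_iff hm', box, cell, mem_prod, h1,
      exists_eq_right', latticeBox, Finset.mem_product, Finset.mem_Ico]
  · intro k _ l _ hkl
    refine Set.disjoint_left.2 fun x hk hl => hkl ?_
    rw [mem_latticeCell_iff hm'] at hk hl
    exact hk.symm.trans hl
  · exact fun k _ => measurableSet_cell _ _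

/-- A quantitative Rellich theorem: refining the grid makes the gradient coefficient as small as
desired, at the price of finitely many cell integrals. -/
theorem poincare_box {φ : Space → ℂ} (hφ : IsTest φ) {m : ℕ} (hm : 0 < m) (R : ℕ) :
    ∫⁻ x in box R, ‖φ x‖ₑ ^ 2 ≤
      8 * ENNReal.ofReal (1 / m) ^ 2 * (∑ j, ∫⁻ x in box R, ‖fderiv ℝ φ x (dir j)‖ₑ ^ 2) +
        2 * (ENNReal.ofReal (1 / m) ^ 3)⁻¹ *
          ∑ k ∈ latticeBox m R, ‖∫ x in latticeCell m k, φ x‖ₑ ^ 2 := by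
  have hm' : (0 : ℝ) < 1 / m := by positivity
  simp_rw [lintegral_box hm]
  rw [Finset.sum_comm, Finset.mul_sum, Finset.mul_sum, ← Finset.sum_add_distrib]
  exact Finset.sum_le_sum fun k _ => poincare_cell hφ _ hm'

/-! ### Form compactness of decaying potentials -/

theorem lintegral_enorm_sq (u : L2) : ∫⁻ x, ‖u x‖ₑ ^ 2 = ENNReal.ofReal (‖u‖ ^ 2) := by
  rw [Lp.norm_def, eLpNorm_eq_lintegral_rpow_enorm_toReal (by simp) (by simp)]
  have h := (Lp.memLp u).2
  rw [eLpNorm_lt_top_iff_lintegral_rpow_enorm_lt_top (by simp) (by simp)] at h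
  simp only [ENNReal.toReal_ofNat, ENNReal.rpow_ofNat] at h ⊢
  rw [← ENNReal.toReal_pow, ENNReal.ofReal_toReal (by finiteness), ← ENNReal.rpow_natCast,
    ← ENNReal.rpow_mul]
  simp

theorem enorm_sq_eq_ofReal {E : Type*} [SeminormedAddCommGroup E] (a : E) :
    ‖a‖ₑ ^ 2 = ENNReal.ofReal (‖a‖ ^ 2) := by
  rw [ENNReal.ofReal_pow (norm_nonneg _), ofReal_norm]

theorem enorm_fderiv_sq_le (A : Space → Fin 3 → ℝ) (φ : Space → ℂ) (j : Fin 3) (x : Space)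
    {K : ℝ} (hK : |A x j| ≤ K) : ‖fderiv ℝ φ x (dir j)‖ₑ ^ 2 ≤
      2 * ‖magD A φ j x‖ₑ ^ 2 + 2 * ENNReal.ofReal (K ^ 2) * ‖φ x‖ₑ ^ 2 := by
  have h1 : ‖fderiv ℝ φ x (dir j)‖ₑ = ‖magD A φ j x + -((A x j : ℂ) * φ x)‖ₑ := by
    rw [magD, add_neg_cancel_right, enorm_mul]
    simp [← ofReal_norm]
  rw [h1]
  refine (enorm_add_sq_le _ _).trans ?_
  rw [mul_add, mul_assoc 2 (ENNReal.ofReal _), enorm_neg, enorm_mul, mul_pow,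
    enorm_sq_eq_ofReal (A x j : ℂ)]
  gcongr
  rw [Complex.norm_real]
  exact hK

/-- Local compactness of the form domain: the mass in a box is controlled by a small multiple of
the form norm up to finitely many functionals. -/
theorem exists_box_bound (A : Space → Fin 3 → ℝ) (R : ℕ) (K : ℝ)
    (hK : ∀ᵐ x, x ∈ box R → ∀ j, |A x j| ≤ K) {ε : ℝ} (hε : 0 < ε) :
    ∃ (s : Finset (ℤ × ℤ × ℤ)) (e : ℤ × ℤ × ℤ → L2) (C : ℝ), 0 ≤ C ∧ ∀ q ∈ gradGraph A,
      ∫⁻ x in box R, ‖q.1 x‖ₑ ^ 2 ≤ ENNReal.ofReal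
        (ε * (‖q.1‖ ^ 2 + ∑ j, ‖q.2 j‖ ^ 2) + C * ∑ k ∈ s, ‖inner ℂ (e k) q.1‖ ^ 2) := by
  -- Replacing each `|∂ⱼφ|²` by `2 |Dⱼφ|² + 2 K² |φ|²` in the Poincaré bound `8 δ² ∑ⱼ ‖∂ⱼφ‖²` gives
  -- at most `16 (1 + 3 K²) δ²` times the form norm squared; the 3 counts directions.
  obtain ⟨m, hm⟩ := exists_nat_gt (16 * (1 + 3 * K ^ 2) / ε)
  have hm1 : (0 : ℝ) < m := lt_of_le_of_lt (by positivity) hm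
  have hm0 : 0 < m := by exact_mod_cast hm1
  have hm2 : (1 : ℝ) ≤ m := by exact_mod_cast hm0
  set δ : ℝ := 1 / m with hδ
  have hδ0 : 0 < δ := by positivity
  have hδ1 : δ ≤ 1 := by rw [hδ, div_le_one hm1]; exact hm2
  have hδε : 16 * (1 + 3 * K ^ 2) * δ ^ 2 ≤ ε := by
    have h1 : 16 * (1 + 3 * K ^ 2) * δ ≤ ε := by
      rw [div_lt_iff₀ hε] at hm
      rw [hδ, mul_one_div, div_le_iff₀ hm1]
      linarith
    have : 16 * (1 + 3 * K ^ 2) * δ ^ 2 ≤ 16 * (1 + 3 * K ^ 2) * δ := by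
      have : δ ^ 2 ≤ δ := by nlinarith
      gcongr
    linarith
  -- Indicators of the cells turn the cell integrals into bounded functionals on `L²`.
  obtain ⟨e, he⟩ : ∃ e : ℤ × ℤ × ℤ → L2, ∀ k u, inner ℂ (e k) u = ∫ x in latticeCell m k, u x :=
    ⟨fun k => indicatorConstLp 2 (measurableSet_latticeCell m k) (volume_latticeCell_ne_top m k) 1,
      fun k u => L2.inner_indicatorConstLp_one _ _ _⟩
  refine ⟨latticeBox m R, e, 2 * (δ ^ 3)⁻¹, by positivity, ?_⟩
  rintro ⟨u, v⟩ ⟨φ, hφ, hu, hv⟩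
  dsimp only at hu hv ⊢
  have e1 : ∫⁻ x in box R, ‖u x‖ₑ ^ 2 = ∫⁻ x in box R, ‖φ x‖ₑ ^ 2 :=
    lintegral_congr_ae (ae_restrict_of_ae (hu.mono fun x hx => by dsimp only; rw [hx]))
  have e2 : ∀ k, inner ℂ (e k) u = ∫ x in latticeCell m k, φ x := fun k => by
    rw [he]
    exact integral_congr_ae (ae_restrict_of_ae hu)
  have e3 : ∀ j, ∫⁻ x in box R, ‖fderiv ℝ φ x (dir j)‖ₑ ^ 2 ≤
      ENNReal.ofReal (2 * ‖v j‖ ^ 2 + 2 * K ^ 2 * ‖u‖ ^ 2) := by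
    intro j
    calc ∫⁻ x in box R, ‖fderiv ℝ φ x (dir j)‖ₑ ^ 2
        ≤ ∫⁻ x in box R, (2 * ‖v j x‖ₑ ^ 2 + 2 * ENNReal.ofReal (K ^ 2) * ‖u x‖ₑ ^ 2) := by
          refine lintegral_mono_ae ?_
          refine (ae_restrict_iff' (measurableSet_box _)).2 ?_
          filter_upwards [hK, hu, hv j] with x hx hux hvx hxb
          rw [hux, hvx]
          exact enorm_fderiv_sq_le A φ j x (hx hxb j)
      _ ≤ ∫⁻ x, (2 * ‖v j x‖ₑ ^ 2 + 2 * ENNReal.ofReal (K ^ 2) * ‖u x‖ₑ ^ 2) :=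
          setLIntegral_le_lintegral _ _
      _ = _ := by
          rw [lintegral_add_left' (by
            have := (Lp.aestronglyMeasurable (v j)).enorm
            fun_prop), lintegral_const_mul' _ _ (by finiteness),
            lintegral_const_mul' _ _ (by finiteness), lintegral_enorm_sq, lintegral_enorm_sq,
            ENNReal.ofReal_add (by positivity) (by positivity), ENNReal.ofReal_mul (by positivity),
            ENNReal.ofReal_mul (by positivity), ENNReal.ofReal_mul (by positivity)]
          simp
  rw [e1]
  refine (poincare_box hφ hm0 R).trans ?_
  simp_rw [← e2]
  have h8 : (8 : ℝ≥0∞) = ENNReal.ofReal 8 := by simp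
  have h2 : (2 : ℝ≥0∞) = ENNReal.ofReal 2 := by simp
  calc _ ≤ 8 * ENNReal.ofReal δ ^ 2 *
        (∑ j, ENNReal.ofReal (2 * ‖v j‖ ^ 2 + 2 * K ^ 2 * ‖u‖ ^ 2)) +
        2 * (ENNReal.ofReal δ ^ 3)⁻¹ * ∑ k ∈ latticeBox m R, ‖inner ℂ (e k) u‖ₑ ^ 2 := by
        gcongr with j
        exact e3 j
    _ = ENNReal.ofReal (8 * δ ^ 2 * (∑ j, (2 * ‖v j‖ ^ 2 + 2 * K ^ 2 * ‖u‖ ^ 2)) +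
        2 * (δ ^ 3)⁻¹ * ∑ k ∈ latticeBox m R, ‖inner ℂ (e k) u‖ ^ 2) := by
        simp_rw [enorm_sq_eq_ofReal]
        rw [h8, show (2 : ℝ≥0∞) * _ = ENNReal.ofReal 2 * _ by rw [← h2], ← ENNReal.ofReal_sum_of_nonneg (fun j _ => by positivity),
          ← ENNReal.ofReal_sum_of_nonneg (fun j _ => by positivity),
          ← ENNReal.ofReal_pow hδ0.le, ← ENNReal.ofReal_pow hδ0.le,
          ← ENNReal.ofReal_inv_of_pos (by positivity), ← ENNReal.ofReal_mul (by positivity),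
          ← ENNReal.ofReal_mul (by positivity), ← ENNReal.ofReal_mul (by positivity),
          ← ENNReal.ofReal_mul (by positivity), ← ENNReal.ofReal_add (by positivity) (by positivity)]
    _ ≤ _ := by
        refine ENNReal.ofReal_le_ofReal ?_
        gcongr ?_ + _
        simp only [Fin.sum_univ_three]
        have a0 := sq_nonneg ‖v 0‖
        have a1 := sq_nonneg ‖v 1‖
        have a2 := sq_nonneg ‖v 2‖
        have a3 := sq_nonneg ‖u‖
        calc _ = 16 * δ ^ 2 * (‖v 0‖ ^ 2 + ‖v 1‖ ^ 2 + ‖v 2‖ ^ 2) +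
              (16 * (3 * K ^ 2) * δ ^ 2) * ‖u‖ ^ 2 := by ring
          _ ≤ (16 * (1 + 3 * K ^ 2) * δ ^ 2) * (‖v 0‖ ^ 2 + ‖v 1‖ ^ 2 + ‖v 2‖ ^ 2) +
              (16 * (1 + 3 * K ^ 2) * δ ^ 2) * ‖u‖ ^ 2 := by
            gcongr
            · nlinarith [sq_nonneg K, sq_nonneg δ, mul_nonneg (sq_nonneg K) (sq_nonneg δ)]
            · linarith
          _ ≤ ε * (‖v 0‖ ^ 2 + ‖v 1‖ ^ 2 + ‖v 2‖ ^ 2) + ε * ‖u‖ ^ 2 := by gcongr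
          _ = _ := by ring

/-- A bounded function is small at infinity. -/
def VanishesAtInfinity (W : Space → ℝ) : Prop :=
  (∃ M : ℝ, ∀ᵐ x, |W x| ≤ M) ∧ ∀ ε : ℝ, 0 < ε → ∃ R : ℕ, ∀ᵐ x, x ∉ box R → |W x| ≤ ε

/-- Multiplication by a bounded function vanishing at infinity is form-compact. -/
theorem exists_potential_bound (A : Space → Fin 3 → ℝ)
    (hA : ∀ R : ℕ, ∃ K : ℝ, ∀ᵐ x, x ∈ box R → ∀ j, |A x j| ≤ K) {W : Space → ℝ}
    (hW : VanishesAtInfinity W) {ε : ℝ} (hε : 0 < ε) :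
    ∃ (s : Finset (ℤ × ℤ × ℤ)) (e : ℤ × ℤ × ℤ → L2) (C : ℝ), 0 ≤ C ∧ ∀ q ∈ gradGraph A,
      ∫⁻ x, ‖(W x : ℂ) * q.1 x‖ₑ ^ 2 ≤ ENNReal.ofReal
        (ε * (‖q.1‖ ^ 2 + ∑ j, ‖q.2 j‖ ^ 2) + C * ∑ k ∈ s, ‖inner ℂ (e k) q.1‖ ^ 2) := by
  obtain ⟨⟨M, hM⟩, hinf⟩ := hW
  obtain ⟨R, hR⟩ := hinf √(ε / 2) (by positivity)
  obtain ⟨K, hK⟩ := hA R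
  -- Outside the box `|W|² ≤ ε / 2`. Inside, `|W|² ≤ M²` multiplies the box bound, and the `+ 1`
  -- keeps the quotient meaningful when `M = 0`.
  obtain ⟨s, e, C, hC, h⟩ := exists_box_bound A R K hK (ε := ε / 2 / (M ^ 2 + 1)) (by positivity)
  refine ⟨s, e, M ^ 2 * C, by positivity, fun q hq => ?_⟩
  have hpt : ∀ᵐ x, ‖(W x : ℂ) * q.1 x‖ₑ ^ 2 ≤ ENNReal.ofReal (ε / 2) * ‖q.1 x‖ₑ ^ 2 +
      ENNReal.ofReal (M ^ 2) * (box R).indicator (fun x => ‖q.1 x‖ₑ ^ 2) x := by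
    filter_upwards [hM, hR] with x h1 h2
    rw [enorm_mul, mul_pow, enorm_sq_eq_ofReal (W x : ℂ), Complex.norm_real, Real.norm_eq_abs]
    by_cases hx : x ∈ box R
    · rw [indicator_of_mem hx]
      refine le_add_left ?_
      gcongr
    · rw [indicator_of_notMem hx, mul_zero, add_zero]
      gcongr
      calc |W x| ^ 2 ≤ √(ε / 2) ^ 2 := by gcongr; exact h2 hx
        _ = ε / 2 := Real.sq_sqrt (by positivity)
  refine (lintegral_mono_ae hpt).trans ?_
  have hm := (Lp.aestronglyMeasurable q.1).enorm
  rw [lintegral_add_left' (by fun_prop), lintegral_const_mul' _ _ (by finiteness),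
    lintegral_const_mul' _ _ (by finiteness), lintegral_indicator (measurableSet_box _),
    lintegral_enorm_sq]
  refine (add_le_add_right (mul_le_mul_right (h q hq) _) _).trans ?_
  have hs : 0 ≤ ∑ j, ‖q.2 j‖ ^ 2 := by positivity
  rw [← ENNReal.ofReal_mul (by positivity), ← ENNReal.ofReal_mul (by positivity),
    ← ENNReal.ofReal_add (by positivity) (by positivity)]
  refine ENNReal.ofReal_le_ofReal ?_
  have h3 : M ^ 2 * (ε / 2 / (M ^ 2 + 1)) ≤ ε / 2 := by
    rw [mul_div_assoc', div_le_iff₀ (by positivity)]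
    nlinarith [sq_nonneg M]
  have h4 := mul_le_mul_of_nonneg_right h3 (show 0 ≤ ‖q.1‖ ^ 2 + ∑ j, ‖q.2 j‖ ^ 2 by positivity)
  have h5 : 0 ≤ ε / 2 * ∑ j, ‖q.2 j‖ ^ 2 := by positivity
  linarith

/-! ### The commutator lower bound for the magnetic form -/

/-- Integration by parts in the first variable against a function of the other variables. -/
theorem integral_mul_deriv_fst_eq_zero {c : ℝ × ℝ → ℝ} (hc : AEStronglyMeasurable c volume)
    {M : ℝ} (hM : ∀ᵐ y, ‖c y‖ ≤ M) {G G' : Space → ℝ}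
    (hG : ∀ y t, HasDerivAt (fun t => G (t, y)) (G' (t, y)) t) (hGc : Continuous G)
    (hGs : HasCompactSupport G) (hGc' : Continuous G') (hGs' : HasCompactSupport G') :
    Integrable (fun x : Space => c x.2 * G' x) ∧ ∫ x : Space, c x.2 * G' x = 0 := by
  have := isAddHaarMeasure_volume
  have hsnd : Measure.QuasiMeasurePreserving (Prod.snd : Space → ℝ × ℝ) volume volume :=
    Measure.quasiMeasurePreserving_snd
  have hint : Integrable (fun x : Space => c x.2 * G' x) :=
    (hGc'.integrable_of_hasCompactSupport hGs').bdd_mul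
      (hc.comp_quasiMeasurePreserving hsnd) (hsnd.ae hM)
  refine ⟨hint, ?_⟩
  have h1 : ∀ y : ℝ × ℝ, ∀ {F : Space → ℝ}, HasCompactSupport F →
      HasCompactSupport fun t => F (t, y) := fun y F hF =>
    hF.comp_isClosedEmbedding
      (Function.LeftInverse.isClosedEmbedding (f := Prod.fst) (fun _ => rfl) (by fun_prop)
        (by fun_prop))
  -- Integrating in `x₁` first leaves `c` constant in the inner integral, so no regularity of `c`
  -- beyond measurability is needed.
  rw [Measure.volume_eq_prod, integral_prod_symm _ (by rwa [← Measure.volume_eq_prod])]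
  dsimp only
  have h2 : ∀ y : ℝ × ℝ, ∫ t : ℝ, c y * G' (t, y) = 0 := by
    intro y
    rw [integral_const_mul, integral_eq_zero_of_hasDerivAt_of_integrable (hG y)
      ((hGc'.comp (by fun_prop)).integrable_of_hasCompactSupport (h1 y hGs'))
      ((hGc.comp (by fun_prop)).integrable_of_hasCompactSupport (h1 y hGs)), mul_zero]
  simp_rw [h2]
  simp

theorem IsTest.fderiv_apply {φ : Space → ℂ} (hφ : IsTest φ) (v : Space) :
    IsTest fun x => fderiv ℝ φ x v :=
  ⟨(hφ.1.fderiv_right (m := ∞) (by simp)).clm_apply contDiff_const, hφ.2.fderiv_apply ℝ v⟩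

theorem IsTest.conj {φ : Space → ℂ} (hφ : IsTest φ) : IsTest fun x => conj (φ x) :=
  ⟨Complex.conjCLE.contDiff.comp hφ.1, hφ.2.comp_left (g := starRingEnd ℂ) (map_zero _)⟩

theorem fderiv_conj_apply {φ : Space → ℂ} (hφ : IsTest φ) (x v : Space) :
    fderiv ℝ (fun x => conj (φ x)) x v = conj (fderiv ℝ φ x v) := by
  have h := Complex.conjCLE.toContinuousLinearMap.hasFDerivAt.comp x
    ((hφ.1.differentiable (by simp)) x).hasFDerivAt
  have h2 : fderiv ℝ (fun x => conj (φ x)) x = _ := h.fderiv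
  rw [h2]
  simp

theorem fderiv_fderiv_comm {φ : Space → ℂ} (hφ : IsTest φ) (x v w : Space) :
    fderiv ℝ (fun x => fderiv ℝ φ x v) x w = fderiv ℝ (fun x => fderiv ℝ φ x w) x v := by
  have hd : DifferentiableAt ℝ (fderiv ℝ φ) x :=
    (hφ.1.fderiv_right (m := ∞) (by simp)).differentiable (by simp) x
  have h1 : ∀ v w, fderiv ℝ (fun x => fderiv ℝ φ x v) x w = fderiv ℝ (fderiv ℝ φ) x w v := by
    intro v w
    rw [fderiv_clm_apply hd (differentiableAt_const v)]
    simp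
  rw [h1, h1]
  refine (hφ.1.contDiffAt.isSymmSndFDerivAt ?_).eq w v
  rw [minSmoothness_of_isRCLikeNormedField]
  exact WithTop.coe_le_coe.2 le_top

/-- `∫ Im (conj (∂ᵥφ) ∂_w φ) = 0`. -/
theorem integral_im_conj_fderiv_mul {φ : Space → ℂ} (hφ : IsTest φ) (v w : Space) :
    Integrable (fun x => (conj (fderiv ℝ φ x v) * fderiv ℝ φ x w).im) ∧
      ∫ x, (conj (fderiv ℝ φ x v) * fderiv ℝ φ x w).im = 0 := by
  have := isAddHaarMeasure_volume
  have hint : Integrable fun x => conj (fderiv ℝ φ x v) * fderiv ℝ φ x w :=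
    ((hφ.fderiv_apply v).conj.1.continuous.mul
      (hφ.fderiv_apply w).1.continuous).integrable_of_hasCompactSupport
        (hφ.fderiv_apply v).conj.2.mul_right
  refine ⟨hint.im, ?_⟩
  -- Integrating by parts in `v` and in `w` and commuting the derivatives shows that `∫ conj (∂ᵥφ)
  -- ∂_wφ` equals its own conjugate.
  have h1 := integral_parts hφ.conj (hφ.fderiv_apply w) v
  have h2 := integral_parts hφ.conj (hφ.fderiv_apply v) w
  simp_rw [fderiv_conj_apply hφ] at h1 h2
  have h3 : ∫ x, conj (φ x) * fderiv ℝ (fun x => fderiv ℝ φ x w) x v =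
      ∫ x, conj (φ x) * fderiv ℝ (fun x => fderiv ℝ φ x v) x w :=
    integral_congr_ae (Eventually.of_forall fun x => by
      dsimp only; rw [fderiv_fderiv_comm hφ])
  rw [h3, ← h2] at h1
  have h4 : ∫ x, conj (fderiv ℝ φ x w) * fderiv ℝ φ x v =
      conj (∫ x, conj (fderiv ℝ φ x v) * fderiv ℝ φ x w) := by
    rw [← integral_conj]
    exact integral_congr_ae (Eventually.of_forall fun x => by simp [mul_comm])
  rw [h4] at h1
  have h5 : ∫ x, (conj (fderiv ℝ φ x v) * fderiv ℝ φ x w).im =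
      (∫ x, conj (fderiv ℝ φ x v) * fderiv ℝ φ x w).im := integral_im hint
  rw [h5]
  have := congrArg Complex.im h1
  rw [Complex.conj_im] at this
  linarith

theorem hasDerivAt_normSq_line {φ : Space → ℂ} (hφ : IsTest φ) (y : ℝ × ℝ) (t : ℝ) :
    HasDerivAt (fun t => ‖φ (t, y)‖ ^ 2)
      (2 * inner ℝ (φ (t, y)) (fderiv ℝ φ (t, y) (dir 0))) t :=
  (hasDerivAt_slice (hφ.1.differentiable (by simp)) (hasDerivAt_line_zero y.1 y.2) t).norm_sq

/-- `∫ c ∂₁(θ |φ|²) = 0` for `θ = θ(x₁)` and `c = c(x₂, x₃)`. -/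
theorem integral_mul_deriv_normSq {φ : Space → ℂ} (hφ : IsTest φ) {θ θ' : ℝ → ℝ}
    (hθ : ∀ t, HasDerivAt θ (θ' t) t) (hθ' : Continuous θ') {c : ℝ × ℝ → ℝ}
    (hc : AEStronglyMeasurable c volume) {M : ℝ} (hM : ∀ᵐ y, ‖c y‖ ≤ M) :
    Integrable (fun x : Space => c x.2 * (θ' x.1 * ‖φ x‖ ^ 2 +
      θ x.1 * (2 * inner ℝ (φ x) (fderiv ℝ φ x (dir 0))))) ∧
    ∫ x : Space, c x.2 * (θ' x.1 * ‖φ x‖ ^ 2 +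
      θ x.1 * (2 * inner ℝ (φ x) (fderiv ℝ φ x (dir 0)))) = 0 := by
  have hθc : Continuous θ := continuous_iff_continuousAt.2 fun t => (hθ t).continuousAt
  have hφc := hφ.1.continuous
  have hpc := (hφ.fderiv_apply (dir 0)).1.continuous
  have hs : ∀ {F : Space → ℝ}, (∀ x, φ x = 0 → F x = 0) → HasCompactSupport F := fun hF =>
    hφ.2.mono fun x hx => fun h => hx (hF x h)
  refine integral_mul_deriv_fst_eq_zero hc hM (G := fun x => θ x.1 * ‖φ x‖ ^ 2)
    (fun y t => (hθ t).mul (hasDerivAt_normSq_line hφ y t)) (by fun_prop)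
    (hs fun x hx => by simp [hx]) (by fun_prop) (hs fun x hx => by simp [hx])

/-- With `D₁ = i p` and `D₂ = i q + a f` this is `|D₁ + i D₂|² ≥ 0` expanded: the square of the
annihilation operator of the lowest Landau level, taken pointwise. -/
theorem sq_norm_add_ge (p q f : ℂ) (a : ℝ) :
    2 * (conj p * q).im - 2 * a * inner ℝ f p ≤
      ‖Complex.I * p‖ ^ 2 + ‖Complex.I * q + a * f‖ ^ 2 := by
  rw [← Complex.normSq_eq_norm_sq, ← Complex.normSq_eq_norm_sq, Complex.inner]
  simp only [Complex.normSq_apply, Complex.mul_re, Complex.mul_im, Complex.add_re, Complex.add_im,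
    Complex.conj_re, Complex.conj_im, Complex.I_re, Complex.I_im, Complex.ofReal_re,
    Complex.ofReal_im]
  nlinarith [sq_nonneg (p.im + q.re + a * f.im), sq_nonneg (p.re - q.im + a * f.re)]

theorem two_mul_mul_le {ε : ℝ} (hε : 0 < ε) (a b : ℝ) : 2 * a * b ≤ ε * a ^ 2 + ε⁻¹ * b ^ 2 := by
  have h : 0 ≤ ε⁻¹ * (ε * a - b) ^ 2 := by positivity
  have e : ε⁻¹ * (ε * a - b) ^ 2 = ε * a ^ 2 + ε⁻¹ * b ^ 2 - 2 * a * b := by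
    field_simp
    ring
  linarith

theorem norm_sq_eq_integral (u : L2) : Integrable (fun x => ‖u x‖ ^ 2) ∧
    ‖u‖ ^ 2 = ∫ x, ‖u x‖ ^ 2 := by
  have h1 := (memLp_two_iff_integrable_sq_norm (Lp.aestronglyMeasurable u)).1 (Lp.memLp u)
  refine ⟨h1, ?_⟩
  rw [integral_eq_lintegral_of_nonneg_ae (Eventually.of_forall fun x => by positivity)
    h1.aestronglyMeasurable]
  simp_rw [← enorm_sq_eq_ofReal]
  rw [lintegral_enorm_sq, ENNReal.toReal_ofReal (by positivity)]

theorem integrable_sq_mul_normSq {W : Space → ℝ} (hW : AEStronglyMeasurable W volume) {M : ℝ}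
    (hM : ∀ᵐ x, |W x| ≤ M) (u : L2) : Integrable fun x => W x ^ 2 * ‖u x‖ ^ 2 := by
  refine (norm_sq_eq_integral u).1.bdd_mul (c := M ^ 2) (hW.pow 2) ?_
  filter_upwards [hM] with x hx
  rw [Real.norm_eq_abs, abs_pow]
  gcongr

theorem integral_sq_mul_normSq_le {W : Space → ℝ} (hW : AEStronglyMeasurable W volume)
    (u : L2) {b : ℝ} (hb : 0 ≤ b) (h : ∫⁻ x, ‖(W x : ℂ) * u x‖ₑ ^ 2 ≤ ENNReal.ofReal b) :
    ∫ x, W x ^ 2 * ‖u x‖ ^ 2 ≤ b := by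
  have hm : AEStronglyMeasurable (fun x => W x ^ 2 * ‖u x‖ ^ 2) volume :=
    (hW.pow 2).mul ((Lp.aestronglyMeasurable u).norm.pow 2)
  rw [integral_eq_lintegral_of_nonneg_ae (Eventually.of_forall fun x => by positivity) hm]
  refine ENNReal.toReal_le_of_le_ofReal hb (le_trans (le_of_eq ?_) h)
  refine lintegral_congr fun x => ?_
  rw [enorm_sq_eq_ofReal, norm_mul, mul_pow, Complex.norm_real, Real.norm_eq_abs, sq_abs]

/-- Integrates a pointwise inequality in which the terms `Z₁`, `Z₂`, `Z₃` are total derivatives and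
drop out. -/
theorem mul_integral_le_of_ae {X : Type*} [MeasurableSpace X] {μ : Measure X}
    {U Z₁ Z₂ Z₃ N₀ N₁ P Q : X → ℝ} (hU : Integrable U μ) (h₁ : Integrable Z₁ μ)
    (h₂ : Integrable Z₂ μ) (h₃ : Integrable Z₃ μ) (hN₀ : Integrable N₀ μ) (hN₁ : Integrable N₁ μ)
    (hP : Integrable P μ) (hQ : Integrable Q μ) (z₁ : ∫ x, Z₁ x ∂μ = 0) (z₂ : ∫ x, Z₂ x ∂μ = 0)
    (z₃ : ∫ x, Z₃ x ∂μ = 0) {a b c : ℝ} (h : ∀ᵐ x ∂μ, a * U x + (2 * Z₁ x - Z₂ x + Z₃ x) ≤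
      b * (N₀ x + N₁ x) + c * (P x + Q x)) :
    a * ∫ x, U x ∂μ ≤ b * ((∫ x, N₀ x ∂μ) + ∫ x, N₁ x ∂μ) +
      c * ((∫ x, P x ∂μ) + ∫ x, Q x ∂μ) := by
  have hle := integral_mono_ae (by fun_prop) (by fun_prop) h
  rw [integral_add (by fun_prop) (by fun_prop), integral_add (by fun_prop) (by fun_prop),
    integral_sub (by fun_prop) (by fun_prop), integral_add (by fun_prop) (by fun_prop)] at hle
  simp only [integral_const_mul, z₁, z₂, z₃] at hle
  rw [integral_add hN₀ hN₁, integral_add hP hQ] at hle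
  linarith

/-- The commutator bound `‖D₁φ‖² + ‖D₂φ‖² ≥ ∫ ∂₁a₂ |φ|²`, for `a₂ = B₀x₁ - θ(x₁)c(x₂,x₃)` perturbed
by a bounded potential `W`. -/
theorem form_lower_bound {A : Space → Fin 3 → ℝ} {B₀ : ℝ} {θ θ' : ℝ → ℝ} {c : ℝ × ℝ → ℝ}
    {W V : Space → ℝ} (hA0 : ∀ x, A x 0 = 0)
    (hA1 : ∀ x, A x 1 = B₀ * x.1 - θ x.1 * c x.2 - W x) (hV : ∀ x, V x = θ' x.1 * c x.2)
    (hθ : ∀ t, HasDerivAt θ (θ' t) t) (hθ' : Continuous θ')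
    (hc : AEStronglyMeasurable c volume) {Mc : ℝ} (hMc : ∀ᵐ y, ‖c y‖ ≤ Mc)
    (hW : AEStronglyMeasurable W volume) {MW : ℝ} (hMW : ∀ᵐ x, |W x| ≤ MW)
    (hVm : AEStronglyMeasurable V volume) {MV : ℝ} (hMV : ∀ᵐ x, |V x| ≤ MV)
    {ε : ℝ} (hε : 0 < ε) (q : L2 × (Fin 3 → L2)) (hq : q ∈ gradGraph A) :
    (B₀ - ε) * ‖q.1‖ ^ 2 ≤ (1 + ε) * ∑ j, ‖q.2 j‖ ^ 2 +
      ε⁻¹ * ((∫ x, W x ^ 2 * ‖q.1 x‖ ^ 2) + ∫ x, V x ^ 2 * ‖q.1 x‖ ^ 2) := by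
  obtain ⟨u, v⟩ := q
  obtain ⟨φ, hφ, hu, hv⟩ := hq
  dsimp only at hu hv ⊢
  obtain ⟨z1, z1'⟩ := integral_im_conj_fderiv_mul hφ (dir 0) (dir 1)
  obtain ⟨z2, z2'⟩ := integral_mul_deriv_normSq hφ (θ := fun t => B₀ * t) (θ' := fun _ => B₀)
    (fun t => by simpa using (hasDerivAt_id t).const_mul B₀) continuous_const
    (c := fun _ => 1) aestronglyMeasurable_const (M := 1) (by simp)
  obtain ⟨z3, z3'⟩ := integral_mul_deriv_normSq hφ hθ hθ' hc hMc
  obtain ⟨iu, eu⟩ := norm_sq_eq_integral u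
  obtain ⟨i0, e0⟩ := norm_sq_eq_integral (v 0)
  obtain ⟨i1, e1⟩ := norm_sq_eq_integral (v 1)
  have iW := integrable_sq_mul_normSq hW hMW u
  have iV := integrable_sq_mul_normSq hVm hMV u
  -- The added terms `2 Im (conj (∂₁φ) ∂₂φ)`, `∂₁(B₀ x₁ |φ|²)` and `c ∂₁(θ |φ|²)` have integral
  -- zero. They turn the completed square into `(B₀ - V) |φ|²` plus the undifferentiated `W` term,
  -- which Young's inequality splits into `ε |D₁φ|²` and `ε⁻¹ W² |φ|²`.
  have hpt : ∀ᵐ x, (B₀ - ε) * ‖u x‖ ^ 2 + (2 * (conj (fderiv ℝ φ x (dir 0)) *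
        fderiv ℝ φ x (dir 1)).im - 1 * (B₀ * ‖φ x‖ ^ 2 +
          B₀ * x.1 * (2 * inner ℝ (φ x) (fderiv ℝ φ x (dir 0)))) +
        c x.2 * (θ' x.1 * ‖φ x‖ ^ 2 + θ x.1 * (2 * inner ℝ (φ x) (fderiv ℝ φ x (dir 0))))) ≤
      (1 + ε) * (‖v 0 x‖ ^ 2 + ‖v 1 x‖ ^ 2) +
        ε⁻¹ * (W x ^ 2 * ‖u x‖ ^ 2 + V x ^ 2 * ‖u x‖ ^ 2) := by
    filter_upwards [hu, hv 0, hv 1] with x h1 h2 h3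
    have a0 : v 0 x = Complex.I * fderiv ℝ φ x (dir 0) := by rw [h2, magD, hA0]; simp
    have a1 : v 1 x = Complex.I * fderiv ℝ φ x (dir 1) + (A x 1 : ℂ) * φ x := h3
    have k1 := sq_norm_add_ge (fderiv ℝ φ x (dir 0)) (fderiv ℝ φ x (dir 1)) (φ x) (A x 1)
    rw [← a0, ← a1, hA1] at k1
    have k2 : -(2 * W x * inner ℝ (φ x) (fderiv ℝ φ x (dir 0))) ≤
        ε * ‖v 0 x‖ ^ 2 + ε⁻¹ * (W x ^ 2 * ‖φ x‖ ^ 2) := by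
      have k3 := two_mul_mul_le hε ‖v 0 x‖ (|W x| * ‖φ x‖)
      have k4 : ‖v 0 x‖ = ‖fderiv ℝ φ x (dir 0)‖ := by rw [a0]; simp
      have k6 : -(W x * inner ℝ (φ x) (fderiv ℝ φ x (dir 0))) ≤
          |W x| * (‖φ x‖ * ‖fderiv ℝ φ x (dir 0)‖) := by
        refine (neg_le_abs _).trans ?_
        rw [abs_mul]
        gcongr
        exact abs_real_inner_le_norm _ _
      rw [mul_pow, sq_abs] at k3
      rw [k4] at k3 ⊢
      linarith
    have k7 : V x * ‖φ x‖ ^ 2 ≤ ε * ‖φ x‖ ^ 2 + ε⁻¹ * (V x ^ 2 * ‖φ x‖ ^ 2) := by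
      have k8 := two_mul_mul_le hε 1 (V x)
      have k9 : V x ≤ ε + ε⁻¹ * V x ^ 2 := by
        have : 0 ≤ ε + ε⁻¹ * V x ^ 2 := by positivity
        linarith
      have := mul_le_mul_of_nonneg_right k9 (sq_nonneg ‖φ x‖)
      linarith
    rw [hV] at k7 ⊢
    rw [h1]
    have k10 : 0 ≤ ε * ‖v 1 x‖ ^ 2 := by positivity
    linarith
  have hle := mul_integral_le_of_ae iu z1 z2 z3 i0 i1 iW iV z1' z2' z3' hpt
  rw [← eu, ← e0, ← e1] at hle
  have : 0 ≤ (1 + ε) * ‖v 2‖ ^ 2 := by positivity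
  rw [Fin.sum_univ_three]
  linarith

/-- The essential infimum of the form is at least `B₀`. -/
theorem isFredholmAt_of_lt {A : Space → Fin 3 → ℝ} (hA : LocallySqIntegrable A)
    (hAb : ∀ R : ℕ, ∃ K : ℝ, ∀ᵐ x, x ∈ box R → ∀ j, |A x j| ≤ K)
    {B₀ : ℝ} {θ θ' : ℝ → ℝ} {c : ℝ × ℝ → ℝ}
    {W V : Space → ℝ} (hA0 : ∀ x, A x 0 = 0)
    (hA1 : ∀ x, A x 1 = B₀ * x.1 - θ x.1 * c x.2 - W x) (hV : ∀ x, V x = θ' x.1 * c x.2)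
    (hθ : ∀ t, HasDerivAt θ (θ' t) t) (hθ' : Continuous θ')
    (hc : AEStronglyMeasurable c volume) {Mc : ℝ} (hMc : ∀ᵐ y, ‖c y‖ ≤ Mc)
    (hW : AEStronglyMeasurable W volume) (hWv : VanishesAtInfinity W)
    (hVm : AEStronglyMeasurable V volume) (hVv : VanishesAtInfinity V)
    (t : ℝ) (ht : t < B₀) : IsFredholmAt (magneticOperator A) t := by
  -- Small enough that the final lower bound `(B₀ - 2ε) / (1 + 2ε)` still exceeds `t`.
  obtain ⟨ε, hε, hε1, hε2⟩ : ∃ ε : ℝ, 0 < ε ∧ ε ≤ 1 ∧ ε * (3 + 3 * |t|) < B₀ - t := by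
    have hb : 0 < B₀ - t := by linarith
    have h3 : 0 < 3 + 3 * |t| := by positivity
    refine ⟨min 1 ((B₀ - t) / 2 / (3 + 3 * |t|)), by positivity, min_le_left _ _, ?_⟩
    calc _ ≤ (B₀ - t) / 2 / (3 + 3 * |t|) * (3 + 3 * |t|) := by gcongr; exact min_le_right _ _
      _ = (B₀ - t) / 2 := by field_simp
      _ < B₀ - t := by linarith
  -- The potentials enter with prefactor `ε⁻¹`, so tolerance `ε² / 2` for each costs `ε` times the
  -- form norm squared in total.
  obtain ⟨s, e, C, hC, h⟩ := exists_potential_bound A hAb hWv (ε := ε ^ 2 / 2) (by positivity)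
  obtain ⟨s', e', C', hC', h'⟩ := exists_potential_bound A hAb hVv (ε := ε ^ 2 / 2) (by positivity)
  obtain ⟨⟨MW, hMW⟩, -⟩ := hWv
  obtain ⟨⟨MV, hMV⟩, -⟩ := hVv
  have h12 : (0 : ℝ) < 1 + 2 * ε := by positivity
  refine isFredholmAt_of_form_bound hA (ι := s ⊕ s') t ((B₀ - 2 * ε) / (1 + 2 * ε) - t)
    (ε⁻¹ * (C + C')) (Sum.elim (fun k => e k) fun k => e' k) ?_ (by positivity) fun q hq => ?_
  · rw [sub_pos, lt_div_iff₀ h12]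
    have := le_abs_self t
    have h0 := abs_nonneg t
    nlinarith
  have hS : 0 ≤ ∑ j, ‖q.2 j‖ ^ 2 := by positivity
  have k1 := form_lower_bound hA0 hA1 hV hθ hθ' hc hMc hW hMW hVm hMV hε q hq
  have k2 := integral_sq_mul_normSq_le hW q.1 (by positivity) (h q hq)
  have k3 := integral_sq_mul_normSq_le hVm q.1 (by positivity) (h' q hq)
  rw [Fintype.sum_sum_type]
  simp only [Sum.elim_inl, Sum.elim_inr]
  rw [Finset.sum_coe_sort s fun k => ‖inner ℂ (e k) q.1‖ ^ 2,
    Finset.sum_coe_sort s' fun k => ‖inner ℂ (e' k) q.1‖ ^ 2]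
  set S := ∑ j, ‖q.2 j‖ ^ 2
  set X := ∑ k ∈ s, ‖inner ℂ (e k) q.1‖ ^ 2 with hX
  set X' := ∑ k ∈ s', ‖inner ℂ (e' k) q.1‖ ^ 2 with hX'
  have hX0 : 0 ≤ X := by positivity
  have hX0' : 0 ≤ X' := by positivity
  have k4 : ε⁻¹ * ((∫ x, W x ^ 2 * ‖q.1 x‖ ^ 2) + ∫ x, V x ^ 2 * ‖q.1 x‖ ^ 2) ≤
      ε * (‖q.1‖ ^ 2 + S) + ε⁻¹ * (C + C') * (X + X') := by
    calc _ ≤ ε⁻¹ * ((ε ^ 2 / 2 * (‖q.1‖ ^ 2 + S) + C * X) +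
          (ε ^ 2 / 2 * (‖q.1‖ ^ 2 + S) + C' * X')) := by gcongr
      _ = ε * (‖q.1‖ ^ 2 + S) + ε⁻¹ * (C * X + C' * X') := by
        field_simp
        ring
      _ ≤ ε * (‖q.1‖ ^ 2 + S) + ε⁻¹ * ((C + C') * (X + X')) := by
        gcongr
        nlinarith [mul_nonneg hC hX0', mul_nonneg hC' hX0]
      _ = _ := by ring
  have k5 : 0 ≤ ε⁻¹ * (C + C') * (X + X') := by positivity
  have k6 : (B₀ - 2 * ε) * ‖q.1‖ ^ 2 ≤
      (1 + 2 * ε) * (S + ε⁻¹ * (C + C') * (X + X')) := by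
    nlinarith
  have k7 : (B₀ - 2 * ε) / (1 + 2 * ε) * ‖q.1‖ ^ 2 ≤ S + ε⁻¹ * (C + C') * (X + X') := by
    rw [div_mul_eq_mul_div, div_le_iff₀ h12]
    linarith
  linarith

/-! ### Almost everywhere statements on coordinate planes -/

theorem quasiMeasurePreserving_plane :
    Measure.QuasiMeasurePreserving (fun x : Space => (x.1, x.2.1)) volume volume := by
  have h1 : MeasurePreserving (MeasurableEquiv.prodAssoc (α := ℝ) (β := ℝ) (γ := ℝ)).symm
      volume volume := volume_preserving_prodAssoc.symm
  exact Measure.quasiMeasurePreserving_fst.comp h1.quasiMeasurePreserving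

theorem quasiMeasurePreserving_third :
    Measure.QuasiMeasurePreserving (fun x : Space => x.2.2) volume volume :=
  Measure.quasiMeasurePreserving_snd.comp Measure.quasiMeasurePreserving_snd

theorem measurePreserving_reflect :
    MeasurePreserving (fun p : ℝ × ℝ => (-p.1, p.2)) volume volume :=
  (Measure.measurePreserving_neg volume).prod (MeasurePreserving.id volume)

theorem MemLp.exists_ae_abs_le {X : Type*} [MeasurableSpace X] {μ : Measure X} {f : X → ℝ}
    (hf : MemLp f ∞ μ) : ∃ M : ℝ, 0 ≤ M ∧ ∀ᵐ x ∂μ, |f x| ≤ M := by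
  refine ⟨(eLpNorm f ∞ μ).toReal, ENNReal.toReal_nonneg, ?_⟩
  have h := hf.2
  rw [eLpNorm_exponent_top] at h ⊢
  filter_upwards [enorm_ae_le_eLpNormEssSup f μ] with x hx
  rw [← Real.norm_eq_abs, ← toReal_enorm]
  exact ENNReal.toReal_mono h.ne hx

/-! ### The smooth step -/

/-- A smooth function equal to `1` on `(-∞, -1]` and to `0` on `[0, ∞)`. -/
noncomputable def step (t : ℝ) : ℝ := Real.smoothTransition (-t)

theorem contDiff_step : ContDiff ℝ ∞ step := Real.smoothTransition.contDiff.comp contDiff_neg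

theorem hasDerivAt_step (t : ℝ) : HasDerivAt step (deriv step t) t :=
  (contDiff_step.differentiable (by simp) t).hasDerivAt

theorem continuous_deriv_step : Continuous (deriv step) := contDiff_step.continuous_deriv (by simp)

theorem step_of_nonneg {t : ℝ} (ht : 0 ≤ t) : step t = 0 :=
  Real.smoothTransition.zero_of_nonpos (by linarith)

theorem step_of_le {t : ℝ} (ht : t ≤ -1) : step t = 1 :=
  Real.smoothTransition.one_of_one_le (by linarith)

theorem abs_step_le (t : ℝ) : |step t| ≤ 1 := by
  rw [step, abs_of_nonneg (Real.smoothTransition.nonneg _)]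
  exact Real.smoothTransition.le_one _

theorem deriv_step_of_pos {t : ℝ} (ht : 0 < t) : deriv step t = 0 := by
  have : step =ᶠ[𝓝 t] fun _ => 0 :=
    (lt_mem_nhds ht).mono fun s hs => step_of_nonneg hs.le
  rw [this.deriv_eq, deriv_const]

theorem deriv_step_of_lt {t : ℝ} (ht : t < -1) : deriv step t = 0 := by
  have : step =ᶠ[𝓝 t] fun _ => 1 :=
    (gt_mem_nhds ht).mono fun s hs => step_of_le (le_of_lt hs)
  rw [this.deriv_eq, deriv_const]

theorem exists_abs_deriv_step_le : ∃ K : ℝ, 0 ≤ K ∧ ∀ t, |deriv step t| ≤ K := by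
  obtain ⟨K, hK⟩ := isCompact_Icc.exists_bound_of_continuousOn (s := Icc (-1 : ℝ) 0)
    continuous_deriv_step.continuousOn
  refine ⟨max K 0, le_max_right _ _, fun t => ?_⟩
  by_cases h : t ∈ Icc (-1 : ℝ) 0
  · exact (hK t h).trans (le_max_left _ _)
  · rw [mem_Icc, not_and_or, not_le, not_le] at h
    rcases h with h | h
    · simp [deriv_step_of_lt h]
    · simp [deriv_step_of_pos h]

/-! ### The flux potential -/

/-- The integrand is even in `t`, so the two half-line integrals together cover the whole line. This
carries information about `f` from the right to the left half-plane. -/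
theorem fluxPot_add_reflect {g : ℝ → ℝ}
    (hg : ∀ x₁ x₂ : ℝ, IntegrableOn (fun t => g (√(t ^ 2 + x₂ ^ 2))) (Ioi x₁)) (s y : ℝ) :
    fluxPot g s y + fluxPot g (-s) y = 2 * fluxPot g 0 y := by
  set k : ℝ → ℝ := fun t => g (√(t ^ 2 + y ^ 2)) with hk
  have hev : ∀ t, k (-t) = k t := fun t => by simp [hk]
  have hint : ∀ a b : ℝ, IntervalIntegrable k volume a b := fun a b => by
    rw [intervalIntegrable_iff]
    exact (hg (min a b) y).mono_set fun t ht => ht.1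
  have h1 : ∀ s, (∫ t in s..0, k t) + ∫ t in Ioi 0, k t = ∫ t in Ioi s, k t := fun s =>
    intervalIntegral.integral_interval_add_Ioi (hg s y) (hg 0 y)
  have h2 : ∫ t in (-s)..0, k t = ∫ t in (0 : ℝ)..s, k t := by
    have := intervalIntegral.integral_comp_neg (a := -s) (b := 0) k
    simpa [hev] using this
  have h3 : ∫ t in (0 : ℝ)..s, k t = -∫ t in s..0, k t := intervalIntegral.integral_symm _ _
  have e : ∀ s, fluxPot g s y = -∫ t in Ioi s, k t := fun s => rfl
  rw [e, e, e, ← h1 s, ← h1 (-s), h2, h3]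
  ring

/-- The total flux `2 f(0, x₂)` along a line. -/
noncomputable def lineFlux (g : ℝ → ℝ) (y : ℝ) : ℝ := 2 * fluxPot g 0 y

/-- Almost-everywhere information on the plane says nothing about the single line `x₁ = 0`. The line
flux is recovered instead from two good slices at `s` and `-s`. -/
theorem exists_slice {g : ℝ → ℝ}
    (hg : ∀ x₁ x₂ : ℝ, IntegrableOn (fun t => g (√(t ^ 2 + x₂ ^ 2))) (Ioi x₁))
    {P : (ℝ → ℝ) → Prop} (h : ∀ᵐ s : ℝ, P fun y => fluxPot g s y) :
    ∃ s : ℝ, P (fun y => fluxPot g s y) ∧ P (fun y => fluxPot g (-s) y) ∧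
      ∀ y, lineFlux g y = fluxPot g s y + fluxPot g (-s) y := by
  have h' : ∀ᵐ s : ℝ, P fun y => fluxPot g (-s) y :=
    (Measure.measurePreserving_neg (volume : Measure ℝ)).quasiMeasurePreserving.ae h
  obtain ⟨s, h1, h2⟩ := (h.and h').exists
  exact ⟨s, h1, h2, fun y => (fluxPot_add_reflect hg s y).symm⟩

theorem aestronglyMeasurable_lineFlux {g : ℝ → ℝ}
    (hg : ∀ x₁ x₂ : ℝ, IntegrableOn (fun t => g (√(t ^ 2 + x₂ ^ 2))) (Ioi x₁))
    (hf : AEStronglyMeasurable (fun p : ℝ × ℝ => fluxPot g p.1 p.2) volume) :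
    AEStronglyMeasurable (lineFlux g) volume := by
  have h : ∀ᵐ s : ℝ, AEStronglyMeasurable (fun y => fluxPot g s y) volume :=
    AEStronglyMeasurable.prodMk_left hf
  obtain ⟨s, h1, h2, h3⟩ := exists_slice hg (P := fun k => AEStronglyMeasurable k volume) h
  exact (h1.add h2).congr (Eventually.of_forall fun y => (h3 y).symm)

theorem ae_abs_lineFlux_le {g : ℝ → ℝ}
    (hg : ∀ x₁ x₂ : ℝ, IntegrableOn (fun t => g (√(t ^ 2 + x₂ ^ 2))) (Ioi x₁)) {M : ℝ}
    (hM : ∀ᵐ p : ℝ × ℝ, |fluxPot g p.1 p.2| ≤ M) : ∀ᵐ y, |lineFlux g y| ≤ 2 * M := by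
  have h : ∀ᵐ s : ℝ, ∀ᵐ y : ℝ, |fluxPot g s y| ≤ M := Measure.ae_ae_of_ae_prod hM
  obtain ⟨s, h1, h2, h3⟩ := exists_slice hg (P := fun k => ∀ᵐ y, |k y| ≤ M) h
  filter_upwards [h1, h2] with y k1 k2
  rw [h3]
  refine (abs_add_le _ _).trans (by linarith)

/-- Essential boundedness and essential decay of a function on the plane. -/
def BoundedDecaying (G : ℝ × ℝ → ℝ) : Prop :=
  (∃ M : ℝ, 0 ≤ M ∧ ∀ᵐ p, |G p| ≤ M) ∧
    ∀ ε : ℝ, 0 < ε → ∃ R : ℝ, ∀ᵐ p : ℝ × ℝ, R ≤ p.1 ^ 2 + p.2 ^ 2 → |G p| ≤ ε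

theorem ae_plane_snd {P : ℝ → Prop} (h : ∀ᵐ y, P y) : ∀ᵐ p : ℝ × ℝ, P p.2 :=
  Measure.quasiMeasurePreserving_snd.ae h

/-- For `x₁ > 0` the step is absent and `f` itself decays. For `x₁ < -1` reflection gives `f -
lineFlux = -f(-x₁, ·)`, which is small. On the strip between, both `f(x₁, ·)` and `f(-x₁, ·)` are
small, hence so is their sum, the line flux. -/
theorem boundedDecaying_fluxPot_sub {g : ℝ → ℝ}
    (hg : ∀ x₁ x₂ : ℝ, IntegrableOn (fun t => g (√(t ^ 2 + x₂ ^ 2))) (Ioi x₁)) {M : ℝ}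
    (hM0 : 0 ≤ M) (hM : ∀ᵐ p : ℝ × ℝ, |fluxPot g p.1 p.2| ≤ M)
    (hdec : ∀ ε : ℝ, 0 < ε → ∃ R : ℝ, ∀ᵐ p : ℝ × ℝ, -1 ≤ p.1 → R ≤ p.1 ^ 2 + p.2 ^ 2 →
      |fluxPot g p.1 p.2| ≤ ε) :
    BoundedDecaying (fun p => fluxPot g p.1 p.2 - step p.1 * lineFlux g p.2) ∧
      BoundedDecaying fun p => deriv step p.1 * lineFlux g p.2 := by
  obtain ⟨K, hK0, hK⟩ := exists_abs_deriv_step_le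
  have hT := ae_plane_snd (ae_abs_lineFlux_le hg hM)
  have key : ∀ ε : ℝ, 0 < ε → ∃ R : ℝ, ∀ᵐ p : ℝ × ℝ, R ≤ p.1 ^ 2 + p.2 ^ 2 →
      |fluxPot g p.1 p.2 - step p.1 * lineFlux g p.2| ≤ 3 * ε ∧
      |deriv step p.1 * lineFlux g p.2| ≤ K * (2 * ε) := by
    intro ε hε
    obtain ⟨R, hR⟩ := hdec ε hε
    have hR' := measurePreserving_reflect.quasiMeasurePreserving.ae hR
    refine ⟨R, ?_⟩
    filter_upwards [hR, hR'] with p h1 h2 hp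
    rw [neg_sq] at h2
    have hL : lineFlux g p.2 = fluxPot g p.1 p.2 + fluxPot g (-p.1) p.2 :=
      (fluxPot_add_reflect hg p.1 p.2).symm
    rcases lt_or_ge 0 p.1 with h0 | h0
    · rw [step_of_nonneg h0.le, deriv_step_of_pos h0]
      have := h1 (by linarith) hp
      simp only [zero_mul, sub_zero, abs_zero]
      exact ⟨by linarith, by positivity⟩
    rcases lt_or_ge p.1 (-1) with h3 | h3
    · rw [step_of_le h3.le, deriv_step_of_lt h3, hL]
      have := h2 (by linarith) hp
      rw [show fluxPot g p.1 p.2 - 1 * (fluxPot g p.1 p.2 + fluxPot g (-p.1) p.2) =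
        -fluxPot g (-p.1) p.2 by ring, abs_neg, zero_mul, abs_zero]
      exact ⟨by linarith, by positivity⟩
    · have k1 := h1 h3 hp
      have k2 := h2 (by linarith) hp
      have k3 : |lineFlux g p.2| ≤ 2 * ε := by
        rw [hL]
        exact (abs_add_le _ _).trans (by linarith)
      constructor
      · refine (abs_sub _ _).trans ?_
        rw [abs_mul]
        have := mul_le_mul (abs_step_le p.1) k3 (abs_nonneg _) zero_le_one
        linarith
      · rw [abs_mul]
        exact mul_le_mul (hK _) k3 (abs_nonneg _) hK0
  refine ⟨⟨⟨3 * M, by positivity, ?_⟩, fun ε hε => ?_⟩,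
    ⟨⟨K * (2 * M), by positivity, ?_⟩, fun ε hε => ?_⟩⟩
  · filter_upwards [hM, hT] with p h1 h2
    refine (abs_sub _ _).trans ?_
    rw [abs_mul]
    have := mul_le_mul (abs_step_le p.1) h2 (abs_nonneg _) zero_le_one
    linarith
  · obtain ⟨R, hR⟩ := key (ε / 3) (by positivity)
    refine ⟨R, hR.mono fun p h hp => (h hp).1.trans (by linarith)⟩
  · filter_upwards [hT] with p h2
    rw [abs_mul]
    exact mul_le_mul (hK _) h2 (abs_nonneg _) hK0
  · obtain ⟨R, hR⟩ := key (ε / (2 * (K + 1))) (by positivity)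
    refine ⟨R, hR.mono fun p h hp => (h hp).2.trans ?_⟩
    rw [show K * (2 * (ε / (2 * (K + 1)))) = K * ε / (K + 1) by field_simp,
      div_le_iff₀ (by positivity)]
    nlinarith

/-- A product of a decaying function of `(x₁, x₂)` and a decaying function of `x₃` vanishes at
infinity. -/
theorem vanishesAtInfinity_mul {η : ℝ → ℝ} {Mη : ℝ} (hη0 : 0 ≤ Mη) (hη : ∀ᵐ s, |η s| ≤ Mη)
    (hdec : ∀ ε : ℝ, 0 < ε → ∃ R : ℝ, ∀ᵐ s : ℝ, R ≤ |s| → |η s| ≤ ε) {G : ℝ × ℝ → ℝ}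
    (hG : BoundedDecaying G) :
    VanishesAtInfinity fun x => η x.2.2 * G (x.1, x.2.1) := by
  obtain ⟨⟨M, hM0, hM⟩, hGd⟩ := hG
  have hη' := quasiMeasurePreserving_third.ae hη
  have hM' := quasiMeasurePreserving_plane.ae hM
  refine ⟨⟨Mη * M, ?_⟩, fun ε hε => ?_⟩
  · filter_upwards [hη', hM'] with x h1 h2
    rw [abs_mul]
    exact mul_le_mul h1 h2 (abs_nonneg _) hη0
  · obtain ⟨R₁, h₁⟩ := hGd (ε / (Mη + 1)) (by positivity)
    obtain ⟨R₂, h₂⟩ := hdec (ε / (M + 1)) (by positivity)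
    -- The 1 ensures `R ≤ R²`, since the decay in the plane is measured by `x₁² + x₂²`. Outside the
    -- box either one of the first two coordinates is large and `G` is small, or the third is and
    -- `η` is small.
    obtain ⟨R, hR⟩ := exists_nat_ge (max (max R₁ R₂) 1)
    have hR₁ : R₁ ≤ R := ((le_max_left _ _).trans (le_max_left _ _)).trans hR
    have hR₂ : R₂ ≤ R := ((le_max_right _ _).trans (le_max_left _ _)).trans hR
    have hR1 : (1 : ℝ) ≤ R := (le_max_right _ _).trans hR
    have hout : ∀ t : ℝ, t ∉ Ico (-R : ℝ) (-R + 2 * R) → (R : ℝ) ≤ |t| := by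
      intro t ht
      rw [mem_Ico, not_and_or, not_le, not_lt] at ht
      rcases ht with h | h
      · exact le_trans (by linarith) (neg_le_abs t)
      · exact le_trans (by linarith) (le_abs_self t)
    have hsq : ∀ t : ℝ, (R : ℝ) ≤ |t| → R₁ ≤ t ^ 2 := by
      intro t ht
      rw [← sq_abs]
      nlinarith
    refine ⟨R, ?_⟩
    filter_upwards [hη', hM', quasiMeasurePreserving_plane.ae h₁,
      quasiMeasurePreserving_third.ae h₂] with x h3 h4 h5 h6 hx
    rw [abs_mul]
    have hx' : (R : ℝ) ≤ |x.1| ∨ (R : ℝ) ≤ |x.2.1| ∨ (R : ℝ) ≤ |x.2.2| := by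
      by_contra hcon
      push Not at hcon
      refine hx ⟨?_, ?_, ?_⟩
      · by_contra h; exact absurd (hout _ h) (not_le.2 hcon.1)
      · by_contra h; exact absurd (hout _ h) (not_le.2 hcon.2.1)
      · by_contra h; exact absurd (hout _ h) (not_le.2 hcon.2.2)
    have caseG : R₁ ≤ x.1 ^ 2 + x.2.1 ^ 2 → |η x.2.2| * |G (x.1, x.2.1)| ≤ ε := by
      intro h
      refine (mul_le_mul h3 (h5 h) (abs_nonneg _) hη0).trans ?_
      rw [mul_div_assoc', div_le_iff₀ (by positivity)]
      nlinarith
    rcases hx' with h | h | h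
    · exact caseG (by nlinarith [hsq _ h, sq_nonneg x.2.1])
    · exact caseG (by nlinarith [hsq _ h, sq_nonneg x.1])
    · refine (mul_le_mul (h6 (hR₂.trans h)) h4 (abs_nonneg _) (by positivity)).trans ?_
      rw [div_mul_eq_mul_div, div_le_iff₀ (by positivity)]
      nlinarith

/-! ### The vector potential -/

theorem ae_abs_flux_le {g η : ℝ → ℝ} {M Mη : ℝ} (hM : ∀ᵐ p : ℝ × ℝ, |fluxPot g p.1 p.2| ≤ M)
    (hη0 : 0 ≤ Mη) (hη : ∀ᵐ s, |η s| ≤ Mη) :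
    ∀ᵐ x : Space, |η x.2.2 * fluxPot g x.1 x.2.1| ≤ Mη * M := by
  filter_upwards [quasiMeasurePreserving_third.ae hη, quasiMeasurePreserving_plane.ae hM] with x h1 h2
  rw [abs_mul]
  exact mul_le_mul h1 h2 (abs_nonneg _) hη0

theorem aestronglyMeasurable_mul_plane {η : ℝ → ℝ} (hη : AEStronglyMeasurable η volume)
    {G : ℝ × ℝ → ℝ} (hG : AEStronglyMeasurable G volume) :
    AEStronglyMeasurable (fun x : Space => η x.2.2 * G (x.1, x.2.1)) volume :=
  (hη.comp_quasiMeasurePreserving quasiMeasurePreserving_third).mul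
    (hG.comp_quasiMeasurePreserving quasiMeasurePreserving_plane)

theorem locallySqIntegrable_vectorPotential (B₀ : ℝ) {g η : ℝ → ℝ}
    (hf : MemLp (fun p : ℝ × ℝ => fluxPot g p.1 p.2) ∞ volume) (hη : MemLp η ∞ volume) :
    LocallySqIntegrable (vectorPotential B₀ g η) := by
  have := isAddHaarMeasure_volume
  obtain ⟨M, hM0, hM⟩ := MemLp.exists_ae_abs_le hf
  obtain ⟨Mη, hη0, hηM⟩ := MemLp.exists_ae_abs_le hη
  intro φ hφ j
  have hφ2 : MemLp φ 2 volume := hφ.1.continuous.memLp_of_hasCompactSupport hφ.2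
  have hc := hφ.1.continuous
  have h1 : MemLp (fun x : Space => ((B₀ * x.1 : ℝ) : ℂ) * φ x) 2 volume :=
    Continuous.memLp_of_hasCompactSupport (by fun_prop) hφ.2.mul_left
  have h2 : MemLp (fun x : Space => ((η x.2.2 * fluxPot g x.1 x.2.1 : ℝ) : ℂ) * φ x) 2 volume := by
    refine hφ2.of_le_mul (c := Mη * M) ?_ ?_
    · exact (Complex.continuous_ofReal.comp_aestronglyMeasurable
        (aestronglyMeasurable_mul_plane hη.1 hf.1)).mul hφ2.1
    · filter_upwards [ae_abs_flux_le hM hη0 hηM] with x hx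
      rw [norm_mul, Complex.norm_real, Real.norm_eq_abs]
      gcongr
  fin_cases j
  · simp [vectorPotential]
  · refine (h1.sub h2).ae_eq (Eventually.of_forall fun x => ?_)
    simp [vectorPotential]
    ring
  · simp [vectorPotential]

theorem exists_vectorPotential_bound (B₀ : ℝ) {g η : ℝ → ℝ}
    (hf : MemLp (fun p : ℝ × ℝ => fluxPot g p.1 p.2) ∞ volume) (hη : MemLp η ∞ volume) (R : ℕ) :
    ∃ K : ℝ, ∀ᵐ x, x ∈ box R → ∀ j, |vectorPotential B₀ g η x j| ≤ K := by
  obtain ⟨M, hM0, hM⟩ := MemLp.exists_ae_abs_le hf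
  obtain ⟨Mη, hη0, hηM⟩ := MemLp.exists_ae_abs_le hη
  refine ⟨|B₀| * R + Mη * M, ?_⟩
  filter_upwards [ae_abs_flux_le hM hη0 hηM] with x hx hb j
  have h1 : |x.1| ≤ R := by
    have := hb.1
    rw [mem_Ico] at this
    exact abs_le.2 ⟨this.1, by linarith [this.2]⟩
  have h0 : 0 ≤ |B₀| * R + Mη * M := by positivity
  fin_cases j
  · simpa [vectorPotential] using h0
  · refine (abs_sub _ _).trans (add_le_add ?_ hx)
    rw [abs_mul]
    gcongr
  · simpa [vectorPotential] using h0

/-- The operator is Fredholm below `B₀`. -/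
theorem isFredholmAt_magneticHamiltonian_of_lt {B₀ : ℝ} {g η : ℝ → ℝ} (hi : AssumptionI g)
    (hii : AssumptionII B₀ g η) (t : ℝ) (ht : t < B₀) :
    IsFredholmAt (magneticHamiltonian B₀ g η) t := by
  obtain ⟨-, -, hg, hf, h, -, -, hdec⟩ := hi
  obtain ⟨hηpos, -, hη, -, hηdec⟩ := hii
  obtain ⟨M, hM0, hM⟩ := MemLp.exists_ae_abs_le hf
  obtain ⟨Mη, hη0, hηM⟩ := MemLp.exists_ae_abs_le hη
  have hηdec' : ∀ ε : ℝ, 0 < ε → ∃ R : ℝ, ∀ᵐ s : ℝ, R ≤ |s| → |η s| ≤ ε := fun ε hε => by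
    obtain ⟨R, hR⟩ := hηdec ε hε
    refine ⟨R, ?_⟩
    filter_upwards [hR, hηpos] with s h1 h2 hs
    rw [abs_of_nonneg h2]
    exact h1 hs
  have hdec' : ∀ ε : ℝ, 0 < ε → ∃ R : ℝ, ∀ᵐ p : ℝ × ℝ, -1 ≤ p.1 → R ≤ p.1 ^ 2 + p.2 ^ 2 →
      |fluxPot g p.1 p.2| ≤ ε := fun ε hε => by
    -- The half-plane `x₁ ≥ -1` is enough because the step varies only on `[-1, 0]`.
    obtain ⟨R, hR⟩ := hdec 1 ε hε
    refine ⟨R, hR.mono fun p hp h1 h2 => ?_⟩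
    have := hp h1 h2
    linarith [abs_nonneg (h p)]
  obtain ⟨d1, d2⟩ := boundedDecaying_fluxPot_sub hg hM0 hM hdec'
  have hL := aestronglyMeasurable_lineFlux hg hf.1
  have hLM := ae_abs_lineFlux_le hg hM
  have hstep : Continuous step := contDiff_step.continuous
  have hLp : AEStronglyMeasurable (fun p : ℝ × ℝ => lineFlux g p.2) volume :=
    hL.comp_quasiMeasurePreserving Measure.quasiMeasurePreserving_snd
  -- Split `η f` into `step(x₁) · (η(x₃) lineFlux(x₂))`, smooth in `x₁` with a coefficient free of
  -- `x₁`, and a remainder `W` vanishing at infinity.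
  refine isFredholmAt_of_lt (locallySqIntegrable_vectorPotential B₀ hf hη)
    (exists_vectorPotential_bound B₀ hf hη) (B₀ := B₀) (θ := step) (θ' := deriv step)
    (c := fun y => η y.2 * lineFlux g y.1) (Mc := Mη * (2 * M))
    (W := fun x => η x.2.2 * (fluxPot g x.1 x.2.1 - step x.1 * lineFlux g x.2.1))
    (V := fun x => η x.2.2 * (deriv step x.1 * lineFlux g x.2.1))
    (fun x => rfl) (fun x => ?_) (fun x => ?_) hasDerivAt_step continuous_deriv_step ?_ ?_
    (aestronglyMeasurable_mul_plane hη.1 (G := fun p => fluxPot g p.1 p.2 -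
      step p.1 * lineFlux g p.2) (hf.1.sub ?_))
    (vanishesAtInfinity_mul hη0 hηM hηdec' d1)
    (aestronglyMeasurable_mul_plane hη.1 (G := fun p => deriv step p.1 * lineFlux g p.2) ?_)
    (vanishesAtInfinity_mul hη0 hηM hηdec' d2) t ht
  · change B₀ * x.1 - η x.2.2 * fluxPot g x.1 x.2.1 = _
    ring
  · ring
  · exact (hη.1.comp_quasiMeasurePreserving Measure.quasiMeasurePreserving_snd).mul
      (hL.comp_quasiMeasurePreserving Measure.quasiMeasurePreserving_fst)
  · filter_upwards [Measure.quasiMeasurePreserving_snd.ae hηM,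
      Measure.quasiMeasurePreserving_fst.ae hLM] with y h1 h2
    rw [Real.norm_eq_abs, abs_mul]
    exact mul_le_mul h1 h2 (abs_nonneg _) hη0
  · exact (hstep.comp continuous_fst).aestronglyMeasurable.mul hLp
  · exact (continuous_deriv_step.comp continuous_fst).aestronglyMeasurable.mul hLp

/-! ### Comparison of the form with the constant-field operator -/

/-- The vector potential of the constant field. -/
def constPotential (B₀ : ℝ) (x : Space) : Fin 3 → ℝ := ![0, B₀ * x.1, 0]

theorem contDiff_constPotential (B₀ : ℝ) (j : Fin 3) :
    ContDiff ℝ ∞ fun x => constPotential B₀ x j := by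
  fin_cases j
  · exact contDiff_const
  · exact contDiff_const.mul contDiff_fst
  · exact contDiff_const

theorem isTest_magD_constPotential (B₀ : ℝ) {φ : Space → ℂ} (hφ : IsTest φ) (j : Fin 3) :
    IsTest (magD (constPotential B₀) φ j) := by
  have h1 := hφ.fderiv_apply (dir j)
  exact ⟨(contDiff_const.mul h1.1).add
    ((Complex.ofRealCLM.contDiff.comp (contDiff_constPotential B₀ j)).mul hφ.1),
    h1.2.mul_left.add hφ.2.mul_left⟩

theorem IsTest.memLp {φ : Space → ℂ} (hφ : IsTest φ) : MemLp φ 2 volume :=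
  have := isAddHaarMeasure_volume
  hφ.1.continuous.memLp_of_hasCompactSupport hφ.2

theorem inner_eq_integral {u v : L2} {φ ψ : Space → ℂ} (hu : u =ᵐ[volume] φ)
    (hv : v =ᵐ[volume] ψ) : inner ℂ u v = ∫ x, conj (φ x) * ψ x := by
  rw [L2.inner_def]
  refine integral_congr_ae ?_
  filter_upwards [hu, hv] with x hx hx'
  simp [hx, hx', mul_comm]

theorem norm_toLp_le {φ : Space → ℂ} (hφ : MemLp φ 2 volume) {β : ℝ} (hβ : 0 ≤ β)
    (h : ∫⁻ x, ‖φ x‖ₑ ^ 2 ≤ ENNReal.ofReal (β ^ 2)) : ‖hφ.toLp φ‖ ≤ β := by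
  have h1 : ENNReal.ofReal (‖hφ.toLp φ‖ ^ 2) ≤ ENNReal.ofReal (β ^ 2) := by
    rw [← lintegral_enorm_sq]
    refine le_trans (le_of_eq ?_) h
    exact lintegral_congr_ae (hφ.coeFn_toLp.mono fun x hx => by dsimp only; rw [hx])
  rw [ENNReal.ofReal_le_ofReal_iff (by positivity)] at h1
  exact le_of_sq_le_sq h1 hβ

/-- The form of `A` and the constant-field operator differ by terms containing the bounded
perturbation `E` of the potential. -/
theorem norm_form_sub_le {A : Space → Fin 3 → ℝ} {B₀ : ℝ} {E : Space → ℝ}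
    (hA0 : ∀ x, A x 0 = 0) (hA1 : ∀ x, A x 1 = B₀ * x.1 - E x) (hA2 : ∀ x, A x 2 = 0)
    (hE : AEStronglyMeasurable E volume) {M : ℝ} (hM : ∀ᵐ x, |E x| ≤ M)
    {ψ : Space → ℂ} (hψ : IsTest ψ) {t β₁ β₂ β₃ : ℝ} (h₁ : 0 ≤ β₁) (h₂ : 0 ≤ β₂) (h₃ : 0 ≤ β₃)
    (hβ₁ : ∫⁻ x, ‖(∑ j, magD (constPotential B₀) (magD (constPotential B₀) ψ j) j x) - t * ψ x‖ₑ ^ 2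
      ≤ ENNReal.ofReal (β₁ ^ 2))
    (hβ₂ : ∫⁻ x, ‖(E x : ℂ) * magD (constPotential B₀) ψ 1 x‖ₑ ^ 2 ≤ ENNReal.ofReal (β₂ ^ 2))
    (hβ₃ : ∫⁻ x, ‖(E x : ℂ) * ψ x‖ₑ ^ 2 ≤ ENNReal.ofReal (β₃ ^ 2))
    {p q : L2 × (Fin 3 → L2)} (hp : p.1 =ᵐ[volume] ψ) (hp' : ∀ j, p.2 j =ᵐ[volume] magD A ψ j)
    (hq : q ∈ gradGraph A) :
    ‖∑ j, inner ℂ (q.2 j) (p.2 j) - t * inner ℂ q.1 p.1‖ ≤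
      (β₁ + β₂ + β₃) * √(‖q.1‖ ^ 2 + ∑ j, ‖q.2 j‖ ^ 2) := by
  obtain ⟨φ, hφ, hq1, hq2⟩ := hq
  set A' := constPotential B₀ with hA'
  have hEmul : ∀ {f : Space → ℂ}, MemLp f 2 volume → MemLp (fun x => (E x : ℂ) * f x) 2 volume := by
    intro f hf
    refine hf.of_le_mul (c := M)
      ((Complex.continuous_ofReal.comp_aestronglyMeasurable hE).mul hf.1) ?_
    filter_upwards [hM] with x hx
    rw [norm_mul, Complex.norm_real, Real.norm_eq_abs]
    gcongr
  have hT := fun j => isTest_magD_constPotential B₀ hψ j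
  have hTT := fun j => isTest_magD_constPotential B₀ (hT j) j
  have hTφ := fun j => isTest_magD_constPotential B₀ hφ j
  have hA'φ : ∀ j, MemLp (fun x => (A' x j : ℂ) * φ x) 2 volume := fun j => by
    have := isAddHaarMeasure_volume
    refine Continuous.memLp_of_hasCompactSupport ?_ hφ.2.mul_left
    exact (Complex.continuous_ofReal.comp (contDiff_constPotential B₀ j).continuous).mul
      hφ.1.continuous
  have hr : MemLp (fun x => (∑ j, magD A' (magD A' ψ j) j x) - t * ψ x) 2 volume := by
    refine MemLp.sub ?_ (hψ.memLp.const_mul _)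
    exact memLp_finsetSum _ fun j _ => (hTT j).memLp
  have hw := hEmul (hT 1).memLp
  have hs := hEmul hψ.memLp
  have hsym : ∀ j, inner ℂ ((hTφ j).memLp.toLp _) ((hT j).memLp.toLp _) =
      inner ℂ q.1 ((hTT j).memLp.toLp _) := fun j => by
    rw [inner_eq_integral (MemLp.coeFn_toLp _) (MemLp.coeFn_toLp _),
      inner_eq_integral hq1 (MemLp.coeFn_toLp _)]
    exact magD_symm hφ (hT j) j (hA'φ j)
  have hoff : ∀ j, (∀ x, A x j = A' x j) →
      inner ℂ (q.2 j) (p.2 j) = inner ℂ q.1 ((hTT j).memLp.toLp _) := by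
    intro j hj
    have e : ∀ f : Space → ℂ, magD A f j = magD A' f j := fun f => by
      funext x
      rw [magD, magD, hj]
    rw [← hsym j]
    congr 1
    · exact Lp.ext ((hq2 j).trans (by rw [e]; exact (MemLp.coeFn_toLp _).symm))
    · exact Lp.ext ((hp' j).trans (by rw [e]; exact (MemLp.coeFn_toLp _).symm))
  have e1 : ∀ f : Space → ℂ, ∀ x, magD A f 1 x = magD A' f 1 x - (E x : ℂ) * f x := by
    intro f x
    rw [magD, magD, hA1, hA', constPotential]
    simp
    ring
  have hp1 : p.2 1 = (hT 1).memLp.toLp _ - hs.toLp _ := by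
    refine Lp.ext ?_
    filter_upwards [hp' 1, Lp.coeFn_sub ((hT 1).memLp.toLp _) (hs.toLp _),
      (hT 1).memLp.coeFn_toLp, hs.coeFn_toLp] with x k1 k2 k3 k4
    rw [k1, k2, Pi.sub_apply, k3, k4, e1]
  have hEφ := hEmul hφ.memLp
  have hq21 : q.2 1 = (hTφ 1).memLp.toLp _ - hEφ.toLp _ := by
    refine Lp.ext ?_
    filter_upwards [hq2 1, Lp.coeFn_sub ((hTφ 1).memLp.toLp _) (hEφ.toLp _),
      (hTφ 1).memLp.coeFn_toLp, hEφ.coeFn_toLp] with x k1 k2 k3 k4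
    rw [k1, k2, Pi.sub_apply, k3, k4, e1]
  have hmove : inner ℂ (hEφ.toLp _) ((hT 1).memLp.toLp _) = inner ℂ q.1 (hw.toLp _) := by
    rw [inner_eq_integral (MemLp.coeFn_toLp _) (MemLp.coeFn_toLp _),
      inner_eq_integral hq1 (MemLp.coeFn_toLp _)]
    refine integral_congr_ae (Eventually.of_forall fun x => ?_)
    simp
    ring
  -- With `D = D' - E` this reads `⟪Dφ, Dψ⟫ = ⟪φ, D'D'ψ⟫ - ⟪φ, E D'ψ⟫ - ⟪Dφ, Eψ⟫`. No derivative
  -- falls on the merely bounded `E`: in the last term it stays on `φ`, where the form norm controls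
  -- it.
  have hon : inner ℂ (q.2 1) (p.2 1) = inner ℂ q.1 ((hTT 1).memLp.toLp _) -
      inner ℂ q.1 (hw.toLp _) - inner ℂ (q.2 1) (hs.toLp _) := by
    rw [hp1, inner_sub_right, ← hmove, ← hsym 1, ← inner_sub_left, ← hq21]
  have hrv : hr.toLp _ = (hTT 0).memLp.toLp _ + (hTT 1).memLp.toLp _ + (hTT 2).memLp.toLp _ -
      (t : ℂ) • p.1 := by
    refine Lp.ext ?_
    filter_upwards [hr.coeFn_toLp, (hTT 0).memLp.coeFn_toLp, (hTT 1).memLp.coeFn_toLp,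
      (hTT 2).memLp.coeFn_toLp, hp, Lp.coeFn_smul (t : ℂ) p.1,
      Lp.coeFn_sub ((hTT 0).memLp.toLp _ + (hTT 1).memLp.toLp _ + (hTT 2).memLp.toLp _)
        ((t : ℂ) • p.1),
      Lp.coeFn_add ((hTT 0).memLp.toLp _ + (hTT 1).memLp.toLp _) ((hTT 2).memLp.toLp _),
      Lp.coeFn_add ((hTT 0).memLp.toLp _) ((hTT 1).memLp.toLp _)] with x k1 k2 k3 k4 k5 k6 k7 k8 k9
    rw [k1, k7, Pi.sub_apply, k8, Pi.add_apply, k9, Pi.add_apply, k2, k3, k4, k6, Pi.smul_apply, k5,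
      Fin.sum_univ_three, smul_eq_mul]
  have hid : ∑ j, inner ℂ (q.2 j) (p.2 j) - t * inner ℂ q.1 p.1 =
      inner ℂ q.1 (hr.toLp _) - inner ℂ q.1 (hw.toLp _) - inner ℂ (q.2 1) (hs.toLp _) := by
    rw [Fin.sum_univ_three, hon, hoff 0 (fun x => by rw [hA0]; rfl),
      hoff 2 (fun x => by rw [hA2]; rfl), hrv, inner_sub_right, inner_add_right, inner_add_right,
      inner_smul_right]
    ring
  have n1 := norm_toLp_le hr h₁ hβ₁
  have n2 := norm_toLp_le hw h₂ hβ₂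
  have n3 := norm_toLp_le hs h₃ hβ₃
  set S := √(‖q.1‖ ^ 2 + ∑ j, ‖q.2 j‖ ^ 2) with hS
  have s1 : ‖q.1‖ ≤ S := Real.le_sqrt_of_sq_le (by
    have : 0 ≤ ∑ j, ‖q.2 j‖ ^ 2 := by positivity
    linarith)
  have s2 : ‖q.2 1‖ ≤ S := Real.le_sqrt_of_sq_le (by
    rw [Fin.sum_univ_three]
    nlinarith [sq_nonneg ‖q.1‖, sq_nonneg ‖q.2 0‖, sq_nonneg ‖q.2 2‖])
  have hS0 : 0 ≤ S := Real.sqrt_nonneg _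
  rw [hid]
  calc _ ≤ ‖inner ℂ q.1 (hr.toLp _)‖ + ‖inner ℂ q.1 (hw.toLp _)‖ +
        ‖inner ℂ (q.2 1) (hs.toLp _)‖ :=
        (norm_sub_le _ _).trans (add_le_add_left (norm_sub_le _ _) _)
    _ ≤ ‖q.1‖ * ‖hr.toLp _‖ + ‖q.1‖ * ‖hw.toLp _‖ + ‖q.2 1‖ * ‖hs.toLp _‖ := by
        gcongr <;> exact norm_inner_le_norm _ _
    _ ≤ S * β₁ + S * β₂ + S * β₃ := by gcongr
    _ = _ := by ring

/-! ### Functions with separated variables -/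

/-- The function `a(x₁) b(x₂) c(x₃)`. -/
def sep (a b c : ℝ → ℂ) (x : Space) : ℂ := a x.1 * b x.2.1 * c x.2.2

theorem isTest_sep {a b c : ℝ → ℂ} (ha : IsTest a) (hb : IsTest b) (hc : IsTest c) :
    IsTest (sep a b c) := by
  refine ⟨((ha.1.comp contDiff_fst).mul (hb.1.comp (contDiff_fst.comp contDiff_snd))).mul
    (hc.1.comp (contDiff_snd.comp contDiff_snd)), ?_⟩
  refine HasCompactSupport.intro (ha.2.isCompact.prod (hb.2.isCompact.prod hc.2.isCompact))
    fun x hx => ?_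
  rw [mem_prod, mem_prod, not_and_or, not_and_or] at hx
  rw [sep]
  rcases hx with h | h | h <;> simp [image_eq_zero_of_notMem_tsupport h]

theorem fderiv_dir_zero {φ : Space → ℂ} (hφ : IsTest φ) {x : Space} {d : ℂ}
    (h : HasDerivAt (fun t => φ (t, x.2.1, x.2.2)) d x.1) : fderiv ℝ φ x (dir 0) = d :=
  (hasDerivAt_slice (hφ.1.differentiable (by simp)) (hasDerivAt_line_zero x.2.1 x.2.2)
    x.1).unique h

theorem fderiv_dir_one {φ : Space → ℂ} (hφ : IsTest φ) {x : Space} {d : ℂ}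
    (h : HasDerivAt (fun t => φ (x.1, t, x.2.2)) d x.2.1) : fderiv ℝ φ x (dir 1) = d :=
  (hasDerivAt_slice (hφ.1.differentiable (by simp)) (hasDerivAt_line_one x.1 x.2.2)
    x.2.1).unique h

theorem fderiv_dir_two {φ : Space → ℂ} (hφ : IsTest φ) {x : Space} {d : ℂ}
    (h : HasDerivAt (fun t => φ (x.1, x.2.1, t)) d x.2.2) : fderiv ℝ φ x (dir 2) = d :=
  (hasDerivAt_slice (hφ.1.differentiable (by simp)) (hasDerivAt_line_two x.1 x.2.1)
    x.2.2).unique h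

section Separated

variable {a a' a'' b b' b'' c c' c'' : ℝ → ℂ}

theorem magD_sep_zero (B₀ : ℝ) (ha : IsTest a) (hb : IsTest b) (hc : IsTest c)
    (ha' : ∀ x, HasDerivAt a (a' x) x) : magD (constPotential B₀) (sep a b c) 0 =
      fun x => Complex.I * (a' x.1 * b x.2.1 * c x.2.2) := by
  funext x
  rw [magD, fderiv_dir_zero (isTest_sep ha hb hc) (d := a' x.1 * b x.2.1 * c x.2.2)
    (((ha' x.1).mul_const (b x.2.1)).mul_const (c x.2.2))]
  simp [constPotential]

theorem magD_sep_one (B₀ : ℝ) (ha : IsTest a) (hb : IsTest b) (hc : IsTest c)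
    (hb' : ∀ x, HasDerivAt b (b' x) x) : magD (constPotential B₀) (sep a b c) 1 =
      fun x => Complex.I * (a x.1 * b' x.2.1 * c x.2.2) +
        (B₀ * x.1 : ℝ) * (a x.1 * b x.2.1 * c x.2.2) := by
  funext x
  rw [magD, fderiv_dir_one (isTest_sep ha hb hc) (d := a x.1 * b' x.2.1 * c x.2.2)
    (((hb' x.2.1).const_mul (a x.1)).mul_const (c x.2.2))]
  simp [constPotential, sep]

theorem magD_sep_two (B₀ : ℝ) (ha : IsTest a) (hb : IsTest b) (hc : IsTest c)
    (hc' : ∀ x, HasDerivAt c (c' x) x) : magD (constPotential B₀) (sep a b c) 2 =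
      fun x => Complex.I * (a x.1 * b x.2.1 * c' x.2.2) := by
  funext x
  rw [magD, fderiv_dir_two (isTest_sep ha hb hc) (d := a x.1 * b x.2.1 * c' x.2.2)
    ((hc' x.2.2).const_mul (a x.1 * b x.2.1))]
  simp [constPotential]

/-- The constant-field operator on functions with separated variables. -/
theorem sum_magD_magD_sep (B₀ t k : ℝ) (ht : t = B₀ + k ^ 2) (ha : IsTest a) (hb : IsTest b)
    (hc : IsTest c)
    (ha' : ∀ x, HasDerivAt a (a' x) x) (ha'' : ∀ x, HasDerivAt a' (a'' x) x)
    (hb' : ∀ x, HasDerivAt b (b' x) x) (hb'' : ∀ x, HasDerivAt b' (b'' x) x)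
    (hc' : ∀ x, HasDerivAt c (c' x) x) (hc'' : ∀ x, HasDerivAt c' (c'' x) x) (x : Space) :
    (∑ j, magD (constPotential B₀) (magD (constPotential B₀) (sep a b c) j) j x) -
      t * sep a b c x =
      (-a'' x.1 + B₀ ^ 2 * x.1 ^ 2 * a x.1 - B₀ * a x.1) * b x.2.1 * c x.2.2 -
      a x.1 * b'' x.2.1 * c x.2.2 + 2 * Complex.I * B₀ * (x.1 * a x.1) * b' x.2.1 * c x.2.2 -
      a x.1 * b x.2.1 * (c'' x.2.2 + k ^ 2 * c x.2.2) := by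
  have hψ := isTest_sep ha hb hc
  have h0 : magD (constPotential B₀) (magD (constPotential B₀) (sep a b c) 0) 0 x =
      -(a'' x.1 * b x.2.1 * c x.2.2) := by
    have hT := isTest_magD_constPotential B₀ hψ 0
    rw [magD_sep_zero B₀ ha hb hc ha'] at hT ⊢
    rw [magD, fderiv_dir_zero hT (d := Complex.I * (a'' x.1 * b x.2.1 * c x.2.2))
      ((((ha'' x.1).mul_const (b x.2.1)).mul_const (c x.2.2)).const_mul Complex.I),
      ← mul_assoc, Complex.I_mul_I]
    simp [constPotential]
  have h2 : magD (constPotential B₀) (magD (constPotential B₀) (sep a b c) 2) 2 x =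
      -(a x.1 * b x.2.1 * c'' x.2.2) := by
    have hT := isTest_magD_constPotential B₀ hψ 2
    rw [magD_sep_two B₀ ha hb hc hc'] at hT ⊢
    rw [magD, fderiv_dir_two hT (d := Complex.I * (a x.1 * b x.2.1 * c'' x.2.2))
      (((hc'' x.2.2).const_mul (a x.1 * b x.2.1)).const_mul Complex.I),
      ← mul_assoc, Complex.I_mul_I]
    simp [constPotential]
  have h1 : magD (constPotential B₀) (magD (constPotential B₀) (sep a b c) 1) 1 x =
      -(a x.1 * b'' x.2.1 * c x.2.2) + 2 * Complex.I * B₀ * (x.1 * a x.1) * b' x.2.1 * c x.2.2 +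
        B₀ ^ 2 * x.1 ^ 2 * a x.1 * b x.2.1 * c x.2.2 := by
    have hT := isTest_magD_constPotential B₀ hψ 1
    rw [magD_sep_one B₀ ha hb hc hb'] at hT ⊢
    rw [magD, fderiv_dir_one hT (d := Complex.I * (a x.1 * b'' x.2.1 * c x.2.2) +
      (B₀ * x.1 : ℝ) * (a x.1 * b' x.2.1 * c x.2.2)) (((((hb'' x.2.1).const_mul (a x.1)).mul_const
      (c x.2.2)).const_mul Complex.I).add ((((hb' x.2.1).const_mul (a x.1)).mul_const
      (c x.2.2)).const_mul ((B₀ * x.1 : ℝ) : ℂ)))]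
    simp only [constPotential, Matrix.cons_val_one, Matrix.cons_val_zero, Complex.ofReal_mul]
    linear_combination (a x.1 * b'' x.2.1 * c x.2.2) * Complex.I_mul_I
  rw [Fin.sum_univ_three, h0, h1, h2, sep, ht]
  push_cast
  ring

end Separated

/-! ### Cutoff functions -/

/-- A smooth bump, equal to `1` on `[-1, 1]` and supported in `[-2, 2]`. -/
noncomputable def chi : ℝ → ℝ := (⟨1, 2, one_pos, one_lt_two⟩ : ContDiffBump (0 : ℝ))

theorem contDiff_chi : ContDiff ℝ ∞ chi := ContDiffBump.contDiff _

theorem chi_of_abs_le {x : ℝ} (hx : |x| ≤ 1) : chi x = 1 :=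
  ContDiffBump.one_of_mem_closedBall _ (by simpa using hx)

theorem iteratedDeriv_chi_of_lt {x : ℝ} (n : ℕ) (hx : 2 < |x|) : iteratedDeriv n chi x = 0 := by
  have h : chi =ᶠ[𝓝 x] fun _ => 0 := by
    filter_upwards [continuous_abs.continuousAt.eventually (lt_mem_nhds hx)] with y hy
    exact ContDiffBump.zero_of_le_dist _ (by simpa [Real.dist_eq] using hy.le)
  rw [h.iteratedDeriv_eq]
  simp

theorem continuous_iteratedDeriv_chi (n : ℕ) : Continuous (iteratedDeriv n chi) :=
  contDiff_chi.continuous_iteratedDeriv n (by exact_mod_cast le_top)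

theorem exists_chi_bound : ∃ K : ℝ, 1 ≤ K ∧ ∀ n ≤ 2, ∀ x, |iteratedDeriv n chi x| ≤ K := by
  have h : ∀ n, ∃ K, ∀ x, ‖iteratedDeriv n chi x‖ ≤ K := fun n =>
    (continuous_iteratedDeriv_chi n).bounded_above_of_compact_support
      (HasCompactSupport.intro (K := Icc (-2) 2) isCompact_Icc fun x hx =>
        iteratedDeriv_chi_of_lt n (by
          by_contra hcon
          exact hx (abs_le.1 (not_lt.1 hcon))))
  choose K hK using h
  refine ⟨max 1 (max (K 0) (max (K 1) (K 2))), le_max_left _ _, fun n hn x => (hK n x).trans ?_⟩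
  interval_cases n <;> simp

/-- The `n`-th derivative of the cutoff `chi ((x - s) / ℓ)`. -/
noncomputable def cut (s ℓ : ℝ) (n : ℕ) (x : ℝ) : ℝ := iteratedDeriv n chi ((x - s) / ℓ) / ℓ ^ n

theorem hasDerivAt_cut (s ℓ : ℝ) (n : ℕ) (x : ℝ) :
    HasDerivAt (cut s ℓ n) (cut s ℓ (n + 1) x) x := by
  have h1 : HasDerivAt (fun x : ℝ => (x - s) / ℓ) (1 / ℓ) x :=
    ((hasDerivAt_id x).sub_const s).div_const ℓ
  have h2 : HasDerivAt (iteratedDeriv n chi) (iteratedDeriv (n + 1) chi ((x - s) / ℓ))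
      ((x - s) / ℓ) := by
    rw [iteratedDeriv_succ]
    exact (contDiff_chi.differentiable_iteratedDeriv n
      (by exact_mod_cast WithTop.coe_lt_top _) _).hasDerivAt
  refine ((h2.comp x h1).div_const (ℓ ^ n)).congr_deriv ?_
  rw [cut, pow_succ]
  ring

theorem cut_eq_zero {s ℓ : ℝ} (hℓ : 0 < ℓ) (n : ℕ) {x : ℝ} (hx : x ∉ Icc (s - 2 * ℓ) (s + 2 * ℓ)) :
    cut s ℓ n x = 0 := by
  rw [cut, iteratedDeriv_chi_of_lt n, zero_div]
  by_contra hcon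
  rw [not_lt, abs_le, le_div_iff₀ hℓ, div_le_iff₀ hℓ] at hcon
  exact hx ⟨by linarith [hcon.1], by linarith [hcon.2]⟩

theorem cut_eq_one {s ℓ : ℝ} (hℓ : 0 < ℓ) {x : ℝ} (hx : x ∈ Icc (s - ℓ) (s + ℓ)) :
    cut s ℓ 0 x = 1 := by
  rw [cut, iteratedDeriv_zero, chi_of_abs_le, pow_zero, div_one]
  rw [abs_le, le_div_iff₀ hℓ, div_le_iff₀ hℓ]
  exact ⟨by linarith [hx.1], by linarith [hx.2]⟩

theorem contDiff_cut (s ℓ : ℝ) : ContDiff ℝ ∞ (cut s ℓ 0) := by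
  have : cut s ℓ 0 = fun x => chi ((x - s) / ℓ) := by
    funext x
    simp [cut]
  rw [this]
  exact contDiff_chi.comp ((contDiff_id.sub contDiff_const).div_const ℓ)

theorem isTest_mul_cut {f : ℝ → ℂ} (hf : ContDiff ℝ ∞ f) {s ℓ : ℝ} (hℓ : 0 < ℓ) :
    IsTest fun x => f x * (cut s ℓ 0 x : ℂ) :=
  ⟨hf.mul (Complex.ofRealCLM.contDiff.comp (contDiff_cut s ℓ)),
    HasCompactSupport.intro (K := Icc (s - 2 * ℓ) (s + 2 * ℓ)) isCompact_Icc fun x hx => by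
      simp [cut_eq_zero hℓ 0 hx]⟩

/-! ### The Gaussian -/

/-- The lowest Landau function of `x₁`. -/
noncomputable def gauss (B₀ x : ℝ) : ℝ := Real.exp (-(B₀ / 2) * x ^ 2)

theorem gauss_pos (B₀ x : ℝ) : 0 < gauss B₀ x := Real.exp_pos _

theorem hasDerivAt_gauss (B₀ x : ℝ) : HasDerivAt (gauss B₀) (-B₀ * x * gauss B₀ x) x := by
  have h := ((hasDerivAt_pow 2 x).const_mul (-(B₀ / 2))).exp
  refine h.congr_deriv ?_
  rw [gauss]
  push_cast
  ring

theorem contDiff_gauss (B₀ : ℝ) : ContDiff ℝ ∞ (gauss B₀) :=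
  (contDiff_const.mul (contDiff_id.pow 2)).exp

/-- The envelope `(1 + |x|) e^{-B₀x²/2}`. -/
noncomputable def envelope (B₀ x : ℝ) : ℝ := (1 + |x|) * gauss B₀ x

theorem gauss_le_envelope (B₀ x : ℝ) : gauss B₀ x ≤ envelope B₀ x := by
  have := gauss_pos B₀ x
  rw [envelope]
  nlinarith [abs_nonneg x]

theorem abs_mul_gauss_le_envelope (B₀ x : ℝ) : |x| * gauss B₀ x ≤ envelope B₀ x := by
  have := gauss_pos B₀ x
  rw [envelope]
  linarith

theorem continuous_envelope (B₀ : ℝ) : Continuous (envelope B₀) := by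
  have := (contDiff_gauss B₀).continuous
  unfold envelope
  fun_prop

theorem lintegral_envelope_lt_top {B₀ : ℝ} (hB₀ : 0 < B₀) :
    ∫⁻ x, ENNReal.ofReal (envelope B₀ x ^ 2) < ⊤ := by
  have h1 : Integrable fun x : ℝ => 2 * Real.exp (-B₀ * x ^ 2) +
      2 * (x ^ (2 : ℝ) * Real.exp (-B₀ * x ^ 2)) :=
    ((integrable_exp_neg_mul_sq hB₀).const_mul 2).add
      ((integrable_rpow_mul_exp_neg_mul_sq hB₀ (by norm_num)).const_mul 2)
  refine lt_of_le_of_lt (lintegral_mono fun x => ENNReal.ofReal_le_ofReal ?_)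
    h1.lintegral_lt_top
  have e : gauss B₀ x ^ 2 = Real.exp (-B₀ * x ^ 2) := by
    rw [gauss, ← Real.exp_nat_mul]
    congr 1
    push_cast
    ring
  rw [envelope, mul_pow, e, Real.rpow_two]
  have h2 : (1 + |x|) ^ 2 ≤ 2 + 2 * x ^ 2 := by
    nlinarith [sq_nonneg (1 - |x|), sq_abs x]
  have := mul_le_mul_of_nonneg_right h2 (Real.exp_pos (-B₀ * x ^ 2)).le
  linarith

/-- The slab region carrying the Weyl functions. -/
def weylRegion (ℓ : ℝ) : Set (ℝ × ℝ) := Icc (-(2 * ℓ)) (2 * ℓ) ×ˢ Icc ℓ (5 * ℓ)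

/-- Functions dominated by the envelope have uniformly bounded norm. -/
theorem lintegral_le_of_envelope {B₀ : ℝ} (hB₀ : 0 < B₀) {ℓ D : ℝ} (hℓ : 0 < ℓ)
    {h : Space → ℂ} (hz : ∀ᵐ x, x.2 ∉ weylRegion ℓ → h x = 0)
    (hb : ∀ᵐ x, x.2 ∈ weylRegion ℓ → ‖h x‖ ≤ D * envelope B₀ x.1 / ℓ) :
    ∫⁻ x, ‖h x‖ₑ ^ 2 ≤ ENNReal.ofReal
      ((D * (4 * √(∫⁻ x, ENNReal.ofReal (envelope B₀ x ^ 2)).toReal)) ^ 2) := by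
  have hms : MeasurableSet (weylRegion ℓ) := measurableSet_Icc.prod measurableSet_Icc
  have hpt : ∀ᵐ x, ‖h x‖ₑ ^ 2 ≤ ENNReal.ofReal (D ^ 2 / ℓ ^ 2) *
      (ENNReal.ofReal (envelope B₀ x.1 ^ 2) * (weylRegion ℓ).indicator 1 x.2) := by
    filter_upwards [hz, hb] with x h1 h2
    by_cases hx : x.2 ∈ weylRegion ℓ
    · rw [indicator_of_mem hx, Pi.one_apply, mul_one, ← ENNReal.ofReal_mul (by positivity),
        enorm_sq_eq_ofReal]
      refine ENNReal.ofReal_le_ofReal ?_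
      refine (pow_le_pow_left₀ (norm_nonneg _) (h2 hx) 2).trans (le_of_eq ?_)
      ring
    · simp [h1 hx]
  refine (lintegral_mono_ae hpt).trans (le_of_eq ?_)
  -- The `4ℓ × 4ℓ` area cancels the normalisation `1 / ℓ²` and leaves the factor 4 in the bound.
  have hvol : volume (weylRegion ℓ) = ENNReal.ofReal (16 * ℓ ^ 2) := by
    rw [weylRegion, Measure.volume_eq_prod, Measure.prod_prod, Real.volume_Icc, Real.volume_Icc,
      ← ENNReal.ofReal_mul (by linarith)]
    congr 1
    ring
  have hm : Measurable fun x => ENNReal.ofReal (envelope B₀ x ^ 2) := by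
    have := continuous_envelope B₀
    fun_prop
  have hprod : ∫⁻ x : Space, ENNReal.ofReal (envelope B₀ x.1 ^ 2) *
      (weylRegion ℓ).indicator 1 x.2 = (∫⁻ x, ENNReal.ofReal (envelope B₀ x ^ 2)) *
        ENNReal.ofReal (16 * ℓ ^ 2) := by
    rw [Measure.volume_eq_prod, lintegral_prod_mul hm.aemeasurable
      ((measurable_one.indicator hms).aemeasurable), lintegral_indicator_one hms, hvol]
  rw [lintegral_const_mul' _ _ (by finiteness), hprod]
  set Γ := ∫⁻ x, ENNReal.ofReal (envelope B₀ x ^ 2) with hΓ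
  have hΓt : Γ ≠ ⊤ := (lintegral_envelope_lt_top hB₀).ne
  conv_lhs => rw [← ENNReal.ofReal_toReal hΓt]
  rw [← ENNReal.ofReal_mul (by positivity), ← ENNReal.ofReal_mul (by positivity)]
  congr 1
  rw [mul_pow, mul_pow, Real.sq_sqrt ENNReal.toReal_nonneg]
  field_simp
  ring

/-! ### The Weyl functions -/

/-- The factor in `x₁`. -/
noncomputable def weylA (B₀ ℓ : ℝ) (x : ℝ) : ℂ := (gauss B₀ x : ℂ) * (cut 0 ℓ 0 x : ℂ)

/-- The factor in `x₂`. -/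
noncomputable def weylB (ℓ : ℝ) (n : ℕ) (x : ℝ) : ℂ := (cut 0 ℓ n x : ℂ)

/-- The factor in `x₃`. -/
noncomputable def weylC (k ℓ : ℝ) (x : ℝ) : ℂ :=
  (Complex.exp (Complex.I * k * x) / ℓ) * (cut (3 * ℓ) ℓ 0 x : ℂ)

theorem isTest_weylA (B₀ : ℝ) {ℓ : ℝ} (hℓ : 0 < ℓ) : IsTest (weylA B₀ ℓ) :=
  isTest_mul_cut (Complex.ofRealCLM.contDiff.comp (contDiff_gauss B₀)) hℓ

theorem isTest_weylB {ℓ : ℝ} (hℓ : 0 < ℓ) : IsTest (weylB ℓ 0) := by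
  have h := isTest_mul_cut (f := fun _ => 1) contDiff_const (s := 0) hℓ
  simp only [one_mul] at h
  exact h

theorem isTest_weylC (k : ℝ) {ℓ : ℝ} (hℓ : 0 < ℓ) : IsTest (weylC k ℓ) :=
  isTest_mul_cut (((contDiff_const.mul Complex.ofRealCLM.contDiff).cexp).div_const _) hℓ

theorem hasDerivAt_weylB (ℓ : ℝ) (n : ℕ) (x : ℝ) :
    HasDerivAt (weylB ℓ n) (weylB ℓ (n + 1) x) x :=
  (hasDerivAt_cut 0 ℓ n x).ofReal_comp

/-- The first derivative of `weylA`. -/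
noncomputable def weylA' (B₀ ℓ : ℝ) (x : ℝ) : ℝ :=
  gauss B₀ x * (-B₀ * x * cut 0 ℓ 0 x + cut 0 ℓ 1 x)

/-- The second derivative of `weylA`. -/
noncomputable def weylA'' (B₀ ℓ : ℝ) (x : ℝ) : ℝ :=
  gauss B₀ x * ((B₀ ^ 2 * x ^ 2 - B₀) * cut 0 ℓ 0 x - 2 * B₀ * x * cut 0 ℓ 1 x + cut 0 ℓ 2 x)

theorem hasDerivAt_weylA (B₀ ℓ x : ℝ) : HasDerivAt (weylA B₀ ℓ) (weylA' B₀ ℓ x : ℂ) x := by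
  have h := ((hasDerivAt_gauss B₀ x).mul (hasDerivAt_cut 0 ℓ 0 x)).ofReal_comp
  have e : weylA B₀ ℓ = fun y => (((gauss B₀ * cut 0 ℓ 0) y : ℝ) : ℂ) := by
    funext y
    simp [weylA]
  rw [e]
  convert h using 2
  rw [weylA']
  ring

theorem hasDerivAt_weylA' (B₀ ℓ x : ℝ) :
    HasDerivAt (fun x => (weylA' B₀ ℓ x : ℂ)) (weylA'' B₀ ℓ x : ℂ) x := by
  have h1 := (((hasDerivAt_id x).const_mul (-B₀)).mul (hasDerivAt_cut 0 ℓ 0 x)).add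
    (hasDerivAt_cut 0 ℓ 1 x)
  have h := ((hasDerivAt_gauss B₀ x).mul h1).ofReal_comp
  have e : (fun x => (weylA' B₀ ℓ x : ℂ)) = fun y =>
      (((gauss B₀ * ((fun y => -B₀ * id y) * cut 0 ℓ 0 + cut 0 ℓ 1)) y : ℝ) : ℂ) := by
    funext y
    simp [weylA']
  rw [e]
  refine h.congr_deriv ?_
  simp only [weylA'', Pi.mul_apply, Pi.add_apply, id]
  push_cast
  ring

/-- The first derivative of `weylC`. -/
noncomputable def weylC' (k ℓ : ℝ) (x : ℝ) : ℂ :=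
  (Complex.exp (Complex.I * k * x) / ℓ) *
    (Complex.I * k * (cut (3 * ℓ) ℓ 0 x : ℂ) + (cut (3 * ℓ) ℓ 1 x : ℂ))

/-- The second derivative of `weylC`. -/
noncomputable def weylC'' (k ℓ : ℝ) (x : ℝ) : ℂ :=
  (Complex.exp (Complex.I * k * x) / ℓ) *
    (-k ^ 2 * (cut (3 * ℓ) ℓ 0 x : ℂ) + 2 * (Complex.I * k) * (cut (3 * ℓ) ℓ 1 x : ℂ) +
      (cut (3 * ℓ) ℓ 2 x : ℂ))

theorem hasDerivAt_wave (k ℓ x : ℝ) :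
    HasDerivAt (fun x : ℝ => Complex.exp (Complex.I * k * x) / ℓ)
      (Complex.exp (Complex.I * k * x) / ℓ * (Complex.I * k)) x := by
  have h1 : HasDerivAt (fun x : ℝ => Complex.I * k * (x : ℂ)) (Complex.I * k) x := by
    simpa using (Complex.ofRealCLM.hasDerivAt (x := x)).const_mul (Complex.I * k)
  refine ((h1.cexp).div_const (ℓ : ℂ)).congr_deriv ?_
  ring

theorem hasDerivAt_weylC (k ℓ x : ℝ) : HasDerivAt (weylC k ℓ) (weylC' k ℓ x) x := by
  have h := (hasDerivAt_wave k ℓ x).mul (hasDerivAt_cut (3 * ℓ) ℓ 0 x).ofReal_comp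
  refine h.congr_deriv ?_
  rw [weylC']
  ring

theorem hasDerivAt_weylC' (k ℓ x : ℝ) : HasDerivAt (weylC' k ℓ) (weylC'' k ℓ x) x := by
  have h := (hasDerivAt_wave k ℓ x).mul
    (((hasDerivAt_cut (3 * ℓ) ℓ 0 x).ofReal_comp.const_mul (Complex.I * k)).add
      (hasDerivAt_cut (3 * ℓ) ℓ 1 x).ofReal_comp)
  refine h.congr_deriv ?_
  simp only [weylC'', Pi.add_apply]
  linear_combination ((Complex.exp (Complex.I * k * x) / ℓ) * k ^ 2 * (cut (3 * ℓ) ℓ 0 x : ℂ)) *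
    Complex.I_mul_I

/-- The Weyl function at energy `B₀ + k²` and scale `ℓ`. -/
noncomputable def weyl (B₀ k ℓ : ℝ) : Space → ℂ := sep (weylA B₀ ℓ) (weylB ℓ 0) (weylC k ℓ)

theorem isTest_weyl (B₀ k : ℝ) {ℓ : ℝ} (hℓ : 0 < ℓ) : IsTest (weyl B₀ k ℓ) :=
  isTest_sep (isTest_weylA B₀ hℓ) (isTest_weylB hℓ) (isTest_weylC k hℓ)

theorem magD_weyl_one (B₀ k : ℝ) {ℓ : ℝ} (hℓ : 0 < ℓ) :
    magD (constPotential B₀) (weyl B₀ k ℓ) 1 = fun x =>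
      Complex.I * (weylA B₀ ℓ x.1 * weylB ℓ 1 x.2.1 * weylC k ℓ x.2.2) +
        (B₀ * x.1 : ℝ) * (weylA B₀ ℓ x.1 * weylB ℓ 0 x.2.1 * weylC k ℓ x.2.2) :=
  magD_sep_one B₀ (isTest_weylA B₀ hℓ) (isTest_weylB hℓ) (isTest_weylC k hℓ)
    (hasDerivAt_weylB ℓ 0)

/-- The Gaussian is annihilated by `-∂₁² + B₀² x₁² - B₀` and the plane wave by `∂₃² + k²`. Every
surviving term therefore contains a derivative of a cutoff. -/
theorem residual_weyl {B₀ k t : ℝ} (ht : t = B₀ + k ^ 2) {ℓ : ℝ} (hℓ : 0 < ℓ) (x : Space) :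
    (∑ j, magD (constPotential B₀) (magD (constPotential B₀) (weyl B₀ k ℓ) j) j x) -
      t * weyl B₀ k ℓ x =
      ((gauss B₀ x.1 * (2 * B₀ * x.1 * cut 0 ℓ 1 x.1 - cut 0 ℓ 2 x.1) : ℝ) : ℂ) *
        weylB ℓ 0 x.2.1 * weylC k ℓ x.2.2 -
      weylA B₀ ℓ x.1 * weylB ℓ 2 x.2.1 * weylC k ℓ x.2.2 +
      2 * Complex.I * B₀ * (x.1 * weylA B₀ ℓ x.1) * weylB ℓ 1 x.2.1 * weylC k ℓ x.2.2 -
      weylA B₀ ℓ x.1 * weylB ℓ 0 x.2.1 * ((Complex.exp (Complex.I * k * x.2.2) / ℓ) *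
        (2 * (Complex.I * k) * (cut (3 * ℓ) ℓ 1 x.2.2 : ℂ) + (cut (3 * ℓ) ℓ 2 x.2.2 : ℂ))) := by
  rw [weyl, sum_magD_magD_sep B₀ t k ht (isTest_weylA B₀ hℓ) (isTest_weylB hℓ)
    (isTest_weylC k hℓ) (hasDerivAt_weylA B₀ ℓ) (hasDerivAt_weylA' B₀ ℓ) (hasDerivAt_weylB ℓ 0)
    (hasDerivAt_weylB ℓ 1) (hasDerivAt_weylC k ℓ) (hasDerivAt_weylC' k ℓ)]
  simp only [weylA'', weylC'', weylA, weylC]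
  push_cast
  ring

section Bounds

variable {B₀ k ℓ K : ℝ}

theorem abs_cut_le (hK : ∀ n ≤ 2, ∀ x, |iteratedDeriv n chi x| ≤ K) (hℓ : 1 ≤ ℓ) (s x : ℝ) :
    |cut s ℓ 0 x| ≤ K ∧ |cut s ℓ 1 x| ≤ K / ℓ ∧ |cut s ℓ 2 x| ≤ K / ℓ := by
  have h0 : 0 < ℓ := by linarith
  have hK0 : 0 ≤ K := (abs_nonneg _).trans (hK 0 (by norm_num) 0)
  refine ⟨by simpa [cut] using hK 0 (by norm_num) ((x - s) / ℓ), ?_, ?_⟩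
  · rw [cut, abs_div, pow_one, abs_of_pos h0]
    gcongr
    exact hK 1 (by norm_num) _
  · rw [cut, abs_div, abs_of_pos (pow_pos h0 2)]
    calc _ ≤ K / ℓ ^ 2 := by gcongr; exact hK 2 le_rfl _
      _ ≤ K / ℓ := by gcongr; nlinarith

theorem norm_wave (k x : ℝ) (hℓ : 1 ≤ ℓ) : ‖Complex.exp (Complex.I * k * x) / ℓ‖ = 1 / ℓ := by
  have h0 : 0 < ℓ := by linarith
  rw [norm_div, Complex.norm_real, Real.norm_of_nonneg h0.le,
    show Complex.I * k * x = ((k * x : ℝ) : ℂ) * Complex.I by push_cast; ring,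
    Complex.norm_exp_ofReal_mul_I]

theorem norm_weylA_le (hK : ∀ n ≤ 2, ∀ x, |iteratedDeriv n chi x| ≤ K) (hℓ : 1 ≤ ℓ) (x : ℝ) :
    ‖weylA B₀ ℓ x‖ ≤ K * gauss B₀ x := by
  rw [weylA, norm_mul, Complex.norm_real, Complex.norm_real, Real.norm_of_nonneg (gauss_pos _ _).le,
    mul_comm]
  gcongr
  · exact (gauss_pos _ _).le
  · exact (abs_cut_le hK hℓ 0 x).1

theorem norm_weylC_le (hK : ∀ n ≤ 2, ∀ x, |iteratedDeriv n chi x| ≤ K) (hℓ : 1 ≤ ℓ) (x : ℝ) :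
    ‖weylC k ℓ x‖ ≤ K / ℓ := by
  have h0 : 0 < ℓ := by linarith
  rw [weylC, norm_mul, norm_wave k x hℓ, Complex.norm_real, one_div_mul_eq_div]
  gcongr
  exact (abs_cut_le hK hℓ _ x).1

theorem norm_weylB_le (hK : ∀ n ≤ 2, ∀ x, |iteratedDeriv n chi x| ≤ K) (hℓ : 1 ≤ ℓ) (x : ℝ) :
    ‖weylB ℓ 0 x‖ ≤ K ∧ ‖weylB ℓ 1 x‖ ≤ K / ℓ ∧ ‖weylB ℓ 2 x‖ ≤ K / ℓ := by
  simp only [weylB, Complex.norm_real, Real.norm_eq_abs]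
  exact abs_cut_le hK hℓ 0 x

theorem weyl_factors_eq_zero (hℓ : 0 < ℓ) {y : ℝ × ℝ} (hy : y ∉ weylRegion ℓ) :
    (∀ n, weylB ℓ n y.1 = 0) ∨ ∀ n, cut (3 * ℓ) ℓ n y.2 = 0 := by
  rw [weylRegion, mem_prod, not_and_or] at hy
  rcases hy with h | h
  · left
    intro n
    rw [weylB, cut_eq_zero hℓ n (by simpa using h), Complex.ofReal_zero]
  · right
    intro n
    refine cut_eq_zero hℓ n ?_
    rwa [show 3 * ℓ - 2 * ℓ = ℓ by ring, show 3 * ℓ + 2 * ℓ = 5 * ℓ by ring]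

theorem weyl_eq_zero (hℓ : 0 < ℓ) {x : Space} (hx : x.2 ∉ weylRegion ℓ) : weyl B₀ k ℓ x = 0 := by
  rw [weyl, sep, weylC]
  rcases weyl_factors_eq_zero hℓ hx with h | h <;> simp [h]

theorem magD_weyl_eq_zero (hℓ : 0 < ℓ) {x : Space} (hx : x.2 ∉ weylRegion ℓ) :
    magD (constPotential B₀) (weyl B₀ k ℓ) 1 x = 0 := by
  rw [magD_weyl_one B₀ k hℓ]
  simp only [weylC]
  rcases weyl_factors_eq_zero hℓ hx with h | h <;> simp [h]

theorem norm_weyl_le (hK : ∀ n ≤ 2, ∀ x, |iteratedDeriv n chi x| ≤ K) (hℓ : 1 ≤ ℓ)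
    (x : Space) : ‖weyl B₀ k ℓ x‖ ≤ K ^ 3 * envelope B₀ x.1 / ℓ := by
  have h0 : 0 < ℓ := by linarith
  have hK0 : 0 ≤ K := (abs_nonneg _).trans (hK 0 (by norm_num) 0)
  have hg := gauss_pos B₀ x.1
  rw [weyl, sep, norm_mul, norm_mul]
  calc _ ≤ K * gauss B₀ x.1 * K * (K / ℓ) := by
        gcongr
        · exact norm_weylA_le hK hℓ _
        · exact (norm_weylB_le hK hℓ _).1
        · exact norm_weylC_le hK hℓ _
    _ = K ^ 3 * gauss B₀ x.1 / ℓ := by ring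
    _ ≤ _ := by gcongr; exact gauss_le_envelope _ _

/-- The unbounded factor `B₀ x₁` of the potential is absorbed by the Gaussian, which is why the
envelope contains `|x|`. -/
theorem norm_magD_weyl_le (hB₀ : 0 < B₀) (hK : ∀ n ≤ 2, ∀ x, |iteratedDeriv n chi x| ≤ K)
    (hℓ : 1 ≤ ℓ) (x : Space) :
    ‖magD (constPotential B₀) (weyl B₀ k ℓ) 1 x‖ ≤
      (K ^ 3 * (1 + B₀)) * envelope B₀ x.1 / ℓ := by
  have h0 : 0 < ℓ := by linarith
  have hK0 : 0 ≤ K := (abs_nonneg _).trans (hK 0 (by norm_num) 0)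
  have hg := gauss_pos B₀ x.1
  have hKℓ : K / ℓ ≤ K := div_le_self hK0 hℓ
  rw [magD_weyl_one B₀ k h0]
  refine (norm_add_le _ _).trans ?_
  simp only [norm_mul, Complex.norm_I, one_mul, Complex.norm_real, Real.norm_eq_abs,
    abs_of_pos hB₀]
  calc _ ≤ K * gauss B₀ x.1 * K * (K / ℓ) + B₀ * |x.1| * (K * gauss B₀ x.1 * K * (K / ℓ)) := by
        gcongr
        · exact norm_weylA_le hK hℓ _
        · exact (norm_weylB_le hK hℓ _).2.1.trans hKℓ
        · exact norm_weylC_le hK hℓ _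
        · exact norm_weylA_le hK hℓ _
        · exact (norm_weylB_le hK hℓ _).1
        · exact norm_weylC_le hK hℓ _
    _ = K ^ 3 / ℓ * (gauss B₀ x.1 + B₀ * (|x.1| * gauss B₀ x.1)) := by ring
    _ ≤ K ^ 3 / ℓ * (envelope B₀ x.1 + B₀ * envelope B₀ x.1) := by
        gcongr
        · exact gauss_le_envelope _ _
        · exact abs_mul_gauss_le_envelope _ _
    _ = _ := by ring

/-- Cutoff derivatives gain `1 / ℓ`. In the constant, `4 B₀` comes from the `x₁`-cutoff and the
cross term in `∂₂`, `2 |k|` from the plane wave, and 3 from the second derivatives of the three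
cutoffs. -/
theorem norm_residual_weyl_le (hB₀ : 0 < B₀) {t : ℝ} (ht : t = B₀ + k ^ 2)
    (hK : ∀ n ≤ 2, ∀ x, |iteratedDeriv n chi x| ≤ K) (hℓ : 1 ≤ ℓ) (x : Space) :
    ‖(∑ j, magD (constPotential B₀) (magD (constPotential B₀) (weyl B₀ k ℓ) j) j x) -
      t * weyl B₀ k ℓ x‖ ≤
      (K ^ 3 * (4 * B₀ + 2 * |k| + 3) / ℓ) * envelope B₀ x.1 / ℓ := by
  have h0 : 0 < ℓ := by linarith
  have hK0 : 0 ≤ K := (abs_nonneg _).trans (hK 0 (by norm_num) 0)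
  have hg := gauss_pos B₀ x.1
  have hA := norm_weylA_le (B₀ := B₀) hK hℓ x.1
  obtain ⟨hB0, hB1, hB2⟩ := norm_weylB_le hK hℓ x.2.1
  have hC := norm_weylC_le (k := k) hK hℓ x.2.2
  obtain ⟨-, hc1, hc2⟩ := abs_cut_le hK hℓ 0 x.1
  obtain ⟨-, hd1, hd2⟩ := abs_cut_le hK hℓ (3 * ℓ) x.2.2
  have e1 := gauss_le_envelope B₀ x.1
  have e2 := abs_mul_gauss_le_envelope B₀ x.1
  rw [residual_weyl ht h0]
  have t1 : ‖((gauss B₀ x.1 * (2 * B₀ * x.1 * cut 0 ℓ 1 x.1 - cut 0 ℓ 2 x.1) : ℝ) : ℂ)‖ ≤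
      K / ℓ * (2 * B₀ * (|x.1| * gauss B₀ x.1) + gauss B₀ x.1) := by
    rw [Complex.norm_real, Real.norm_eq_abs, abs_mul, abs_of_pos hg]
    calc _ ≤ gauss B₀ x.1 * (2 * B₀ * |x.1| * (K / ℓ) + K / ℓ) := by
          gcongr
          refine (abs_sub _ _).trans ?_
          rw [abs_mul, abs_mul, abs_of_pos (show 0 < 2 * B₀ by positivity)]
          gcongr
      _ = _ := by ring
  have t2 : ‖(Complex.exp (Complex.I * k * x.2.2) / ℓ) *
      (2 * (Complex.I * k) * (cut (3 * ℓ) ℓ 1 x.2.2 : ℂ) + (cut (3 * ℓ) ℓ 2 x.2.2 : ℂ))‖ ≤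
      1 / ℓ * (2 * |k| * (K / ℓ) + K / ℓ) := by
    rw [norm_mul, norm_wave k _ hℓ]
    gcongr
    refine (norm_add_le _ _).trans ?_
    simp only [norm_mul, Complex.norm_I, one_mul, Complex.norm_real, Real.norm_eq_abs,
      RCLike.norm_ofNat]
    gcongr
  have t3 : ‖2 * Complex.I * B₀ * (x.1 * weylA B₀ ℓ x.1)‖ ≤ 2 * B₀ * (|x.1| * (K * gauss B₀ x.1)) := by
    simp only [norm_mul, Complex.norm_I, mul_one, Complex.norm_real, Real.norm_eq_abs,
      RCLike.norm_ofNat, abs_of_pos hB₀]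
    gcongr
  refine (norm_sub_le _ _).trans ((add_le_add_left ((norm_add_le _ _).trans
    (add_le_add_left (norm_sub_le _ _) _)) _).trans ?_)
  rw [norm_mul _ (weylC k ℓ x.2.2), norm_mul _ (weylB ℓ 0 x.2.1), norm_mul _ (weylC k ℓ x.2.2),
    norm_mul _ (weylB ℓ 2 x.2.1), norm_mul _ (weylC k ℓ x.2.2), norm_mul _ (weylB ℓ 1 x.2.1),
    norm_mul (weylA B₀ ℓ x.1 * weylB ℓ 0 x.2.1), norm_mul (weylA B₀ ℓ x.1)]
  calc _ ≤ (K / ℓ * (2 * B₀ * (|x.1| * gauss B₀ x.1) + gauss B₀ x.1)) * K * (K / ℓ) +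
        (K * gauss B₀ x.1) * (K / ℓ) * (K / ℓ) +
        (2 * B₀ * (|x.1| * (K * gauss B₀ x.1))) * (K / ℓ) * (K / ℓ) +
        (K * gauss B₀ x.1) * K * (1 / ℓ * (2 * |k| * (K / ℓ) + K / ℓ)) := by gcongr
    _ = K ^ 3 / ℓ / ℓ * (4 * B₀ * (|x.1| * gauss B₀ x.1) + (2 * |k| + 3) * gauss B₀ x.1) := by
        field_simp
        ring
    _ ≤ K ^ 3 / ℓ / ℓ * (4 * B₀ * envelope B₀ x.1 + (2 * |k| + 3) * envelope B₀ x.1) := by gcongr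
    _ = _ := by ring

theorem residual_weyl_eq_zero {t : ℝ} (ht : t = B₀ + k ^ 2) (hℓ : 0 < ℓ) {x : Space}
    (hx : x.2 ∉ weylRegion ℓ) :
    (∑ j, magD (constPotential B₀) (magD (constPotential B₀) (weyl B₀ k ℓ) j) j x) -
      t * weyl B₀ k ℓ x = 0 := by
  rw [residual_weyl ht hℓ]
  simp only [weylC]
  rcases weyl_factors_eq_zero hℓ hx with h | h <;> simp [h]

/-- Lower bound for the norm of the Weyl functions. -/
theorem le_lintegral_weyl (hB₀ : 0 < B₀) (hℓ : 1 ≤ ℓ) :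
    ENNReal.ofReal (8 * Real.exp (-B₀)) ≤ ∫⁻ x, ‖weyl B₀ k ℓ x‖ₑ ^ 2 := by
  have h0 : 0 < ℓ := by linarith
  -- On `S`, of volume `8 ℓ²`, all three cutoffs equal 1 and the squared Gaussian is at least
  -- `e^{-B₀}`.
  set S : Set Space := Icc (-1) 1 ×ˢ Icc (-ℓ) ℓ ×ˢ Icc (2 * ℓ) (4 * ℓ) with hS
  have hms : MeasurableSet S := measurableSet_Icc.prod (measurableSet_Icc.prod measurableSet_Icc)
  have hvol : volume S = ENNReal.ofReal (8 * ℓ ^ 2) := by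
    rw [hS, Measure.volume_eq_prod, Measure.prod_prod, Measure.volume_eq_prod, Measure.prod_prod,
      Real.volume_Icc, Real.volume_Icc, Real.volume_Icc, ← ENNReal.ofReal_mul (by linarith),
      ← ENNReal.ofReal_mul (by norm_num)]
    congr 1
    ring
  calc ENNReal.ofReal (8 * Real.exp (-B₀))
      = ∫⁻ x in S, ENNReal.ofReal (Real.exp (-B₀) / ℓ ^ 2) := by
        rw [setLIntegral_const, hvol, ← ENNReal.ofReal_mul (by positivity)]
        congr 1
        field_simp
    _ ≤ ∫⁻ x in S, ‖weyl B₀ k ℓ x‖ₑ ^ 2 := by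
        refine setLIntegral_mono' hms fun x hx => ?_
        obtain ⟨h1, h2, h3⟩ := hx
        have hx1 : x.1 ^ 2 ≤ 1 := by
          rw [sq_le_one_iff_abs_le_one]
          exact abs_le.2 h1
        rw [enorm_sq_eq_ofReal]
        refine ENNReal.ofReal_le_ofReal ?_
        rw [weyl, sep, weylA, weylB, weylC, cut_eq_one h0 (x := x.1) (by
            constructor <;> [linarith [h1.1]; linarith [h1.2]]),
          cut_eq_one h0 (x := x.2.1) (by simpa using h2),
          cut_eq_one h0 (x := x.2.2) (by
            constructor <;> [linarith [h3.1]; linarith [h3.2]])]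
        rw [Complex.ofReal_one, mul_one, mul_one, mul_one, norm_mul, norm_wave k _ hℓ,
          Complex.norm_real, Real.norm_of_nonneg (gauss_pos _ _).le, mul_pow, div_pow, one_pow,
          mul_one_div, gauss, ← Real.exp_nat_mul]
        gcongr
        push_cast
        nlinarith
    _ ≤ _ := setLIntegral_le_lintegral _ _

end Bounds

/-! ### The essential spectrum -/

/-- Bounded sequences whose supports escape in the third direction are weakly null. -/
theorem tendsto_inner_of_escaping {u : ℕ → L2} {C : ℝ} (hC : ∀ n, ‖u n‖ ≤ C)
    (h0 : ∀ n : ℕ, ∀ᵐ x : Space, x.2.2 < n → u n x = 0) (y : L2) :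
    Tendsto (fun n => inner ℂ y (u n)) atTop (𝓝 0) := by
  set S : ℕ → Set Space := fun n => {x | (n : ℝ) ≤ x.2.2} with hS
  have hms : ∀ n, MeasurableSet (S n) := fun n =>
    measurableSet_le measurable_const (measurable_snd.comp measurable_snd)
  have hy : ∀ n, MemLp ((S n).indicator y) 2 volume := fun n => (Lp.memLp y).indicator (hms n)
  -- Only the part of `y` in `x₃ ≥ n` meets `u n`, and its norm tends to zero by dominated
  -- convergence.
  have e : ∀ n, inner ℂ y (u n) = inner ℂ ((hy n).toLp _) (u n) := by
    intro n
    rw [inner_eq_integral (ae_eq_refl _) (ae_eq_refl _),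
      inner_eq_integral (hy n).coeFn_toLp (ae_eq_refl _)]
    refine integral_congr_ae ?_
    filter_upwards [h0 n] with x hx
    by_cases hxS : x ∈ S n
    · simp [hxS]
    · rw [hx (not_le.1 hxS)]
      simp
  have hm : AEMeasurable (fun x => ‖y x‖ₑ ^ 2) volume :=
    (Lp.aestronglyMeasurable y).enorm.pow_const 2
  have hlim : Tendsto (fun n => ∫⁻ x, ‖(S n).indicator y x‖ₑ ^ 2) atTop (𝓝 0) := by
    have := tendsto_lintegral_of_dominated_convergence' (μ := (volume : Measure Space))
      (F := fun n x => ‖(S n).indicator y x‖ₑ ^ 2) (f := fun _ => 0) (fun x => ‖y x‖ₑ ^ 2)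
      (fun n => (hy n).1.enorm.pow_const 2)
      (fun n => Eventually.of_forall fun x => by
        dsimp only
        gcongr
        exact enorm_indicator_le_enorm_self _ _)
      (by rw [lintegral_enorm_sq]; exact ENNReal.ofReal_ne_top)
      (Eventually.of_forall fun x => by
        refine tendsto_const_nhds.congr' ?_
        obtain ⟨N, hN⟩ := exists_nat_gt x.2.2
        filter_upwards [eventually_ge_atTop N] with n hn
        have : x ∉ S n := not_le.2 (hN.trans_le (by exact_mod_cast hn))
        simp [this])
    simpa using this
  have hlim' : Tendsto (fun n => ‖(hy n).toLp _‖ ^ 2) atTop (𝓝 0) := by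
    have := (ENNReal.tendsto_toReal ENNReal.zero_ne_top).comp hlim
    refine this.congr fun n => ?_
    rw [Function.comp_apply, ← ENNReal.toReal_ofReal (sq_nonneg ‖(hy n).toLp _‖),
      ← lintegral_enorm_sq]
    congr 1
    exact lintegral_congr_ae ((hy n).coeFn_toLp.mono fun x hx => by dsimp only; rw [hx])
  have hlim2 : Tendsto (fun n => ‖(hy n).toLp _‖ * C) atTop (𝓝 0) := by
    have := (hlim'.sqrt).mul_const C
    simpa [Real.sqrt_sq] using this
  refine squeeze_zero_norm (fun n => ?_) hlim2
  rw [e]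
  exact (norm_inner_le_norm _ _).trans (mul_le_mul_of_nonneg_left (hC n) (norm_nonneg _))

theorem memLp_magD {A : Space → Fin 3 → ℝ} (hA : LocallySqIntegrable A) {φ : Space → ℂ}
    (hφ : IsTest φ) (j : Fin 3) : MemLp (magD A φ j) 2 volume := by
  have := isAddHaarMeasure_volume
  have c1 : Continuous fun x => fderiv ℝ φ x (dir j) :=
    (hφ.1.continuous_fderiv (by simp)).clm_apply continuous_const
  have : MemLp (fun x => fderiv ℝ φ x (dir j)) 2 volume :=
    c1.memLp_of_hasCompactSupport (hφ.2.fderiv_apply ℝ (dir j))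
  exact (this.const_mul Complex.I).add (hA φ hφ j)

/-- The operator is not Fredholm at any point of `[B₀, ∞)`. -/
theorem not_isFredholmAt_magneticHamiltonian_of_le {B₀ : ℝ} (hB₀ : 0 < B₀) {g η : ℝ → ℝ}
    (hi : AssumptionI g) (hii : AssumptionII B₀ g η) (t : ℝ) (ht : B₀ ≤ t) :
    ¬ IsFredholmAt (magneticHamiltonian B₀ g η) t := by
  obtain ⟨-, -, -, hf, -⟩ := hi
  obtain ⟨hηpos, -, hη, -, hηdec⟩ := hii
  obtain ⟨M, hM0, hM⟩ := MemLp.exists_ae_abs_le hf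
  obtain ⟨Mη, hη0, hηM⟩ := MemLp.exists_ae_abs_le hη
  obtain ⟨K, hK1, hK⟩ := exists_chi_bound
  have hA := locallySqIntegrable_vectorPotential B₀ hf hη
  set k := √(t - B₀) with hk
  have htk : t = B₀ + k ^ 2 := by rw [hk, Real.sq_sqrt (by linarith)]; ring
  set E : Space → ℝ := fun x => η x.2.2 * fluxPot g x.1 x.2.1 with hE
  have hδ : ∀ n : ℕ, 0 < 1 / ((n : ℝ) + 1) := fun n => by positivity
  choose R hR using fun n : ℕ => hηdec _ (hδ n)
  -- The scale tends to infinity, and the Weyl region, where `x₃ ≥ ℓ n`, lies where `η ≤ 1 / (n +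
  -- 1)`. No decay of `f` is needed: its essential bound `M` suffices.
  set ℓ : ℕ → ℝ := fun n => max (n + 1) (R n) with hℓ
  have hℓn : ∀ n : ℕ, (n : ℝ) + 1 ≤ ℓ n := fun n => le_max_left _ _
  have hℓ1 : ∀ n, 1 ≤ ℓ n := fun n => le_trans (by simp) (hℓn n)
  have hℓ0 : ∀ n, 0 < ℓ n := fun n => one_pos.trans_le (hℓ1 n)
  have hEsmall : ∀ n : ℕ, ∀ᵐ x : Space, x.2 ∈ weylRegion (ℓ n) →
      |E x| ≤ M * (1 / ((n : ℝ) + 1)) := by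
    intro n
    filter_upwards [quasiMeasurePreserving_third.ae (hR n), quasiMeasurePreserving_third.ae hηpos,
      quasiMeasurePreserving_plane.ae hM] with x h1 h2 h3 hx
    have h4 : R n ≤ |x.2.2| := ((le_max_right _ _).trans hx.2.1).trans (le_abs_self _)
    rw [hE, abs_mul, abs_of_nonneg h2, mul_comm]
    exact mul_le_mul h3 (h1 h4) h2 hM0
  set ψ : ℕ → Space → ℂ := fun n => weyl B₀ k (ℓ n) with hψ
  have tψ : ∀ n, IsTest (ψ n) := fun n => isTest_weyl B₀ k (hℓ0 n)
  set Γ := 4 * √(∫⁻ x, ENNReal.ofReal (envelope B₀ x ^ 2)).toReal with hΓ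
  have hΓ0 : 0 ≤ Γ := by positivity
  have hK0 : 0 ≤ K := by linarith
  have b0 : ∀ n, ∫⁻ x, ‖ψ n x‖ₑ ^ 2 ≤ ENNReal.ofReal ((K ^ 3 * Γ) ^ 2) := fun n =>
    lintegral_le_of_envelope hB₀ (hℓ0 n)
      (Eventually.of_forall fun x hx => weyl_eq_zero (hℓ0 n) hx)
      (Eventually.of_forall fun x _ => norm_weyl_le hK (hℓ1 n) x)
  have b1 := fun n => lintegral_le_of_envelope hB₀ (hℓ0 n)
      (Eventually.of_forall fun x hx => residual_weyl_eq_zero htk (hℓ0 n) hx)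
      (Eventually.of_forall fun x _ => norm_residual_weyl_le hB₀ htk hK (hℓ1 n) x)
  have hmulE : ∀ n : ℕ, ∀ (F : Space → ℂ) (D : ℝ), (∀ x, x.2 ∉ weylRegion (ℓ n) → F x = 0) →
      (∀ x, ‖F x‖ ≤ D * envelope B₀ x.1 / ℓ n) →
      ∫⁻ x, ‖(E x : ℂ) * F x‖ₑ ^ 2 ≤
        ENNReal.ofReal ((M * (1 / ((n : ℝ) + 1)) * D * Γ) ^ 2) := by
    intro n F D hF hFD
    refine lintegral_le_of_envelope hB₀ (hℓ0 n)
      (Eventually.of_forall fun x hx => by rw [hF x hx, mul_zero]) ?_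
    filter_upwards [hEsmall n] with x hx hx'
    rw [norm_mul, Complex.norm_real, Real.norm_eq_abs]
    calc _ ≤ M * (1 / ((n : ℝ) + 1)) * (D * envelope B₀ x.1 / ℓ n) :=
          mul_le_mul (hx hx') (hFD x) (norm_nonneg _) (by positivity)
      _ = _ := by ring
  have b2 := fun n => hmulE n _ _ (fun x hx => magD_weyl_eq_zero (B₀ := B₀) (k := k) (hℓ0 n) hx)
    (fun x => norm_magD_weyl_le hB₀ hK (hℓ1 n) x)
  have b3 := fun n => hmulE n _ _ (fun x hx => weyl_eq_zero (B₀ := B₀) (k := k) (hℓ0 n) hx)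
    (fun x => norm_weyl_le hK (hℓ1 n) x)
  set p : ℕ → L2 × (Fin 3 → L2) := fun n =>
    ((tψ n).memLp.toLp _, fun j => (memLp_magD hA (tψ n) j).toLp _) with hp
  have hp1 : ∀ n, (p n).1 =ᵐ[volume] ψ n := fun n => (tψ n).memLp.coeFn_toLp
  have hp2 : ∀ n j, (p n).2 j =ᵐ[volume] magD (vectorPotential B₀ g η) (ψ n) j := fun n j =>
    (memLp_magD hA (tψ n) j).coeFn_toLp
  set C₁ := K ^ 3 * (4 * B₀ + 2 * |k| + 3) with hC₁
  have hC₁0 : 0 ≤ C₁ := by positivity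
  -- The three errors are the constant-field residual, `E` times the second component of the
  -- magnetic gradient of `ψ n`, and `E ψ n`.
  set ε : ℕ → ℝ := fun n => C₁ / ℓ n * Γ + M * (1 / ((n : ℝ) + 1)) * (K ^ 3 * (1 + B₀)) * Γ +
    M * (1 / ((n : ℝ) + 1)) * K ^ 3 * Γ with hε
  have hεlim : Tendsto ε atTop (𝓝 0) := by
    have h1 := tendsto_one_div_add_atTop_nhds_zero_nat (𝕜 := ℝ)
    have h2 : Tendsto (fun n => C₁ / ℓ n) atTop (𝓝 0) := by
      refine Tendsto.const_div_atTop (tendsto_atTop_mono hℓn ?_) _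
      exact tendsto_atTop_add_const_right _ _ tendsto_natCast_atTop_atTop
    have := ((h2.mul_const Γ).add (((h1.const_mul M).mul_const (K ^ 3 * (1 + B₀))).mul_const Γ)).add
      (((h1.const_mul M).mul_const (K ^ 3)).mul_const Γ)
    simpa [hε] using this
  refine not_isFredholmAt_of_form_weyl hA t p (fun n => ⟨ψ n, tψ n, hp1 n, hp2 n⟩)
    (√(8 * Real.exp (-B₀))) (by positivity) (fun n => ?_) (fun y => ?_) ε hεlim fun n q hq => ?_
  · have h := le_lintegral_weyl (k := k) hB₀ (hℓ1 n)
    have e : ∫⁻ x, ‖(p n).1 x‖ₑ ^ 2 = ∫⁻ x, ‖weyl B₀ k (ℓ n) x‖ₑ ^ 2 :=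
      lintegral_congr_ae ((hp1 n).mono fun x hx => by dsimp only; rw [hx])
    rw [← e, lintegral_enorm_sq, ENNReal.ofReal_le_ofReal_iff (by positivity)] at h
    exact Real.sqrt_le_iff.2 ⟨norm_nonneg _, h⟩
  · refine tendsto_inner_of_escaping (u := fun n => (p n).1) (C := K ^ 3 * Γ)
      (fun n => norm_toLp_le (tψ n).memLp (by positivity) (b0 n)) (fun n => ?_) y
    filter_upwards [hp1 n] with x hx hxn
    rw [hx]
    refine weyl_eq_zero (hℓ0 n) fun hx' => ?_
    linarith [hx'.2.1, hℓn n]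
  · have hnn : 0 ≤ 1 / ((n : ℝ) + 1) := (hδ n).le
    have hℓ' := (hℓ0 n).le
    exact norm_form_sub_le (B₀ := B₀) (E := E) (fun x => rfl) (fun x => rfl) (fun x => rfl)
      (aestronglyMeasurable_mul_plane hη.1 hf.1) (ae_abs_flux_le hM hη0 hηM) (tψ n)
      (by positivity) (by positivity) (by positivity) (b1 n) (b2 n) (b3 n) (hp1 n) (hp2 n) hq

end MagneticHole

theorem mainTheorem10 (B₀ : ℝ) (hB₀ : 0 < B₀) (g η : ℝ → ℝ)
    (hi : MagneticHole.AssumptionI g) (hii : MagneticHole.AssumptionII B₀ g η) :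
    MagneticHole.essSpectrum (MagneticHole.magneticHamiltonian B₀ g η) =
      (fun t : ℝ => (t : ℂ)) '' Set.Ici B₀ := by
  ext z
  constructor
  · intro hz
    by_cases him : z.im = 0
    · have hre : z = (z.re : ℂ) := Complex.ext rfl (by simpa using him)
      refine ⟨z.re, ?_, hre.symm⟩
      by_contra hlt
      rw [hre] at hz
      exact hz (MagneticHole.isFredholmAt_magneticHamiltonian_of_lt hi hii _ (not_le.1 hlt))
    · exact absurd (MagneticHole.isFredholmAt_of_im_ne_zero
        (MagneticHole.locallySqIntegrable_vectorPotential B₀ hi.2.2.2.1 hii.2.2.1) z him) hz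
  · rintro ⟨t, ht, rfl⟩
    exact MagneticHole.not_isFredholmAt_magneticHamiltonian_of_le hB₀ hi hii t ht
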